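/- **Setting.** Let $\mathcal S$ be a finite disjoint union of circles (a compact Hausdorff 1-manifold) with a smooth involution $\sigma$ with isolated fixed points, let $\tau(x,y)=(-x,y)$ on $\mathbb R^2$, and let $\mathcal L=\{x=0\}$. A point of $\mathcal S$ is called *free* if it is not fixed by $\sigma$. Let $\mathcal F$ be the set of smooth maps $\phi:\mathcal S\to\mathbb R^2$ with $\phi\sigma=\tau\phi$ that take distinct fixed points of $\sigma$ to distinct points. An equivariant $(m,n)$-multigerm is a germ of a smooth equivariant map along $m$ distinct free orbits $\{t_i,\sigma t_i\}$ and $n$ distinct fixed points $p_j$; the germs at these orbits and points are its free and fixed-point *branches* (a pair of symmetric branches counts as one). $J^{k,(m,n)}$ denotes the space of equivariant $k$-multijets of such multigerms; the equivariant $k$-jet at a free orbit is the ordinary $k$-jet, and the one at a fixed point is the jet of order $2k+1$. The parametric codimension of a submanifold $D\subset J^{k,(m,n)}$ is $\operatorname{pcodim}D=\operatorname{codim}D-m$. A *singularity* is a submanifold $D\subset J^{k,(m,n)}$ (for some $k,m,n$) that is invariant under equivariant right-left equivalence (local equivariant diffeomorphisms of source and target). A multigerm is a *coincidence* if its branches can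 be divided into two non-empty groups such that no image point of the first group (or its reflection) is an image point of the second. **Theorem.** For all $m,n$ there are a $K$ and finitely many singularities $W_1,\dots,W_N\subset J^{K,(m,n)}$ with $\operatorname{pcodim}W_i\ge 3$ such that the following holds. Let $D\subset J^{k,(m,n)}$, for any $k$, be a singularity with $\operatorname{pcodim}D=2$. Then every multigerm $g$ of a map in $\mathcal F$ whose $k$-multijet lies in $D$ and which is not a coincidence is of one of the following five kinds, unless its $K$-multijet lies in one of the singularities $W_i$ of parametric codimension at least $3$: 1. an *off-axis singularity*: all branches pass, up to reflection, through one point $w\notin\mathcal L$, and there is a branch with zero derivative, or two branches are (up to reflection) tangent, or there are at least three branches; 2. an *on-axis or fixed-point cusp*: $g$ consists of one branch, free and meeting $\mathcal L$, or through a fixed point, with zero derivative there; 3. an *on-axis or fixed-point ordinary strikethrough*: $g$ has at least two branches, all through one point of $\mathcal L$, and one of them is a free branch whose derivative there is non-zero, neither parallel nor perpendicular to $\mathcal L$, and not parallel to the generalized tangent line (spanned by the first non-zero derivative, which is assumed to exist) of any other branch or to the reflection of that line; 4. an *on-axis or fixed-point tangency*: either one free branch meeting $\mathcal L$ with non-zero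 vertical derivative (line tangency) or non-zero horizontal derivative (perpendicular tangency), so that it is tangent to its mirror image; or two free branches meeting on $\mathcal L$ which are tangent, possibly after reflecting one of them, with derivative neither horizontal nor vertical (oblique tangency); or one free and one fixed-point branch which are tangent to each other, the free branch being also tangent to its mirror image (fixed-point tangency); 5. a regular fixed-point branch (non-zero derivative) passing through an on-axis line tangency of order $1$: $g$ has one further branch, which is free, passes through the same point with non-zero vertical derivative, and has tangency of order exactly $1$ with its mirror image. Here two branches through the same point are *tangent* if their derivatives there are non-zero and parallel, and the tangency has order $k$ if in suitable local coordinates the branches are $t\mapsto(t,0)$ and $t\mapsto(t,h(t))$ with $h$ of leading degree $k+1$. -/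

import Mathlib

open scoped Manifold ContDiff Topology

noncomputable section

namespace EquivSing

/-! ### The plane with its reflection -/

/-- The reflection `τ (x, y) = (-x, y)` of the plane. -/
def tau (w : ℝ × ℝ) : ℝ × ℝ := (-w.1, w.2)

/-- The fixed axis `L = {x = 0}` of `τ`. -/
def axisL : Set (ℝ × ℝ) := {w | w.1 = 0}

/-- The determinant of two plane vectors; it vanishes iff they are linearly dependent. -/
def det2 (v w : ℝ × ℝ) : ℝ := v.1 * w.2 - v.2 * w.1

/-! ### The domain: a closed 1-manifold with an involution; equivariant maps -/

/-- A smooth involution with isolated fixed points. -/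
structure SmoothInvolution (S : Type*) [TopologicalSpace S] [ChartedSpace ℝ S] where
  toFun : S → S
  smooth : ContMDiff 𝓘(ℝ, ℝ) 𝓘(ℝ, ℝ) ∞ toFun
  involutive : Function.Involutive toFun
  isolated : ∀ s, toFun s = s → ∀ᶠ s' in 𝓝[≠] s, toFun s' ≠ s'

variable {S : Type*} [TopologicalSpace S] [ChartedSpace ℝ S]

instance : CoeFun (SmoothInvolution S) (fun _ => S → S) := ⟨SmoothInvolution.toFun⟩

/-- Smooth maps `φ : S → ℝ²` with `φ ∘ σ = τ ∘ φ`. -/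
structure EquivariantMap (σ : SmoothInvolution S) where
  toFun : S → ℝ × ℝ
  smooth : ContMDiff 𝓘(ℝ, ℝ) 𝓘(ℝ, ℝ × ℝ) ∞ toFun
  equivariant : ∀ s, toFun (σ s) = tau (toFun s)

instance (σ : SmoothInvolution S) : CoeFun (EquivariantMap σ) (fun _ => S → ℝ × ℝ) :=
  ⟨EquivariantMap.toFun⟩

/-- The space of equivariant maps taking distinct fixed points of `σ` to distinct points. -/
def mapsF (σ : SmoothInvolution S) : Set (EquivariantMap σ) :=
  {φ | ∀ s s', σ s = s → σ s' = s' → φ s = φ s' → s = s'}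

/-- The `i`-th derivative of `φ` at `s` in the local coordinate `e`. -/
def localDeriv (i : ℕ) (e : OpenPartialHomeomorph S ℝ) (φ : S → ℝ × ℝ) (s : S) : ℝ × ℝ :=
  iteratedDeriv i (φ ∘ e.symm) (e s)

/-- The `i`-th derivative `φ⁽ⁱ⁾(s)` in the preferred local coordinate at `s`. -/
def der (i : ℕ) (φ : S → ℝ × ℝ) (s : S) : ℝ × ℝ := localDeriv i (chartAt ℝ s) φ s

/-! ### Multigerms, equivariant multijets and their local coordinates -/

/-- An equivariant multigerm over distinct free orbits, labelled by `A`, and distinct fixed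
points, labelled by `B`.  It is given by an equivariant map (every equivariant multigerm extends
to one) and by base points; the free orbits are given by representatives. -/
structure MultiGerm (σ : SmoothInvolution S) (A B : Type) where
  map : EquivariantMap σ
  free : A → S
  fixedPt : B → S
  free_ne : ∀ a, σ (free a) ≠ free a
  free_distinct : ∀ a a', a ≠ a' → free a' ≠ free a ∧ free a' ≠ σ (free a)
  fixedPt_eq : ∀ b, σ (fixedPt b) = fixedPt b
  fixedPt_inj : Function.Injective fixedPt

/-- Restriction of a multigerm to some of its branches. -/
def MultiGerm.restrict {σ : SmoothInvolution S} {A B : Type} (g : MultiGerm σ A B)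
    (P : Set A) (Q : Set B) : MultiGerm σ P Q where
  map := g.map
  free a := g.free a
  fixedPt b := g.fixedPt b
  free_ne a := g.free_ne a
  free_distinct a a' h := g.free_distinct a a' (fun h' => h (Subtype.ext h'))
  fixedPt_eq b := g.fixedPt_eq b
  fixedPt_inj _ _ h := Subtype.ext (g.fixedPt_inj h)

/-- Two multigerms have the same equivariant `k`-multijet: same orbits, same `k`-jet at each point
of each free orbit, and same jet of order `2 k + 1` at each fixed point. (At a fixed point the
equivariant `k`-jets are the equivariant germs modulo the `(k+1)`-st power of the maximal ideal
`(t²)` of invariant germs.) -/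
def SameJet {σ : SmoothInvolution S} {A B : Type} (k : ℕ) (g g' : MultiGerm σ A B) : Prop :=
  (∀ a, (g'.free a = g.free a ∨ g'.free a = σ (g.free a)) ∧
    ∀ i ≤ k, der i g.map (g.free a) = der i g'.map (g.free a) ∧
      der i g.map (σ (g.free a)) = der i g'.map (σ (g.free a))) ∧
  (∀ b, g'.fixedPt b = g.fixedPt b ∧
    ∀ i ≤ 2 * k + 1, der i g.map (g.fixedPt b) = der i g'.map (g.fixedPt b))

/-- Having the same multijet is an equivalence relation. -/
def jetSetoid (σ : SmoothInvolution S) (A B : Type) (k : ℕ) : Setoid (MultiGerm σ A B) where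
  r := SameJet k
  iseqv := by
    refine ⟨fun g => ⟨fun a => ⟨Or.inl rfl, fun i _ => ⟨rfl, rfl⟩⟩, fun b => ⟨rfl, fun i _ => rfl⟩⟩,
      ?_, ?_⟩
    · rintro g g' ⟨h, h'⟩
      refine ⟨fun a => ?_, fun b => ?_⟩
      · obtain ⟨h1, h2⟩ := h a
        rcases h1 with h1 | h1
        · rw [h1]
          exact ⟨Or.inl rfl, fun i hi => ⟨(h2 i hi).1.symm, (h2 i hi).2.symm⟩⟩
        · have e : σ (σ (g.free a)) = g.free a := σ.involutive _
          rw [h1, e]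
          exact ⟨Or.inr rfl, fun i hi => ⟨(h2 i hi).2.symm, (h2 i hi).1.symm⟩⟩
      · obtain ⟨h1, h2⟩ := h' b
        rw [h1]
        exact ⟨rfl, fun i hi => (h2 i hi).symm⟩
    · rintro g g' g'' ⟨h, h'⟩ ⟨l, l'⟩
      refine ⟨fun a => ?_, fun b => ?_⟩
      · obtain ⟨h1, h2⟩ := h a
        obtain ⟨l1, l2⟩ := l a
        rcases h1 with h1 | h1
        · rw [h1] at l1 l2
          exact ⟨l1, fun i hi => ⟨(h2 i hi).1.trans (l2 i hi).1, (h2 i hi).2.trans (l2 i hi).2⟩⟩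
        · have e : σ (σ (g.free a)) = g.free a := σ.involutive _
          rw [h1, e] at l1 l2
          exact ⟨l1.symm, fun i hi =>
            ⟨(h2 i hi).1.trans (l2 i hi).2, (h2 i hi).2.trans (l2 i hi).1⟩⟩
      · obtain ⟨h1, h2⟩ := h' b
        obtain ⟨l1, l2⟩ := l' b
        rw [h1] at l1 l2
        exact ⟨l1, fun i hi => (h2 i hi).trans (l2 i hi)⟩

/-- The equivariant multijet space over `A`-labelled free orbits and `B`-labelled fixed points. -/
def MultiJet (σ : SmoothInvolution S) (k : ℕ) (A B : Type) : Type _ :=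
  Quotient (jetSetoid σ A B k)

/-- The `k`-multijet of a multigerm. -/
def MultiGerm.jet {σ : SmoothInvolution S} {A B : Type} (k : ℕ) (g : MultiGerm σ A B) :
    MultiJet σ k A B :=
  Quotient.mk (jetSetoid σ A B k) g

/-- The model space of the local coordinates on the multijet space: for each free orbit the
position of the base point and the derivatives of order `0, …, k`; for each fixed point
the pairs `(x⁽²ʲ⁺¹⁾, y⁽²ʲ⁾)`, `j = 0, …, k` (the other derivatives vanish by equivariance). -/
abbrev JetCoord (k : ℕ) (A B : Type) : Type :=
  (A → ℝ × (Fin (k + 1) → ℝ × ℝ)) × (B → Fin (k + 1) → ℝ × ℝ)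

/-- The data of a local coordinate system on the multijet space: a local coordinate on `S` for
each free orbit, and around each fixed point a local coordinate in which `σ` is `t ↦ -t`. -/
structure JetChart (σ : SmoothInvolution S) (A B : Type) where
  freeChart : A → OpenPartialHomeomorph S ℝ
  freeChart_mem : ∀ a, freeChart a ∈ IsManifold.maximalAtlas 𝓘(ℝ, ℝ) ∞ S
  basePt : B → S
  fixedChart : B → OpenPartialHomeomorph S ℝ
  fixedChart_mem : ∀ b, fixedChart b ∈ IsManifold.maximalAtlas 𝓘(ℝ, ℝ) ∞ S
  basePt_mem : ∀ b, basePt b ∈ (fixedChart b).source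
  basePt_zero : ∀ b, fixedChart b (basePt b) = 0
  symmetric : ∀ b, ∀ s ∈ (fixedChart b).source,
    σ s ∈ (fixedChart b).source ∧ fixedChart b (σ s) = - fixedChart b s

/-- The base points of `g` lie in the domain of the coordinate system. -/
def JetChart.Domain {σ : SmoothInvolution S} {A B : Type} (c : JetChart σ A B)
    (g : MultiGerm σ A B) : Prop :=
  (∀ a, g.free a ∈ (c.freeChart a).source) ∧ ∀ b, g.fixedPt b = c.basePt b

/-- The local coordinates of the `k`-multijet of `g`. -/
def JetChart.coord {σ : SmoothInvolution S} {A B : Type} (c : JetChart σ A B) (k : ℕ)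
    (g : MultiGerm σ A B) : JetCoord k A B :=
  (fun a => (c.freeChart a (g.free a),
      fun i => localDeriv i (c.freeChart a) g.map (g.free a)),
    fun b j => ((localDeriv (2 * j + 1) (c.fixedChart b) g.map (g.fixedPt b)).1,
      (localDeriv (2 * j) (c.fixedChart b) g.map (g.fixedPt b)).2))

/-- `D` is a smooth submanifold of codimension `w` of the multijet space: near each of its points
it is, in local coordinates, the zero set of a submersion to `ℝʷ`. -/
def IsSubmanifold {σ : SmoothInvolution S} {A B : Type} [Fintype A] [Fintype B] {k : ℕ}
    (w : ℕ) (D : Set (MultiJet σ k A B)) : Prop :=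
  ∀ g : MultiGerm σ A B, g.jet k ∈ D →
    ∃ c : JetChart σ A B, c.Domain g ∧
      ∃ U : Set (JetCoord k A B), IsOpen U ∧ c.coord k g ∈ U ∧
        ∃ F : JetCoord k A B → (Fin w → ℝ), ContDiffOn ℝ ∞ F U ∧
          (∀ x ∈ U, Function.Surjective (fderiv ℝ F x)) ∧
          ∀ g' : MultiGerm σ A B, c.Domain g' → c.coord k g' ∈ U →
            (g'.jet k ∈ D ↔ F (c.coord k g') = 0)

/-- `D` is a submanifold of parametric codimension `r`: its codimension minus the number of
free orbits is `r`. -/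
def HasPcodim {σ : SmoothInvolution S} {A B : Type} [Fintype A] [Fintype B] {k : ℕ}
    (D : Set (MultiJet σ k A B)) (r : ℤ) : Prop :=
  ∃ w : ℕ, IsSubmanifold w D ∧ (w : ℤ) - Fintype.card A = r

/-! ### Right-left equivalence -/

/-- Equivariant right-left equivalence of multigerms. -/
def RLEquiv {σ : SmoothInvolution S} {A B : Type} (g g' : MultiGerm σ A B) : Prop :=
  ∃ (hR : OpenPartialHomeomorph S S) (hL : OpenPartialHomeomorph (ℝ × ℝ) (ℝ × ℝ)),
    ContMDiffOn 𝓘(ℝ, ℝ) 𝓘(ℝ, ℝ) ∞ hR hR.source ∧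
    ContMDiffOn 𝓘(ℝ, ℝ) 𝓘(ℝ, ℝ) ∞ hR.symm hR.target ∧
    ContDiffOn ℝ ∞ hL hL.source ∧ ContDiffOn ℝ ∞ hL.symm hL.target ∧
    (∀ s ∈ hR.source, σ s ∈ hR.source ∧ hR (σ s) = σ (hR s)) ∧
    (∀ w ∈ hL.source, tau w ∈ hL.source ∧ hL (tau w) = tau (hL w)) ∧
    (∀ a, g.free a ∈ hR.source ∧
      (hR (g.free a) = g'.free a ∨ hR (g.free a) = σ (g'.free a))) ∧
    (∀ b, g.fixedPt b ∈ hR.source ∧ hR (g.fixedPt b) = g'.fixedPt b) ∧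
    (∀ s ∈ hR.source, g.map s ∈ hL.source ∧ hL (g.map s) = g'.map (hR s))

/-- `D` is a union of (jets of) right-left equivalence classes. -/
def RLInvariant {σ : SmoothInvolution S} {A B : Type} {k : ℕ}
    (D : Set (MultiJet σ k A B)) : Prop :=
  ∀ g g' : MultiGerm σ A B, RLEquiv g g' → g.jet k ∈ D → g'.jet k ∈ D

/-- A singularity: a class of multijets that is invariant under right-left equivalence and is a
submanifold of parametric codimension `r`. -/
def IsSingularity {σ : SmoothInvolution S} {A B : Type} [Fintype A] [Fintype B] {k : ℕ}
    (D : Set (MultiJet σ k A B)) (r : ℤ) : Prop :=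
  RLInvariant D ∧ HasPcodim D r

/-! ### Coincidences -/

/-- The image points of a multigerm. -/
def MultiGerm.image {σ : SmoothInvolution S} {A B : Type} (g : MultiGerm σ A B) : Set (ℝ × ℝ) :=
  {w | (∃ a, w = g.map (g.free a)) ∨ (∃ a, w = g.map (σ (g.free a))) ∨
    ∃ b, w = g.map (g.fixedPt b)}

/-- The coincidence `D₁ ⊠ D₂`, where `D₁` lives over the labels in `P`, `Q` and `D₂` over the
remaining labels. -/
def coincidence {σ : SmoothInvolution S} {A B : Type} (P : Set A) (Q : Set B) {k₁ k₂ : ℕ}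
    (D₁ : Set (MultiJet σ k₁ P Q)) (D₂ : Set (MultiJet σ k₂ ↥Pᶜ ↥Qᶜ)) :
    Set (MultiJet σ (max k₁ k₂) A B) :=
  {z | ∃ g : MultiGerm σ A B, g.jet (max k₁ k₂) = z ∧
    (g.restrict P Q).jet k₁ ∈ D₁ ∧ (g.restrict Pᶜ Qᶜ).jet k₂ ∈ D₂ ∧
    Disjoint (g.restrict P Q).image (g.restrict Pᶜ Qᶜ).image}

/-- The multigerm `g` is a coincidence: it belongs to some `D₁ ⊠ D₂`, where each of the two
parts involves at least one branch. -/
def IsCoincidence {σ : SmoothInvolution S} {A B : Type} (g : MultiGerm σ A B) : Prop :=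
  ∃ (P : Set A) (Q : Set B), (P.Nonempty ∨ Q.Nonempty) ∧ (Pᶜ.Nonempty ∨ Qᶜ.Nonempty) ∧
    ∃ (k₁ k₂ : ℕ) (D₁ : Set (MultiJet σ k₁ P Q)) (D₂ : Set (MultiJet σ k₂ ↥Pᶜ ↥Qᶜ)),
      g.jet (max k₁ k₂) ∈ coincidence P Q D₁ D₂

/-! ### Tangencies and generalized tangent lines -/

/-- The branches of `φ` through `s` and `s'` are tangent. -/
def IsTangency (φ : S → ℝ × ℝ) (s s' : S) : Prop :=
  φ s = φ s' ∧ der 1 φ s ≠ 0 ∧ der 1 φ s' ≠ 0 ∧ det2 (der 1 φ s) (der 1 φ s') = 0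

/-- The branches through `s` and `s'` are tangent of order `k`: in suitable local coordinates
(not required to be equivariant) they are `t ↦ (t, 0)` and `t ↦ (t, h t)` with `h` of leading
degree `k + 1`. -/
def IsTangencyOfOrder (k : ℕ) (φ : S → ℝ × ℝ) (s s' : S) : Prop :=
  IsTangency φ s s' ∧
  ∃ (e e' : OpenPartialHomeomorph S ℝ) (Ψ : OpenPartialHomeomorph (ℝ × ℝ) (ℝ × ℝ)) (h : ℝ → ℝ),
    e ∈ IsManifold.maximalAtlas 𝓘(ℝ, ℝ) ∞ S ∧ e' ∈ IsManifold.maximalAtlas 𝓘(ℝ, ℝ) ∞ S ∧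
    s ∈ e.source ∧ e s = 0 ∧ s' ∈ e'.source ∧ e' s' = 0 ∧
    ContDiffOn ℝ ∞ Ψ Ψ.source ∧ ContDiffOn ℝ ∞ Ψ.symm Ψ.target ∧ φ s ∈ Ψ.source ∧
    ContDiffAt ℝ ∞ h 0 ∧
    (∀ᶠ t in 𝓝 (0 : ℝ), Ψ (φ (e.symm t)) = (t, 0)) ∧
    (∀ᶠ t in 𝓝 (0 : ℝ), Ψ (φ (e'.symm t)) = (t, h t)) ∧
    (∀ i ≤ k, iteratedDeriv i h 0 = 0) ∧ iteratedDeriv (k + 1) h 0 ≠ 0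

/-- `v` is the first non-vanishing derivative of `φ` at `s`; it spans the generalized tangent
line. -/
def IsGenTangent (φ : S → ℝ × ℝ) (s : S) (v : ℝ × ℝ) : Prop :=
  ∃ m : ℕ, 1 ≤ m ∧ (∀ i, 1 ≤ i → i < m → der i φ s = 0) ∧ der m φ s = v ∧ v ≠ 0

/-- The generalized tangent line of `φ` at `s` exists, and neither it nor its reflection is
parallel to `u`. -/
def TransverseToGenTangent (u : ℝ × ℝ) (φ : S → ℝ × ℝ) (s : S) : Prop :=
  ∃ v, IsGenTangent φ s v ∧ det2 u v ≠ 0 ∧ det2 u (tau v) ≠ 0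

/-! ### The five kinds -/

section Kinds

variable {σ : SmoothInvolution S} {A B : Type}

/-- Off-axis singularity: all branches pass through `{w, τ w}` for some `w ∉ L`, and there is a
cusp, or a tangency of two branches, or a multiple point with at least three branches. -/
def IsOffAxisSingularity (g : MultiGerm σ A B) : Prop :=
  (∃ w, w ∉ axisL ∧ IsEmpty B ∧ ∀ a, g.map (g.free a) = w ∨ g.map (g.free a) = tau w) ∧
  ((∃ a, der 1 g.map (g.free a) = 0) ∨
    (∃ a a', a ≠ a' ∧ (IsTangency g.map (g.free a) (g.free a') ∨
      IsTangency g.map (g.free a) (σ (g.free a')))) ∨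
    (∃ a₁ a₂ a₃ : A, a₁ ≠ a₂ ∧ a₁ ≠ a₃ ∧ a₂ ≠ a₃))

/-- On-axis cusp: a single free branch with vanishing derivative at a point of `L`. -/
def IsOnAxisCusp (g : MultiGerm σ A B) : Prop :=
  IsEmpty B ∧ ∃ a, (∀ a', a' = a) ∧ g.map (g.free a) ∈ axisL ∧ der 1 g.map (g.free a) = 0

/-- Fixed-point cusp: a single fixed-point branch with vanishing derivative. -/
def IsFixedPointCusp (g : MultiGerm σ A B) : Prop :=
  IsEmpty A ∧ ∃ b, (∀ b', b' = b) ∧ der 1 g.map (g.fixedPt b) = 0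

/-- On-axis or fixed-point ordinary strikethrough: all branches pass through one point of `L`,
there is at least one other branch besides the free branch `a`, and the derivative of the latter
is non-zero, neither parallel nor perpendicular to `L`, and not parallel to the generalized
tangent line of any other branch or its reflection. -/
def IsAxialOrdinaryStrikethrough (g : MultiGerm σ A B) : Prop :=
  ∃ w ∈ axisL, (∀ a, g.map (g.free a) = w) ∧ (∀ b, g.map (g.fixedPt b) = w) ∧
  ∃ a, ((∃ a', a' ≠ a) ∨ Nonempty B) ∧
    (der 1 g.map (g.free a)).1 ≠ 0 ∧ (der 1 g.map (g.free a)).2 ≠ 0 ∧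
    (∀ a', a' ≠ a → TransverseToGenTangent (der 1 g.map (g.free a)) g.map (g.free a')) ∧
    (∀ b, TransverseToGenTangent (der 1 g.map (g.free a)) g.map (g.fixedPt b))

/-- On-axis line tangency: a single free branch meeting `L` and tangent to its mirror image, with
vertical derivative. -/
def IsLineTangency (g : MultiGerm σ A B) : Prop :=
  IsEmpty B ∧ ∃ a, (∀ a', a' = a) ∧ g.map (g.free a) ∈ axisL ∧
    IsTangency g.map (g.free a) (σ (g.free a)) ∧ (der 1 g.map (g.free a)).1 = 0

/-- On-axis perpendicular tangency: the same with horizontal derivative. -/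
def IsPerpendicularTangency (g : MultiGerm σ A B) : Prop :=
  IsEmpty B ∧ ∃ a, (∀ a', a' = a) ∧ g.map (g.free a) ∈ axisL ∧
    IsTangency g.map (g.free a) (σ (g.free a)) ∧ (der 1 g.map (g.free a)).2 = 0

/-- On-axis oblique tangency: two free branches that meet on `L` and are tangent (possibly after
reflecting one of them), with derivative neither horizontal nor vertical. -/
def IsObliqueTangency (g : MultiGerm σ A B) : Prop :=
  IsEmpty B ∧ ∃ a₁ a₂, a₁ ≠ a₂ ∧ (∀ a, a = a₁ ∨ a = a₂) ∧ g.map (g.free a₁) ∈ axisL ∧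
    (IsTangency g.map (g.free a₁) (g.free a₂) ∨ IsTangency g.map (g.free a₁) (σ (g.free a₂))) ∧
    (der 1 g.map (g.free a₁)).1 ≠ 0 ∧ (der 1 g.map (g.free a₁)).2 ≠ 0

/-- Fixed-point tangency: one free and one fixed-point branch that are tangent, the free branch
being also tangent to its mirror image. -/
def IsFixedPointTangency (g : MultiGerm σ A B) : Prop :=
  ∃ a b, (∀ a', a' = a) ∧ (∀ b', b' = b) ∧
    IsTangency g.map (g.free a) (g.fixedPt b) ∧ IsTangency g.map (g.free a) (σ (g.free a))

/-- The special case: one free branch with an on-axis line tangency of order 1 and one regular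
fixed-point branch through the same point. -/
def IsFixedThroughLineTangency (g : MultiGerm σ A B) : Prop :=
  ∃ a b, (∀ a', a' = a) ∧ (∀ b', b' = b) ∧
    g.map (g.free a) = g.map (g.fixedPt b) ∧ der 1 g.map (g.fixedPt b) ≠ 0 ∧
    IsTangencyOfOrder 1 g.map (g.free a) (σ (g.free a)) ∧ (der 1 g.map (g.free a)).1 = 0

end Kinds

end EquivSing

end

open EquivSing

noncomputable section

namespace EquivSing

open Filter Asymptotics

section

/-! ### Vanishing order of smooth functions of one variable -/

/-! The exceptional singularities are chosen over multigerms all of whose branches pass through one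
point of the axis. That incidence alone has parametric codimension `m + n - 1`: there are `m`
equations `x = 0` and `m + n - 1` equalities of heights, and `m` is subtracted. Every further
second-order condition adds one. `LinStratum` imposes a set of vanishing conditions on `x'`, `y'`,
`x''` of free branches and on `x'`, `y''` of fixed-point branches. `TangentStratum` imposes
tangency, up to reflection, of two oblique free branches. The strata of parametric codimension at
least three form a finite list, and two-jets suffice. They are invariant because an equivariant
diffeomorphism of the plane preserves the axis and has a diagonal derivative there
(`AxisRel.holdsIn`, `AxisRel.tangentIn`). They are submanifolds because their equations are
submersive (`isSubmanifold_of_eq_zero`).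

If `g` is not a coincidence, its branches lie over a single orbit of `tau` (`exists_common_image`).
Suppose that this orbit is on the axis and that `g` avoids the list. Then there is at most one
fixed-point branch, because the map separates fixed points. There are at most three branches, and at
most `3 - m - n` conditions can hold together. With two or three branches this counting alone,
without `D`, leaves only the kinds of the theorem.

With a single branch, or off the axis, what remains to be excluded are the stable germs: a regular
fixed-point branch, an oblique crossing of the axis, an immersed branch off the axis, and two
transverse branches off the axis. Here `D` enters. The derivative of a submersion defining `D` is a
surjection onto a space of dimension `m + 2` that kills all directions tangent to the right-left
class of `g` (`IsSingularity.exists_linearMap`). Such directions come from equivariant vector fields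
on the plane (`isOrbitDirection_fieldJet`) and from moving the base points of free branches
(`isOrbitDirection_move`). In the four cases they span a subspace of codimension at most 0, 2, 2, 3,
whereas `m + 2` is 2, 3, 3, 4, a contradiction.

Enough vector fields exist by a triangular argument: if `f` and `u` vanish along a curve to orders
`d` and `e`, then `f * u ^ j` has order `d + e * j`, so linear combinations realize prescribed
derivatives in these orders (`exists_comb_iteratedDeriv`). For two branches, `exists_separating`
supplies fields that act on one branch and are flat along the other. -/

theorem iteratedDeriv_fst {γ : ℝ → ℝ × ℝ} {t : ℝ} {n : ℕ} (h : ContDiffAt ℝ n γ t) :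
    (iteratedDeriv n γ t).1 = iteratedDeriv n (fun u => (γ u).1) t := by
  have := (ContinuousLinearMap.fst ℝ ℝ ℝ).iteratedFDeriv_comp_left h (le_refl _)
  rw [iteratedDeriv_eq_iteratedFDeriv, iteratedDeriv_eq_iteratedFDeriv]
  exact (congrArg (fun L => L (fun _ => (1 : ℝ))) this).symm

theorem iteratedDeriv_snd {γ : ℝ → ℝ × ℝ} {t : ℝ} {n : ℕ} (h : ContDiffAt ℝ n γ t) :
    (iteratedDeriv n γ t).2 = iteratedDeriv n (fun u => (γ u).2) t := by
  have := (ContinuousLinearMap.snd ℝ ℝ ℝ).iteratedFDeriv_comp_left h (le_refl _)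
  rw [iteratedDeriv_eq_iteratedFDeriv, iteratedDeriv_eq_iteratedFDeriv]
  exact (congrArg (fun L => L (fun _ => (1 : ℝ))) this).symm

theorem _root_.ContDiffAt.nat {E F : Type*} [NormedAddCommGroup E] [NormedSpace ℝ E]
    [NormedAddCommGroup F] [NormedSpace ℝ F] {f : E → F} {x : E}
    (h : ContDiffAt ℝ ∞ f x) (n : ℕ) : ContDiffAt ℝ n f x :=
  h.of_le (by exact_mod_cast le_top)

theorem contDiffAt_deriv {E : Type*} [NormedAddCommGroup E] [NormedSpace ℝ E] {f : ℝ → E} {t : ℝ}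
    (h : ContDiffAt ℝ ∞ f t) : ContDiffAt ℝ ∞ (deriv f) t := by
  have h1 : ContDiffAt ℝ ∞ (fderiv ℝ f) t := h.fderiv_right (m := ∞) (by simp)
  have h2 : deriv f = fun u => fderiv ℝ f u 1 := by
    ext u; exact fderiv_apply_one_eq_deriv.symm
  rw [h2]
  exact h1.clm_apply contDiffAt_const

/-- Induction on `p`: the bound for the derivative, taken on the closed ball of radius `|t - t₀|`,
gains one power by the mean value inequality. -/
theorem isBigO_pow_of_iteratedDeriv {f : ℝ → ℝ} {t₀ : ℝ} {p : ℕ} (hf : ContDiffAt ℝ ∞ f t₀)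
    (h : ∀ i < p, iteratedDeriv i f t₀ = 0) : f =O[𝓝 t₀] (fun t => (t - t₀) ^ p) := by
  induction p generalizing f with
  | zero => simpa using hf.continuousAt.norm.isBoundedUnder_le.isBigO_one ℝ
  | succ p ih =>
    have h1 := ih (contDiffAt_deriv hf) (fun i hi => by
      rw [← iteratedDeriv_succ']; exact h (i + 1) (by omega))
    have h0 : f t₀ = 0 := by simpa using h 0 (by omega)
    obtain ⟨C, hC0, hC⟩ := h1.exists_nonneg
    rw [isBigOWith_iff] at hC
    have hd : ∀ᶠ t in 𝓝 t₀, DifferentiableAt ℝ f t := by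
      have := (hf.nat 1).eventually (by simp)
      exact this.mono fun t ht => ht.differentiableAt (by simp)
    obtain ⟨ε, hε, hball⟩ := Metric.eventually_nhds_iff_ball.1 (hC.and hd)
    refine IsBigO.of_bound C (Metric.eventually_nhds_iff_ball.2 ⟨ε, hε, fun t ht => ?_⟩)
    have hsub : Metric.closedBall t₀ |t - t₀| ⊆ Metric.ball t₀ ε := fun u hu =>
      lt_of_le_of_lt hu (by simpa [Real.dist_eq] using ht)
    have := (convex_closedBall t₀ |t - t₀|).norm_image_sub_le_of_norm_deriv_le
      (f := f) (C := C * |t - t₀| ^ p) (x := t₀) (y := t)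
      (fun u hu => (hball u (hsub hu)).2) (fun u hu => by
        refine ((hball u (hsub hu)).1).trans ?_
        rw [norm_pow, Real.norm_eq_abs]
        exact mul_le_mul_of_nonneg_left (pow_le_pow_left₀ (abs_nonneg _) hu p) hC0)
      (by simp) (by simp [Real.dist_eq])
    rw [h0, sub_zero] at this
    rw [norm_pow, pow_succ, ← mul_assoc]
    exact this

theorem contDiffAt_sub_pow (t₀ t : ℝ) (c : ℝ) (i : ℕ) :
    ContDiffAt ℝ ∞ (fun u : ℝ => c * (u - t₀) ^ i) t := by fun_prop

theorem iteratedDeriv_sub_pow (t₀ c : ℝ) (i j : ℕ) :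
    iteratedDeriv j (fun u : ℝ => c * (u - t₀) ^ i) t₀ = if j = i then c * i.factorial else 0 := by
  rw [iteratedDeriv_const_mul_field,
    congrFun (iteratedDeriv_comp_sub_const j (fun u : ℝ => u ^ i) t₀) t₀]
  simp only [sub_self]
  rw [iteratedDeriv_fun_pow_zero]
  split_ifs <;> simp

/-- Big-O bounds pass through compositions directly, so this equivalence makes formulas for higher
derivatives of composites unnecessary. For the forward direction, let `i` be the order in question.
Once the lower derivatives vanish, the term `c * (t - t₀) ^ i` is a difference of two functions that
are `o((t - t₀) ^ i)`, which forces `c = 0`. -/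
theorem isBigO_pow_iff {f : ℝ → ℝ} {t₀ : ℝ} {p : ℕ} (hf : ContDiffAt ℝ ∞ f t₀) :
    f =O[𝓝 t₀] (fun t => (t - t₀) ^ p) ↔ ∀ i < p, iteratedDeriv i f t₀ = 0 := by
  refine ⟨fun h => ?_, isBigO_pow_of_iteratedDeriv hf⟩
  intro i
  induction i using Nat.strong_induction_on with
  | _ i ih =>
    intro hi
    set c : ℝ := iteratedDeriv i f t₀ / i.factorial with hc
    have hfac : (i.factorial : ℝ) ≠ 0 := by positivity
    have hg : (fun t => f t - c * (t - t₀) ^ i) =O[𝓝 t₀] (fun t => (t - t₀) ^ (i + 1)) := by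
      refine isBigO_pow_of_iteratedDeriv (hf.sub (contDiffAt_sub_pow _ _ _ _)) fun j hj => ?_
      rw [iteratedDeriv_fun_sub (hf.nat j) ((contDiffAt_sub_pow _ _ _ _).nat j),
        iteratedDeriv_sub_pow]
      rcases Nat.lt_succ_iff_lt_or_eq.1 hj with hj | rfl
      · rw [ih j hj (by omega), if_neg hj.ne, sub_zero]
      · rw [if_pos rfl, hc]; field_simp; simp
    have htend : Tendsto (fun t : ℝ => t - t₀) (𝓝 t₀) (𝓝 0) := by
      have : Continuous fun t : ℝ => t - t₀ := by fun_prop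
      simpa using this.tendsto t₀
    have hlit : ∀ q, i < q → (fun t : ℝ => (t - t₀) ^ q) =o[𝓝 t₀] (fun t => (t - t₀) ^ i) :=
      fun q hq => (isLittleO_pow_pow hq).comp_tendsto htend
    have h1 := (h.trans_isLittleO (hlit p hi)).sub
        (hg.trans_isLittleO (hlit _ (Nat.lt_succ_self i)))
    have h2 : (fun t : ℝ => c * (t - t₀) ^ i) =o[𝓝 t₀] (fun t => (t - t₀) ^ i) :=
      h1.congr_left (fun t => by ring)
    by_contra hne
    have hc0 : c ≠ 0 := by rw [hc]; exact div_ne_zero hne hfac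
    rw [isLittleO_const_mul_left_iff hc0] at h2
    have h3 := h2.def (show (0 : ℝ) < 1 / 2 by norm_num)
    have h4 := (h3.filter_mono (nhdsWithin_le_nhds (s := {t₀}ᶜ)))
    obtain ⟨t, ht1, ht2⟩ := (h4.and self_mem_nhdsWithin).exists
    have : 0 < ‖(t - t₀) ^ i‖ := norm_pos_iff.2 (pow_ne_zero _ (sub_ne_zero.2 ht2))
    linarith

/-! ### Taylor series -/

/-- The Taylor series of `f` at `t`. -/
def taylorSeries (f : ℝ → ℝ) (t : ℝ) : PowerSeries ℝ :=
  PowerSeries.mk fun n => iteratedDeriv n f t / n.factorial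

theorem coeff_taylorSeries (f : ℝ → ℝ) (t : ℝ) (n : ℕ) :
    PowerSeries.coeff n (taylorSeries f t) = iteratedDeriv n f t / n.factorial :=
  PowerSeries.coeff_mk _ _

theorem iteratedDeriv_eq_coeff (f : ℝ → ℝ) (t : ℝ) (n : ℕ) :
    iteratedDeriv n f t = n.factorial * PowerSeries.coeff n (taylorSeries f t) := by
  rw [coeff_taylorSeries]; field_simp

/-- Leibniz's rule divided by `n!`. Passing to power series over a field makes orders of vanishing
additive under products. -/
theorem taylorSeries_mul {f g : ℝ → ℝ} {t : ℝ} (hf : ContDiffAt ℝ ∞ f t)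
    (hg : ContDiffAt ℝ ∞ g t) :
    taylorSeries (fun u => f u * g u) t = taylorSeries f t * taylorSeries g t := by
  ext n
  rw [PowerSeries.coeff_mul, coeff_taylorSeries, iteratedDeriv_fun_mul (hf.nat n) (hg.nat n),
    Finset.Nat.sum_antidiagonal_eq_sum_range_succ_mk, Finset.sum_div]
  refine Finset.sum_congr rfl fun i hi => ?_
  have hi : i ≤ n := Nat.lt_succ_iff.1 (Finset.mem_range.1 hi)
  simp only [coeff_taylorSeries]
  rw [Nat.cast_choose ℝ hi]
  field_simp

theorem taylorSeries_add {f g : ℝ → ℝ} {t : ℝ} (hf : ContDiffAt ℝ ∞ f t)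
    (hg : ContDiffAt ℝ ∞ g t) :
    taylorSeries (fun u => f u + g u) t = taylorSeries f t + taylorSeries g t := by
  ext n
  rw [map_add]
  simp only [coeff_taylorSeries]
  rw [iteratedDeriv_fun_add (hf.nat n) (hg.nat n), add_div]

theorem taylorSeries_const (c : ℝ) (t : ℝ) :
    taylorSeries (fun _ => c) t = PowerSeries.C c := by
  ext n
  rw [coeff_taylorSeries, PowerSeries.coeff_C, iteratedDeriv_const]
  split_ifs with h
  · simp [h]
  · simp

theorem taylorSeries_pow {f : ℝ → ℝ} {t : ℝ} (hf : ContDiffAt ℝ ∞ f t) (n : ℕ) :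
    taylorSeries (fun u => f u ^ n) t = taylorSeries f t ^ n := by
  induction n with
  | zero => simp [taylorSeries_const]
  | succ n ih => simp only [pow_succ]; rw [taylorSeries_mul (hf.pow n) hf, ih]

theorem taylorSeries_sum {ι : Type*} (s : Finset ι) {f : ι → ℝ → ℝ} {t : ℝ}
    (hf : ∀ i, ContDiffAt ℝ ∞ (f i) t) :
    taylorSeries (fun u => ∑ i ∈ s, f i u) t = ∑ i ∈ s, taylorSeries (f i) t := by
  classical
  induction s using Finset.induction_on with
  | empty => simp [taylorSeries_const]
  | insert a s ha ih =>
    simp only [Finset.sum_insert ha]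
    rw [taylorSeries_add (hf a) (ContDiffAt.sum fun i _ => hf i), ih]

theorem order_taylorSeries_eq_one {f : ℝ → ℝ} {t : ℝ} (h0 : f t = 0) (h1 : deriv f t ≠ 0) :
    (taylorSeries f t).order = 1 := by
  have := (PowerSeries.order_eq_nat (φ := taylorSeries f t) (n := 1)).2
    ⟨by simpa [coeff_taylorSeries, iteratedDeriv_one] using h1, fun i hi => by
      obtain rfl : i = 0 := by omega
      simpa [coeff_taylorSeries] using h0⟩
  simpa using this

theorem order_taylorSeries_eq_zero {f : ℝ → ℝ} {t : ℝ} (h0 : f t ≠ 0) :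
    (taylorSeries f t).order = 0 := by
  have := (PowerSeries.order_eq_nat (φ := taylorSeries f t) (n := 0)).2
    ⟨by simpa [coeff_taylorSeries] using h0, fun i hi => by omega⟩
  simpa using this

/-- Coefficients prescribed along an arithmetic progression. -/
theorem exists_sum_mul_pow_coeff {f u : PowerSeries ℝ} {d e : ℕ} (he : 0 < e)
    (hf : f.order = d) (hu : u.order = e) (N : ℕ) (c : ℕ → ℝ) :
    ∃ a : ℕ → ℝ, ∀ i < N,
      PowerSeries.coeff (d + e * i) (∑ j ∈ Finset.range N, PowerSeries.C (a j) * (f * u ^ j))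
        = c i := by
  have hord : ∀ n : ℕ, (f * u ^ n).order = ((d + e * n : ℕ) : ℕ∞) := fun n => by
    rw [PowerSeries.order_mul, PowerSeries.order_pow, hf, hu, nsmul_eq_mul]
    push_cast
    ring
  induction N with
  | zero => exact ⟨0, fun i hi => absurd hi (by omega)⟩
  | succ N ih =>
    obtain ⟨a, ha⟩ := ih
    obtain ⟨h1, h2⟩ := PowerSeries.order_eq_nat.1 (hord N)
    set r := PowerSeries.coeff (d + e * N)
      (∑ j ∈ Finset.range N, PowerSeries.C (a j) * (f * u ^ j)) with hr
    -- The new term `f * u ^ N` has order exactly `d + e * N`: it corrects the coefficient at that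
    -- place and leaves the earlier prescribed ones alone.
    refine ⟨Function.update a N
      ((c N - r) / PowerSeries.coeff (d + e * N) (f * u ^ N)), fun i hi => ?_⟩
    rw [Finset.sum_range_succ, Finset.sum_congr rfl (g := fun j => PowerSeries.C (a j) *
        (f * u ^ j))
      (fun j hj => by rw [Function.update_of_ne (Finset.mem_range.1 hj).ne]), map_add,
      Function.update_self, PowerSeries.coeff_C_mul]
    rcases Nat.lt_succ_iff_lt_or_eq.1 hi with hi | rfl
    · rw [ha i hi, h2 (d + e * i) (Nat.add_lt_add_left (Nat.mul_lt_mul_of_pos_left hi he) d),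
        mul_zero, add_zero]
    · rw [← hr]; field_simp; ring

end

section

/-! ### The reflection -/

theorem tau_tau (v : ℝ × ℝ) : tau (tau v) = v := by simp [tau]

theorem tau_eq_self_of_axis {w : ℝ × ℝ} (hw : w.1 = 0) : tau w = w := by
  ext <;> simp [tau, hw]

/-- The reflection as a continuous linear map. -/
def tauL : ℝ × ℝ →L[ℝ] ℝ × ℝ :=
  (-ContinuousLinearMap.fst ℝ ℝ ℝ).prod (ContinuousLinearMap.snd ℝ ℝ ℝ)

theorem coe_tauL : ⇑tauL = tau := rfl

theorem contDiff_tau {n : WithTop ℕ∞} : ContDiff ℝ n tau := coe_tauL ▸ tauL.contDiff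

theorem continuous_tau : Continuous tau := coe_tauL ▸ tauL.continuous

/-! ### Changes of the source coordinate -/

variable {S : Type*} [TopologicalSpace S] [ChartedSpace ℝ S]

theorem contDiffAt_comp_symm {E : Type*} [NormedAddCommGroup E] [NormedSpace ℝ E] {f : S → E}
    {e : OpenPartialHomeomorph S ℝ} (he : e ∈ IsManifold.maximalAtlas 𝓘(ℝ, ℝ) ∞ S)
    {s : S} (hs : s ∈ e.source) (hf : ContMDiffAt 𝓘(ℝ, ℝ) 𝓘(ℝ, E) ∞ f s) :
    ContDiffAt ℝ ∞ (f ∘ e.symm) (e s) := by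
  refine contMDiffAt_iff_contDiffAt.1 (ContMDiffAt.comp (e s) ?_
    (contMDiffAt_symm_of_mem_maximalAtlas he (e.map_source hs)))
  rwa [e.left_inv hs]

/-- `ρ` is a local diffeomorphism at `s`. -/
structure SrcDiffeoAt (ρ : S → S) (s : S) : Prop where
  smooth : ContMDiffAt 𝓘(ℝ, ℝ) 𝓘(ℝ, ℝ) ∞ ρ s
  inv : ∃ ρ' : S → S, ContMDiffAt 𝓘(ℝ, ℝ) 𝓘(ℝ, ℝ) ∞ ρ' (ρ s) ∧ ∀ᶠ z in 𝓝 s, ρ' (ρ z) = z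

theorem srcDiffeoAt_id (s : S) : SrcDiffeoAt id s :=
  ⟨contMDiffAt_id, id, contMDiffAt_id, Eventually.of_forall fun _ => rfl⟩

theorem SmoothInvolution.srcDiffeoAt (σ : SmoothInvolution S) (s : S) : SrcDiffeoAt σ s :=
  ⟨σ.smooth.contMDiffAt, σ, σ.smooth.contMDiffAt, Eventually.of_forall fun z => σ.involutive z⟩

theorem SrcDiffeoAt.comp {ρ₁ ρ₂ : S → S} {s : S} (h₁ : SrcDiffeoAt ρ₁ (ρ₂ s))
    (h₂ : SrcDiffeoAt ρ₂ s) : SrcDiffeoAt (ρ₁ ∘ ρ₂) s := by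
  obtain ⟨a₁, b₁, hb₁, hc₁⟩ := h₁
  obtain ⟨a₂, b₂, hb₂, hc₂⟩ := h₂
  refine ⟨a₁.comp s a₂, b₂ ∘ b₁, ?_, ?_⟩
  · refine ContMDiffAt.comp _ ?_ hb₁
    rwa [show b₁ ((ρ₁ ∘ ρ₂) s) = ρ₂ s from hc₁.self_of_nhds]
  · filter_upwards [a₂.continuousAt.eventually hc₁, hc₂] with z h1 h2
    simp only [Function.comp_apply]
    rw [h1, h2]

/-- In coordinates, `ρ` followed by its local inverse is the identity germ, so by the chain rule the
transition function cannot have derivative zero. -/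
theorem SrcDiffeoAt.exists_transition {ρ : S → S} {s : S} (h : SrcDiffeoAt ρ s)
    {e e' : OpenPartialHomeomorph S ℝ} (he : e ∈ IsManifold.maximalAtlas 𝓘(ℝ, ℝ) ∞ S)
    (he' : e' ∈ IsManifold.maximalAtlas 𝓘(ℝ, ℝ) ∞ S) (hs : s ∈ e.source)
    (hs' : ρ s ∈ e'.source) :
    ∃ r : ℝ → ℝ, ContDiffAt ℝ ∞ r (e s) ∧ r (e s) = e' (ρ s) ∧ deriv r (e s) ≠ 0 ∧
      ∀ᶠ t in 𝓝 (e s), e'.symm (r t) = ρ (e.symm t) := by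
  obtain ⟨hρ, ρ', hρ', hinv⟩ := h
  have hr : ContDiffAt ℝ ∞ ((e' ∘ ρ) ∘ e.symm) (e s) :=
    contDiffAt_comp_symm he hs ((contMDiffAt_of_mem_maximalAtlas he' hs').comp s hρ)
  have hr' : ContDiffAt ℝ ∞ ((e ∘ ρ') ∘ e'.symm) (e' (ρ s)) :=
    contDiffAt_comp_symm he' hs' (ContMDiffAt.comp _ (contMDiffAt_of_mem_maximalAtlas he
      (by rwa [hinv.self_of_nhds])) hρ')
  have hrs : ((e' ∘ ρ) ∘ e.symm) (e s) = e' (ρ s) := by simp [e.left_inv hs]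
  have hesymm : Tendsto e.symm (𝓝 (e s)) (𝓝 s) := by
    simpa [ContinuousAt, e.left_inv hs] using e.continuousAt_symm (e.map_source hs)
  have hev : ∀ᶠ t in 𝓝 (e s), e'.symm (((e' ∘ ρ) ∘ e.symm) t) = ρ (e.symm t) := by
    have h1 : ∀ᶠ z in 𝓝 s, ρ z ∈ e'.source :=
      hρ.continuousAt.eventually (e'.open_source.mem_nhds hs')
    filter_upwards [hesymm.eventually h1] with t ht
    exact e'.left_inv ht
  refine ⟨(e' ∘ ρ) ∘ e.symm, hr, hrs, ?_, hev⟩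
  have hcomp : ((e ∘ ρ') ∘ e'.symm) ∘ ((e' ∘ ρ) ∘ e.symm) =ᶠ[𝓝 (e s)] id := by
    filter_upwards [hesymm.eventually hinv, hev, e.open_target.mem_nhds (e.map_source hs)]
      with t h1 h2 h3
    simp only [Function.comp_apply, id] at h2 ⊢
    rw [h2, h1, e.right_inv h3]
  intro h0
  have hd : HasDerivAt ((e' ∘ ρ) ∘ e.symm) 0 (e s) := by
    rw [← h0]; exact (hr.differentiableAt (by simp)).hasDerivAt
  have hd' := (hr'.differentiableAt (by simp)).hasDerivAt
  rw [← hrs] at hd'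
  have h1 := (hd'.comp (e s) hd).congr_of_eventuallyEq hcomp.symm
  have h2 := h1.unique (hasDerivAt_id (e s))
  simp at h2

/-- `f` vanishes to order `p` at `s`. -/
def Flat {E : Type*} [NormedAddCommGroup E] (p : ℕ) (e : OpenPartialHomeomorph S ℝ) (f : S → E)
    (s : S) : Prop :=
  (f ∘ e.symm) =O[𝓝 (e s)] fun t => (t - e s) ^ p

/-- The bound is pulled back along the transition function `r`, for which `r t - e' (ρ s) = O(t - e
s)`. Only a bound of `f'` by `f ∘ ρ` is needed, so changes of the target coordinates can enter as
mere estimates. -/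
theorem Flat.transfer {E E' : Type*} [NormedAddCommGroup E] [NormedAddCommGroup E'] {p : ℕ}
    {ρ : S → S} {s : S} (h : SrcDiffeoAt ρ s)
    {e e' : OpenPartialHomeomorph S ℝ} (he : e ∈ IsManifold.maximalAtlas 𝓘(ℝ, ℝ) ∞ S)
    (he' : e' ∈ IsManifold.maximalAtlas 𝓘(ℝ, ℝ) ∞ S) (hs : s ∈ e.source)
    (hs' : ρ s ∈ e'.source) {f : S → E} {f' : S → E'} (hf : f' =O[𝓝 s] (f ∘ ρ))
    (hflat : Flat p e' f (ρ s)) : Flat p e f' s := by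
  obtain ⟨r, hr, hrs, -, hev⟩ := h.exists_transition he he' hs hs'
  have hesymm : Tendsto e.symm (𝓝 (e s)) (𝓝 s) := by
    simpa [ContinuousAt, e.left_inv hs] using e.continuousAt_symm (e.map_source hs)
  have hrt : Tendsto r (𝓝 (e s)) (𝓝 (e' (ρ s))) := hrs ▸ hr.continuousAt
  have h1 : (f' ∘ e.symm) =O[𝓝 (e s)] ((f ∘ ρ) ∘ e.symm) := hf.comp_tendsto hesymm
  have h2 : ((f ∘ ρ) ∘ e.symm) =ᶠ[𝓝 (e s)] (f ∘ e'.symm) ∘ r := by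
    filter_upwards [hev] with t ht
    simp [ht]
  have h3 := hflat.comp_tendsto hrt
  have h4 : (fun t => r t - e' (ρ s)) =O[𝓝 (e s)] fun t => t - e s := by
    rw [← hrs]; exact (hr.differentiableAt (by simp)).hasDerivAt.isBigO_sub
  exact h1.trans (h2.trans_isBigO (h3.trans (h4.pow p)))

theorem flat_iff {p : ℕ} {e : OpenPartialHomeomorph S ℝ}
    (he : e ∈ IsManifold.maximalAtlas 𝓘(ℝ, ℝ) ∞ S) {s : S} (hs : s ∈ e.source) {f : S → ℝ}
    (hf : ContMDiffAt 𝓘(ℝ, ℝ) 𝓘(ℝ, ℝ) ∞ f s) :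
    Flat p e f s ↔ ∀ i < p, iteratedDeriv i (f ∘ e.symm) (e s) = 0 :=
  isBigO_pow_iff (contDiffAt_comp_symm he hs hf)

/-- The chain rule. The factor `c` is the derivative of the coordinate change and is fixed before
the maps `φ`, `φ'` and `L`. -/
theorem localDeriv_one_transfer {ρ : S → S} {s : S} (h : SrcDiffeoAt ρ s)
    {e e' : OpenPartialHomeomorph S ℝ} (he : e ∈ IsManifold.maximalAtlas 𝓘(ℝ, ℝ) ∞ S)
    (he' : e' ∈ IsManifold.maximalAtlas 𝓘(ℝ, ℝ) ∞ S) (hs : s ∈ e.source)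
    (hs' : ρ s ∈ e'.source) :
    ∃ c : ℝ, c ≠ 0 ∧ ∀ (φ φ' : S → ℝ × ℝ) (L : ℝ × ℝ → ℝ × ℝ),
      ContMDiffAt 𝓘(ℝ, ℝ) 𝓘(ℝ, ℝ × ℝ) ∞ φ (ρ s) → DifferentiableAt ℝ L (φ (ρ s)) →
      φ' =ᶠ[𝓝 s] L ∘ φ ∘ ρ →
      localDeriv 1 e φ' s = c • fderiv ℝ L (φ (ρ s)) (localDeriv 1 e' φ (ρ s)) := by
  obtain ⟨r, hr, hrs, hr0, hev⟩ := h.exists_transition he he' hs hs'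
  refine ⟨deriv r (e s), hr0, fun φ φ' L hφ hL heq => ?_⟩
  have hesymm : Tendsto e.symm (𝓝 (e s)) (𝓝 s) := by
    simpa [ContinuousAt, e.left_inv hs] using e.continuousAt_symm (e.map_source hs)
  have h1 : φ' ∘ e.symm =ᶠ[𝓝 (e s)] (L ∘ φ ∘ e'.symm) ∘ r := by
    filter_upwards [hesymm.eventually heq, hev] with t h1 h2
    simp only [Function.comp_apply] at h1 ⊢
    rw [h1, h2]
  have hγ : HasDerivAt (φ ∘ e'.symm) (localDeriv 1 e' φ (ρ s)) (r (e s)) := by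
    rw [hrs, localDeriv, iteratedDeriv_one]
    exact ((contDiffAt_comp_symm he' hs' hφ).differentiableAt (by simp)).hasDerivAt
  have hval : (φ ∘ e'.symm) (r (e s)) = φ (ρ s) := by
    rw [hrs]; simp [e'.left_inv hs']
  have hL' : HasFDerivAt L (fderiv ℝ L (φ (ρ s))) ((φ ∘ e'.symm) (r (e s))) := by
    rw [hval]; exact hL.hasFDerivAt
  have h2 := (hL'.comp_hasDerivAt _ hγ).scomp (e s) (hr.differentiableAt (by simp)).hasDerivAt
  rw [localDeriv, iteratedDeriv_one]
  exact (h2.congr_of_eventuallyEq h1).deriv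

/-! ### Equivariant local diffeomorphisms of the plane at points of the axis -/

/-- `L` is a `τ`-equivariant local diffeomorphism at the point `w` of the axis. -/
structure AxisDiffeoAt (L : ℝ × ℝ → ℝ × ℝ) (w : ℝ × ℝ) : Prop where
  axis : w.1 = 0
  smooth : ContDiffAt ℝ ∞ L w
  comm : ∀ᶠ v in 𝓝 w, L (tau v) = tau (L v)
  inj : Function.Injective (fderiv ℝ L w)

theorem AxisDiffeoAt.hasFDerivAt {L : ℝ × ℝ → ℝ × ℝ} {w : ℝ × ℝ} (h : AxisDiffeoAt L w) :
    HasFDerivAt L (fderiv ℝ L w) w := (h.smooth.differentiableAt (by simp)).hasFDerivAt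

theorem AxisDiffeoAt.axis_image {L : ℝ × ℝ → ℝ × ℝ} {w : ℝ × ℝ} (h : AxisDiffeoAt L w) :
    (L w).1 = 0 := by
  have := congrArg Prod.fst h.comm.self_of_nhds
  rw [tau_eq_self_of_axis h.axis] at this
  simp only [tau] at this
  linarith

theorem AxisDiffeoAt.fderiv_tau {L : ℝ × ℝ → ℝ × ℝ} {w : ℝ × ℝ} (h : AxisDiffeoAt L w)
    (v : ℝ × ℝ) : fderiv ℝ L w (tau v) = tau (fderiv ℝ L w v) := by
  have hw : tauL w = w := tau_eq_self_of_axis h.axis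
  have h1 : HasFDerivAt (L ∘ tauL) ((fderiv ℝ L w).comp tauL) w := by
    refine HasFDerivAt.comp w ?_ tauL.hasFDerivAt
    rw [hw]; exact h.hasFDerivAt
  have h2 : HasFDerivAt (tauL ∘ L) (tauL.comp (fderiv ℝ L w)) w :=
    tauL.hasFDerivAt.comp w h.hasFDerivAt
  have h3 := h1.unique (h2.congr_of_eventuallyEq h.comm)
  exact congrArg (fun T => T v) h3

/-- The derivative commutes with `tau`, so it preserves the two eigenlines of `tau`, which are the
coordinate axes. Injectivity makes both eigenvalues non-zero. -/
theorem AxisDiffeoAt.exists_diag {L : ℝ × ℝ → ℝ × ℝ} {w : ℝ × ℝ} (h : AxisDiffeoAt L w) :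
    ∃ α β : ℝ, α ≠ 0 ∧ β ≠ 0 ∧ ∀ v, fderiv ℝ L w v = (α * v.1, β * v.2) := by
  have e1 := h.fderiv_tau (1, 0)
  have e2 := h.fderiv_tau (0, 1)
  have t1 : tau (1, 0) = -((1, 0) : ℝ × ℝ) := by simp [tau]
  have t2 : tau (0, 1) = ((0, 1) : ℝ × ℝ) := by simp [tau]
  rw [t1, map_neg] at e1
  rw [t2] at e2
  have f1 : (fderiv ℝ L w (1, 0)).2 = 0 := by
    have := congrArg Prod.snd e1
    simp only [tau, Prod.snd_neg] at this
    linarith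
  have f2 : (fderiv ℝ L w (0, 1)).1 = 0 := by
    have := congrArg Prod.fst e2
    simp only [tau] at this
    linarith
  have key : ∀ v : ℝ × ℝ, fderiv ℝ L w v
      = ((fderiv ℝ L w (1, 0)).1 * v.1, (fderiv ℝ L w (0, 1)).2 * v.2) := fun v => by
    have hv : v = v.1 • ((1, 0) : ℝ × ℝ) + v.2 • ((0, 1) : ℝ × ℝ) := by ext <;> simp
    conv_lhs => rw [hv]
    rw [map_add, map_smul, map_smul]
    ext
    · simp [f2, mul_comm]
    · simp [f1, mul_comm]
  refine ⟨_, _, fun h0 => ?_, fun h0 => ?_, key⟩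
  · have : fderiv ℝ L w (1, 0) = fderiv ℝ L w 0 := by rw [key (1, 0), h0]; simp
    simpa using h.inj this
  · have : fderiv ℝ L w (0, 1) = fderiv ℝ L w 0 := by rw [key (0, 1), h0]; simp
    simpa using h.inj this

theorem AxisDiffeoAt.comp_tau {L : ℝ × ℝ → ℝ × ℝ} {w : ℝ × ℝ} (h : AxisDiffeoAt L w) :
    AxisDiffeoAt (L ∘ tau) w ∧ ∀ v, fderiv ℝ (L ∘ tau) w v = fderiv ℝ L w (tau v) := by
  have hw : tau w = w := tau_eq_self_of_axis h.axis
  have hd : HasFDerivAt (L ∘ tauL) ((fderiv ℝ L w).comp tauL) w := by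
    refine HasFDerivAt.comp w ?_ tauL.hasFDerivAt
    rw [coe_tauL, hw]; exact h.hasFDerivAt
  have hd' : fderiv ℝ (L ∘ tau) w = (fderiv ℝ L w).comp tauL := hd.fderiv
  refine ⟨⟨h.axis, ?_, ?_, ?_⟩, fun v => by rw [hd']; rfl⟩
  · refine ContDiffAt.comp w ?_ contDiff_tau.contDiffAt
    rw [hw]; exact h.smooth
  · have : Tendsto tau (𝓝 w) (𝓝 w) := by simpa [hw] using continuous_tau.tendsto w
    exact this.eventually h.comm
  · rw [hd']
    intro a b hab
    have := h.inj hab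
    simpa [coe_tauL, tau_tau] using congrArg tau this

theorem AxisDiffeoAt.isBigO_sub {L : ℝ × ℝ → ℝ × ℝ} {w : ℝ × ℝ} (h : AxisDiffeoAt L w) :
    (fun v => L v - L w) =O[𝓝 w] fun v => v - w := h.hasFDerivAt.isBigO_sub

/-- Compare `v` with its projection `(0, v.2)`: the projection is sent into the axis by
equivariance, and `L` is locally Lipschitz. -/
theorem AxisDiffeoAt.isBigO_fst {L : ℝ × ℝ → ℝ × ℝ} {w : ℝ × ℝ} (h : AxisDiffeoAt L w) :
    (fun v => (L v).1) =O[𝓝 w] fun v => v.1 := by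
  obtain ⟨K, t, ht, hK⟩ := (h.smooth.nat 1).exists_lipschitzOnWith
  have hproj : Tendsto (fun v : ℝ × ℝ => ((0, v.2) : ℝ × ℝ)) (𝓝 w) (𝓝 w) := by
    have : Continuous fun v : ℝ × ℝ => ((0, v.2) : ℝ × ℝ) := by fun_prop
    have h2 := this.tendsto w
    rwa [show ((0, w.2) : ℝ × ℝ) = w from Prod.ext h.axis.symm rfl] at h2
  refine IsBigO.of_bound K ?_
  filter_upwards [ht, hproj.eventually ht, hproj.eventually h.comm] with v h1 h2 h3
  have h0 : (L (0, v.2)).1 = 0 := by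
    have := congrArg Prod.fst h3
    rw [tau_eq_self_of_axis rfl] at this
    simp only [tau] at this
    linarith
  have h4 := hK.dist_le_mul v h1 (0, v.2) h2
  rw [dist_eq_norm, dist_eq_norm] at h4
  calc ‖(L v).1‖ = ‖(L v - L (0, v.2)).1‖ := by simp [h0]
    _ ≤ ‖L v - L (0, v.2)‖ := norm_fst_le _
    _ ≤ K * ‖v - (0, v.2)‖ := h4
    _ = K * ‖v.1‖ := by
      congr 1
      rw [Prod.norm_def]
      simp

/-! ### Right-left equivalence at points of the axis -/

variable {σ : SmoothInvolution S} {A B : Type}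

/-- Near each of its branches, which all pass through the point `w` of the axis, the multigerm `g`
is taken to `g'` by coordinate changes in the source and the local diffeomorphism `L`, up to
reflection. -/
structure AxisRel (g g' : MultiGerm σ A B) (w : ℝ × ℝ) (L : ℝ × ℝ → ℝ × ℝ) : Prop where
  diffeo : AxisDiffeoAt L w
  free_eq : ∀ a, g.map (g.free a) = w
  fixed_eq : ∀ b, g.map (g.fixedPt b) = w
  free : ∀ a, ∃ ρ L', (L' = L ∨ L' = L ∘ tau) ∧ SrcDiffeoAt ρ (g'.free a) ∧
    ρ (g'.free a) = g.free a ∧ g'.map =ᶠ[𝓝 (g'.free a)] L' ∘ g.map ∘ ρ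
  fixed : ∀ b, ∃ ρ, SrcDiffeoAt ρ (g'.fixedPt b) ∧ ρ (g'.fixedPt b) = g.fixedPt b ∧
    g'.map =ᶠ[𝓝 (g'.fixedPt b)] L ∘ g.map ∘ ρ

theorem axisDiffeoAt_id {w : ℝ × ℝ} (hw : w.1 = 0) : AxisDiffeoAt id w :=
  ⟨hw, contDiffAt_id, Eventually.of_forall fun _ => rfl, by
    rw [fderiv_id]; exact fun _ _ h => h⟩

theorem AxisRel.refl {g : MultiGerm σ A B} {w : ℝ × ℝ} (hw : w.1 = 0)
    (hA : ∀ a, g.map (g.free a) = w) (hB : ∀ b, g.map (g.fixedPt b) = w) : AxisRel g g w id :=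
  ⟨axisDiffeoAt_id hw, hA, hB,
    fun _ => ⟨id, id, Or.inl rfl, srcDiffeoAt_id _, rfl, EventuallyEq.rfl⟩,
    fun _ => ⟨id, srcDiffeoAt_id _, rfl, EventuallyEq.rfl⟩⟩

/-- The source changes `ρ` run from `g'` back to `g`, so they are built from the inverse of `hR`. At
least one branch is needed to know that `w` lies in the domain of `hL`. -/
theorem RLEquiv.exists_axisRel {g g' : MultiGerm σ A B} (h : RLEquiv g g') {w : ℝ × ℝ}
    (hw : w.1 = 0) (hA : ∀ a, g.map (g.free a) = w) (hB : ∀ b, g.map (g.fixedPt b) = w)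
    (hne : Nonempty (A ⊕ B)) :
    ∃ L, AxisRel g g' w L := by
  obtain ⟨hR, hL, hR1, hR2, hL1, hL2, hRσ, hLτ, ha, hb, hm⟩ := h
  have hwL : w ∈ hL.source := by
    rcases hne with ⟨a | b⟩
    · rw [← hA a]; exact (hm _ (ha a).1).1
    · rw [← hB b]; exact (hm _ (hb b).1).1
  have hsrc : ∀ s ∈ hR.source, SrcDiffeoAt hR.symm (hR s) ∧ hR.symm (hR s) = s ∧
      g'.map =ᶠ[𝓝 (hR s)] hL ∘ g.map ∘ hR.symm := fun s hs => by
    have hs' := hR.map_source hs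
    refine ⟨⟨(hR2 _ hs').contMDiffAt (hR.open_target.mem_nhds hs'), hR, ?_, ?_⟩,
      hR.left_inv hs, ?_⟩
    · rw [hR.left_inv hs]
      exact (hR1 _ hs).contMDiffAt (hR.open_source.mem_nhds hs)
    · filter_upwards [hR.open_target.mem_nhds hs'] with z hz using hR.right_inv hz
    · filter_upwards [hR.open_target.mem_nhds hs'] with z hz
      have := (hm _ (hR.map_target hz)).2
      rw [hR.right_inv hz] at this
      exact this.symm
  refine ⟨hL, ⟨hw, (hL1 w hwL).contDiffAt
      (hL.open_source.mem_nhds hwL), ?_, ?_⟩, hA, hB, fun a => ?_,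
    fun b => ?_⟩
  · filter_upwards [hL.open_source.mem_nhds hwL] with v hv using (hLτ v hv).2
  · have hwt := hL.map_source hwL
    have d1 := (((hL1 w hwL).contDiffAt (hL.open_source.mem_nhds hwL)).differentiableAt
      (by simp)).hasFDerivAt
    have d2 := (((hL2 _ hwt).contDiffAt (hL.open_target.mem_nhds hwt)).differentiableAt
      (by simp)).hasFDerivAt
    have d3 := (d2.comp w d1).congr_of_eventuallyEq (f₁ := id) (by
      filter_upwards [hL.open_source.mem_nhds hwL] with v hv
      exact (hL.left_inv hv).symm)
    have d4 := d3.unique (hasFDerivAt_id w)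
    refine Function.LeftInverse.injective (g := fderiv ℝ hL.symm (hL w)) fun v => ?_
    exact congrArg (fun T => T v) d4
  · obtain ⟨h1, h2⟩ := ha a
    rcases h2 with h2 | h2
    · obtain ⟨k1, k2, k3⟩ := hsrc _ h1
      rw [h2] at k1 k2 k3
      exact ⟨_, _, Or.inl rfl, k1, k2, k3⟩
    -- The representative of the orbit is swapped here: `ρ` passes through `σ`, and the reflection
    -- this causes is absorbed into `L ∘ tau`.
    · obtain ⟨h3, h4⟩ := hRσ _ h1
      obtain ⟨k1, k2, k3⟩ := hsrc _ h3
      have e : hR (σ (g.free a)) = g'.free a := by rw [h4, h2]; exact σ.involutive _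
      rw [e] at k1 k2 k3
      refine ⟨σ ∘ hR.symm, _, Or.inr rfl, (σ.srcDiffeoAt _).comp k1, ?_, ?_⟩
      · simp only [Function.comp_apply, k2]; exact σ.involutive _
      · filter_upwards [k3] with z hz
        rw [hz]
        simp only [Function.comp_apply]
        rw [g.map.equivariant, tau_tau]
  · obtain ⟨h1, h2⟩ := hb b
    obtain ⟨k1, k2, k3⟩ := hsrc _ h1
    rw [h2] at k1 k2 k3
    exact ⟨_, k1, k2, k3⟩

end

section

/-! ### Existence of local coordinates -/

variable {S : Type*} [TopologicalSpace S] [ChartedSpace ℝ S]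

/-- By the chain rule the derivative squares to one. If it were `1`, the involution would be
increasing near the fixed point. An increasing involution is the identity, since `r t < t` gives `t
= r (r t) < r t` and likewise with the inequalities reversed. This contradicts isolatedness. -/
theorem SmoothInvolution.deriv_at_fixed (σ : SmoothInvolution S) {b : S} (hb : σ b = b)
    {e : OpenPartialHomeomorph S ℝ} (he : e ∈ IsManifold.maximalAtlas 𝓘(ℝ, ℝ) ∞ S)
    (hs : b ∈ e.source) : HasDerivAt ((e ∘ σ) ∘ e.symm) (-1) (e b) := by
  set r := (e ∘ σ) ∘ e.symm with hr
  have hrsm : ContDiffAt ℝ ∞ r (e b) := contDiffAt_comp_symm he hs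
    ((contMDiffAt_of_mem_maximalAtlas he (by rwa [hb])).comp b σ.smooth.contMDiffAt)
  have hrb : r (e b) = e b := by simp [hr, e.left_inv hs, hb]
  have hesymm : Tendsto e.symm (𝓝 (e b)) (𝓝 b) := by
    simpa [ContinuousAt, e.left_inv hs] using e.continuousAt_symm (e.map_source hs)
  have hσsrc : ∀ᶠ z in 𝓝 b, σ z ∈ e.source :=
    σ.smooth.continuous.continuousAt.eventually (e.open_source.mem_nhds (by rwa [hb]))
  have hrr : ∀ᶠ t in 𝓝 (e b), r (r t) = t := by
    filter_upwards [hesymm.eventually hσsrc, e.open_target.mem_nhds (e.map_source hs)] with t h1 h2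
    simp only [hr, Function.comp_apply]
    rw [e.left_inv h1, σ.involutive, e.right_inv h2]
  have hd := (hrsm.differentiableAt (by simp)).hasDerivAt
  have hsq : deriv r (e b) * deriv r (e b) = 1 := by
    have h1 : HasDerivAt r (deriv r (e b)) (r (e b)) := by rwa [hrb]
    have h2 := (h1.comp (e b) hd).congr_of_eventuallyEq (f₁ := id)
      (hrr.mono fun t ht => ht.symm)
    exact h2.unique (hasDerivAt_id _)
  rcases mul_self_eq_one_iff.1 hsq with h1 | h1
  swap
  · rwa [h1] at hd
  exfalso
  have hpos : ∀ᶠ t in 𝓝 (e b), 0 < deriv r t :=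
    (contDiffAt_deriv hrsm).continuousAt.eventually (lt_mem_nhds (by rw [h1]; norm_num))
  have hcont : ∀ᶠ t in 𝓝 (e b), ContinuousAt r t :=
    ((hrsm.nat 1).eventually (by simp)).mono fun t ht => ht.continuousAt
  obtain ⟨ε, hε, hball⟩ := Metric.eventually_nhds_iff_ball.1 ((hpos.and hcont).and hrr)
  have hmono : StrictMonoOn r (Metric.ball (e b) ε) := by
    refine strictMonoOn_of_deriv_pos (convex_ball _ _)
      (fun t ht => (hball t ht).1.2.continuousWithinAt) fun t ht => ?_
    rw [Metric.isOpen_ball.interior_eq] at ht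
    exact (hball t ht).1.1
  have hr_t : Tendsto r (𝓝 (e b)) (𝓝 (e b)) := by simpa [ContinuousAt, hrb] using hrsm.continuousAt
  have hball' := Metric.ball_mem_nhds (e b) hε
  have hne : ∀ᶠ t in 𝓝[≠] (e b), r t ≠ t := by
    have h2 : ∀ᶠ z in 𝓝 b, z ≠ b → σ z ≠ z := eventually_nhdsWithin_iff.1 (σ.isolated b hb)
    rw [eventually_nhdsWithin_iff]
    filter_upwards [hesymm.eventually h2, hesymm.eventually hσsrc,
      e.open_target.mem_nhds (e.map_source hs)] with t h3 h4 h5 h6 h7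
    refine h3 (fun h8 => h6 ?_) ?_
    · rw [← h8, e.right_inv h5]; rfl
    · simp only [hr, Function.comp_apply] at h7
      rw [← e.left_inv h4, h7]
  have hboth : ∀ᶠ t in 𝓝 (e b), t ∈ Metric.ball (e b) ε ∧ r t ∈ Metric.ball (e b) ε :=
    Filter.Eventually.and hball' (hr_t hball')
  obtain ⟨t, h2, h3, h4⟩ := (hne.and (hboth.filter_mono nhdsWithin_le_nhds)).exists
  have h5 := (hball t h3).2
  rcases lt_or_gt_of_ne h2 with h6 | h6
  · have := hmono h4 h3 h6
    rw [h5] at this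
    exact absurd this (not_lt.2 h6.le)
  · have := hmono h3 h4 h6
    rw [h5] at this
    exact absurd this (not_lt.2 h6.le)

variable [IsManifold 𝓘(ℝ, ℝ) ∞ S]

/-- A smooth function with non-zero derivative is a local coordinate. -/
theorem exists_localCoord {f : S → ℝ} {O : Set S} (hO : IsOpen O)
    (hf : ContMDiffOn 𝓘(ℝ, ℝ) 𝓘(ℝ, ℝ) ∞ f O) {s : S} (hsO : s ∈ O)
    {e : OpenPartialHomeomorph S ℝ} (he : e ∈ IsManifold.maximalAtlas 𝓘(ℝ, ℝ) ∞ S)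
    (hs : s ∈ e.source) (hd : deriv (f ∘ e.symm) (e s) ≠ 0) :
    ∃ e' ∈ IsManifold.maximalAtlas 𝓘(ℝ, ℝ) ∞ S, s ∈ e'.source ∧ e'.source ⊆ O ∧
      ∀ z, e' z = f (e.symm (e z)) ∧ (z ∈ e'.source → e' z = f z) := by
  set F := f ∘ e.symm with hF
  have hFat : ∀ t ∈ e.target, e.symm t ∈ O → ContDiffAt ℝ ∞ F t := fun t ht htO => by
    have := contDiffAt_comp_symm he (e.map_target ht) (hf.contMDiffAt (hO.mem_nhds htO))
    rwa [e.right_inv ht] at this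
  have hes : e s ∈ e.target := e.map_source hs
  have hes' : e.symm (e s) = s := e.left_inv hs
  have hF0 := hFat (e s) hes (by rwa [hes'])
  have hder : HasFDerivAt F
      (ContinuousLinearEquiv.unitsEquivAut ℝ (Units.mk0 _ hd) : ℝ →L[ℝ] ℝ) (e s) :=
    ((hF0.differentiableAt (by simp)).hasDerivAt).hasFDerivAt_equiv hd
  let H := hF0.toOpenPartialHomeomorph F hder (by simp)
  have hHcoe : ⇑H = F := rfl
  have hHs : e s ∈ H.source := hF0.mem_toOpenPartialHomeomorph_source hder (by simp)
  let V₀ := e.target ∩ e.symm ⁻¹' O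
  have hV₀ : IsOpen V₀ := e.isOpen_inter_preimage_symm hO
  -- The inverse function theorem at `e s` yields a local inverse. Keeping the derivative non-zero
  -- on all of the domain makes that inverse smooth everywhere, as membership in the atlas requires.
  let V := V₀ ∩ (deriv F) ⁻¹' {0}ᶜ
  have hV : IsOpen V := by
    refine ContinuousOn.isOpen_inter_preimage (fun t ht => ?_) hV₀ isOpen_compl_singleton
    exact (contDiffAt_deriv (hFat t ht.1 ht.2)).continuousAt.continuousWithinAt
  have hsV : e s ∈ V := ⟨⟨hes, by simpa [hes'] using hsO⟩, hd⟩
  let H' := H.restrOpen V hV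
  let e' := e.trans H'
  have hval : ∀ z, e' z = f (e.symm (e z)) := fun z => rfl
  have hsrc : ∀ z ∈ e'.source, z ∈ e.source ∧ e z ∈ H.source ∧ e z ∈ V := fun z hz => by
    rw [OpenPartialHomeomorph.trans_source] at hz
    exact ⟨hz.1, hz.2⟩
  have hval' : ∀ z ∈ e'.source, e' z = f z := fun z hz => by
    rw [hval, e.left_inv (hsrc z hz).1]
  have hsubO : e'.source ⊆ O := fun z hz => by
    have := (hsrc z hz).2.2.1.2
    rwa [Set.mem_preimage, e.left_inv (hsrc z hz).1] at this
  refine ⟨e', ?_, ?_, hsubO, fun z => ⟨hval z, hval' z⟩⟩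
  · refine e'.mem_maximalAtlas_of_contMDiffOn ((hf.mono hsubO).congr hval') ?_
    have h1 : e'.target ⊆ H'.target := by
      rw [OpenPartialHomeomorph.trans_target]; exact Set.inter_subset_left
    have h2 : ContMDiffOn 𝓘(ℝ, ℝ) 𝓘(ℝ, ℝ) ∞ H'.symm H'.target := fun y hy => by
      have hyV : H'.symm y ∈ H.source ∧ H'.symm y ∈ V := H'.map_target hy
      have hd' : deriv F (H'.symm y) ≠ 0 := hyV.2.2
      have hsm := hFat _ hyV.2.1.1 hyV.2.1.2
      have := H'.contDiffAt_symm_deriv (f₀' := deriv F (H'.symm y)) (n := ∞) hd' hy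
        ((hsm.differentiableAt (by simp)).hasDerivAt) hsm
      exact this.contMDiffAt.contMDiffWithinAt
    refine (contMDiffOn_symm_of_mem_maximalAtlas he).comp (h2.mono h1) fun y hy => ?_
    exact ((H'.map_target (h1 hy)).2).1.1
  · rw [OpenPartialHomeomorph.trans_source]
    exact ⟨hs, hHs, hsV⟩

/-- Take the odd part `(e - e ∘ σ) / 2` of any chart. Since `σ` has derivative `-1`, this function
has derivative `1` at the fixed point and is a local coordinate there. -/
theorem SmoothInvolution.exists_symmetricChart (σ : SmoothInvolution S) {b : S} (hb : σ b = b) :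
    ∃ e ∈ IsManifold.maximalAtlas 𝓘(ℝ, ℝ) ∞ S, b ∈ e.source ∧ e b = 0 ∧
      ∀ s ∈ e.source, σ s ∈ e.source ∧ e (σ s) = - e s := by
  set e := chartAt ℝ b with he_def
  have he : e ∈ IsManifold.maximalAtlas 𝓘(ℝ, ℝ) ∞ S := IsManifold.chart_mem_maximalAtlas b
  have hs : b ∈ e.source := mem_chart_source ℝ b
  have hd := σ.deriv_at_fixed hb he hs
  have hσc : Continuous σ := σ.smooth.continuous
  let f : S → ℝ := fun z => (e z - e (σ z)) / 2
  have hO : IsOpen (e.source ∩ σ ⁻¹' e.source) :=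
    e.open_source.inter (e.open_source.preimage hσc)
  have hesm : ContMDiffOn 𝓘(ℝ, ℝ) 𝓘(ℝ, ℝ) ∞ e e.source := contMDiffOn_of_mem_maximalAtlas he
  have hf : ContMDiffOn 𝓘(ℝ, ℝ) 𝓘(ℝ, ℝ) ∞ f (e.source ∩ σ ⁻¹' e.source) := by
    have h1 : ContMDiffOn 𝓘(ℝ, ℝ) 𝓘(ℝ, ℝ) ∞ (fun z => e z - e (σ z))
        (e.source ∩ σ ⁻¹' e.source) :=
      (hesm.mono Set.inter_subset_left).sub
        (hesm.comp σ.smooth.contMDiffOn fun z hz => hz.2)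
    have h2 : ContDiff ℝ ∞ fun t : ℝ => t / 2 := by fun_prop
    exact h2.contMDiff.comp_contMDiffOn h1
  have hsO : b ∈ e.source ∩ σ ⁻¹' e.source := ⟨hs, by simpa [hb] using hs⟩
  have hderiv : HasDerivAt (f ∘ e.symm) 1 (e b) := by
    have h1 : HasDerivAt (fun t => (t - ((e ∘ σ) ∘ e.symm) t) / 2) ((1 - (-1)) / 2) (e b) :=
      ((hasDerivAt_id' _).sub hd).div_const 2
    rw [show ((1 : ℝ) - (-1)) / 2 = 1 by norm_num] at h1
    refine h1.congr_of_eventuallyEq ?_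
    filter_upwards [e.open_target.mem_nhds (e.map_source hs)] with t ht
    simp [f, e.right_inv ht]
  obtain ⟨e', he', hse', hsub, hval⟩ := exists_localCoord hO hf hsO he hs
    (by rw [hderiv.deriv]; norm_num)
  -- Shrinking the domain to its intersection with its mirror image makes it invariant under `σ`.
  have hU : IsOpen (σ ⁻¹' e'.source) := e'.open_source.preimage hσc
  refine ⟨e'.restrOpen _ hU, ?_, ⟨hse', by simpa [hb] using hse'⟩, ?_, ?_⟩
  · refine OpenPartialHomeomorph.mem_maximalAtlas_of_contMDiffOn _
      ((contMDiffOn_of_mem_maximalAtlas he').mono fun z hz => hz.1)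
      ((contMDiffOn_symm_of_mem_maximalAtlas he').mono ?_)
    intro y hy
    exact hy.1
  · change e' b = 0
    rw [(hval b).2 hse']
    simp [f, hb]
  · rintro z ⟨hz, hz'⟩
    refine ⟨⟨hz', ?_⟩, ?_⟩
    · change σ (σ z) ∈ e'.source
      rwa [σ.involutive z]
    · change e' (σ z) = - e' z
      rw [(hval _).2 hz', (hval _).2 hz]
      simp only [f]
      rw [σ.involutive z]
      ring

theorem MultiGerm.exists_jetChart {σ : SmoothInvolution S} {A B : Type} (g : MultiGerm σ A B) :
    ∃ c : JetChart σ A B, c.Domain g := by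
  choose e he h1 h2 h3 using fun b => σ.exists_symmetricChart (g.fixedPt_eq b)
  exact ⟨⟨fun a => chartAt ℝ (g.free a), fun a => IsManifold.chart_mem_maximalAtlas _, g.fixedPt,
    e, he, h1, h2, h3⟩, fun a => mem_chart_source _ _, fun b => rfl⟩

end

section

variable {S : Type*} [TopologicalSpace S] [ChartedSpace ℝ S] {σ : SmoothInvolution S} {A B : Type}

/-! ### Coordinate-free conditions on the derivatives at points of the axis -/

theorem localDeriv_zero {S : Type*} [TopologicalSpace S] {e : OpenPartialHomeomorph S ℝ}
    {φ : S → ℝ × ℝ} {s : S}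
    (hs : s ∈ e.source) : localDeriv 0 e φ s = φ s := by
  simp [localDeriv, e.left_inv hs]

theorem localDeriv_fst {e : OpenPartialHomeomorph S ℝ}
    (he : e ∈ IsManifold.maximalAtlas 𝓘(ℝ, ℝ) ∞ S) {s : S} (hs : s ∈ e.source) {φ : S → ℝ × ℝ}
    (hφ : ContMDiffAt 𝓘(ℝ, ℝ) 𝓘(ℝ, ℝ × ℝ) ∞ φ s) (i : ℕ) :
    (localDeriv i e φ s).1 = iteratedDeriv i ((fun z => (φ z).1) ∘ e.symm) (e s) :=
  iteratedDeriv_fst ((contDiffAt_comp_symm he hs hφ).nat i)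

theorem localDeriv_snd {e : OpenPartialHomeomorph S ℝ}
    (he : e ∈ IsManifold.maximalAtlas 𝓘(ℝ, ℝ) ∞ S) {s : S} (hs : s ∈ e.source) {φ : S → ℝ × ℝ}
    (hφ : ContMDiffAt 𝓘(ℝ, ℝ) 𝓘(ℝ, ℝ × ℝ) ∞ φ s) (i : ℕ) :
    (localDeriv i e φ s).2 = iteratedDeriv i ((fun z => (φ z).2) ∘ e.symm) (e s) :=
  iteratedDeriv_snd ((contDiffAt_comp_symm he hs hφ).nat i)

theorem contMDiffAt_fst {φ : S → ℝ × ℝ} {s : S}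
    (hφ : ContMDiffAt 𝓘(ℝ, ℝ) 𝓘(ℝ, ℝ × ℝ) ∞ φ s) :
    ContMDiffAt 𝓘(ℝ, ℝ) 𝓘(ℝ, ℝ) ∞ (fun z => (φ z).1) s :=
  contDiff_fst.contDiffAt.comp_contMDiffAt hφ

theorem contMDiffAt_snd {φ : S → ℝ × ℝ} {s : S}
    (hφ : ContMDiffAt 𝓘(ℝ, ℝ) 𝓘(ℝ, ℝ × ℝ) ∞ φ s) :
    ContMDiffAt 𝓘(ℝ, ℝ) 𝓘(ℝ, ℝ) ∞ (fun z => (φ z).2) s :=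
  contDiff_snd.contDiffAt.comp_contMDiffAt hφ

/-- The vanishing of a second derivative depends on the coordinate unless the first derivative
vanishes too. Flatness of order three packages both with the value into a condition that can be
transferred. -/
theorem flat_fst_iff {e : OpenPartialHomeomorph S ℝ}
    (he : e ∈ IsManifold.maximalAtlas 𝓘(ℝ, ℝ) ∞ S) {s : S} (hs : s ∈ e.source) {φ : S → ℝ × ℝ}
    (hφ : ContMDiffAt 𝓘(ℝ, ℝ) 𝓘(ℝ, ℝ × ℝ) ∞ φ s) :
    Flat 3 e (fun z => (φ z).1) s ↔ (φ s).1 = 0 ∧ (localDeriv 1 e φ s).1 = 0 ∧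
      (localDeriv 2 e φ s).1 = 0 := by
  rw [flat_iff he hs (contMDiffAt_fst hφ), ← localDeriv_zero (φ := φ) hs]
  simp only [localDeriv_fst he hs hφ]
  exact ⟨fun h => ⟨h 0 (by norm_num), h 1 (by norm_num), h 2 (by norm_num)⟩,
    fun ⟨h0, h1, h2⟩ i hi => by interval_cases i <;> assumption⟩

theorem flat_snd_iff {e : OpenPartialHomeomorph S ℝ}
    (he : e ∈ IsManifold.maximalAtlas 𝓘(ℝ, ℝ) ∞ S) {s : S} (hs : s ∈ e.source) {φ : S → ℝ × ℝ}
    (hφ : ContMDiffAt 𝓘(ℝ, ℝ) 𝓘(ℝ, ℝ × ℝ) ∞ φ s) :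
    Flat 3 e (fun z => (φ z).2 - (φ s).2) s ↔ (localDeriv 1 e φ s).2 = 0 ∧
      (localDeriv 2 e φ s).2 = 0 := by
  have hsm : ContMDiffAt 𝓘(ℝ, ℝ) 𝓘(ℝ, ℝ) ∞ (fun z => (φ z).2 - (φ s).2) s :=
    (contMDiffAt_snd hφ).sub contMDiffAt_const
  rw [flat_iff he hs hsm]
  have hsub : ∀ i, 0 < i → iteratedDeriv i ((fun z => (φ z).2 - (φ s).2) ∘ e.symm) (e s)
      = iteratedDeriv i ((fun z => (φ z).2) ∘ e.symm) (e s) := fun i hi => by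
    have := iteratedDeriv_fun_sub (n := i) (f := (fun z => (φ z).2) ∘ e.symm)
      (g := fun _ => (φ s).2) ((contDiffAt_comp_symm he hs (contMDiffAt_snd hφ)).nat i)
      contDiffAt_const
    rw [iteratedDeriv_const, if_neg hi.ne', sub_zero] at this
    exact this
  simp only [localDeriv_snd he hs hφ]
  exact ⟨fun h => ⟨hsub 1 one_pos ▸ h 1 (by norm_num), hsub 2 two_pos ▸ h 2 (by norm_num)⟩,
    fun ⟨h1, h2⟩ i hi => by
      interval_cases i
      · simp [e.left_inv hs]
      · rwa [hsub 1 one_pos]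
      · rwa [hsub 2 two_pos]⟩

theorem flat_sub_iff {S : Type*} [TopologicalSpace S] {p : ℕ} {e : OpenPartialHomeomorph S ℝ}
    {φ : S → ℝ × ℝ} {s : S} :
    Flat p e (fun z => φ z - φ s) s ↔
      Flat p e (fun z => (φ z).1 - (φ s).1) s ∧ Flat p e (fun z => (φ z).2 - (φ s).2) s :=
  isBigO_prod_left (f' := fun t => (φ (e.symm t)).1 - (φ s).1)
    (g' := fun t => (φ (e.symm t)).2 - (φ s).2)

section Transfer

variable {ρ : S → S} {s : S} {e e' : OpenPartialHomeomorph S ℝ} {L : ℝ × ℝ → ℝ × ℝ}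
  {φ φ' : S → ℝ × ℝ}

/-- Works for the first coordinate alone because `L` preserves the axis, so that the first
coordinate of `L v` is controlled by that of `v`. `flat_sub_transfer` is the analogue for both
coordinates and needs only differentiability of `L`. -/
theorem flat_fst_transfer (hρ : SrcDiffeoAt ρ s) (he : e ∈ IsManifold.maximalAtlas 𝓘(ℝ, ℝ) ∞ S)
    (he' : e' ∈ IsManifold.maximalAtlas 𝓘(ℝ, ℝ) ∞ S) (hs : s ∈ e.source) (hs' : ρ s ∈ e'.source)
    (hφ : ContMDiffAt 𝓘(ℝ, ℝ) 𝓘(ℝ, ℝ × ℝ) ∞ φ (ρ s)) (hL : AxisDiffeoAt L (φ (ρ s)))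
    (heq : φ' =ᶠ[𝓝 s] L ∘ φ ∘ ρ) {p : ℕ} (h : Flat p e' (fun z => (φ z).1) (ρ s)) :
    Flat p e (fun z => (φ' z).1) s := by
  refine Flat.transfer hρ he he' hs hs' ?_ h
  have h1 : Tendsto (φ ∘ ρ) (𝓝 s) (𝓝 (φ (ρ s))) :=
    hφ.continuousAt.comp hρ.smooth.continuousAt
  have h2 := hL.isBigO_fst.comp_tendsto h1
  refine EventuallyEq.trans_isBigO ?_ h2
  filter_upwards [heq] with z hz
  simp [hz]

theorem flat_sub_transfer (hρ : SrcDiffeoAt ρ s) (he : e ∈ IsManifold.maximalAtlas 𝓘(ℝ, ℝ) ∞ S)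
    (he' : e' ∈ IsManifold.maximalAtlas 𝓘(ℝ, ℝ) ∞ S) (hs : s ∈ e.source) (hs' : ρ s ∈ e'.source)
    (hφ : ContMDiffAt 𝓘(ℝ, ℝ) 𝓘(ℝ, ℝ × ℝ) ∞ φ (ρ s)) (hL : AxisDiffeoAt L (φ (ρ s)))
    (heq : φ' =ᶠ[𝓝 s] L ∘ φ ∘ ρ) {p : ℕ} (h : Flat p e' (fun z => φ z - φ (ρ s)) (ρ s)) :
    Flat p e (fun z => φ' z - φ' s) s := by
  refine Flat.transfer hρ he he' hs hs' ?_ h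
  have h1 : Tendsto (φ ∘ ρ) (𝓝 s) (𝓝 (φ (ρ s))) :=
    hφ.continuousAt.comp hρ.smooth.continuousAt
  have h2 := hL.isBigO_sub.comp_tendsto h1
  refine EventuallyEq.trans_isBigO ?_ h2
  have h3 := heq.self_of_nhds
  filter_upwards [heq] with z hz
  rw [hz, h3]
  rfl

end Transfer

/-! ### Branches through fixed points -/

/-- Reflecting the argument multiplies the `i`-th derivative at `0` by `(-1) ^ i`, while the
hypothesis multiplies it by `c`. -/
theorem iteratedDeriv_eq_zero_of_parity {f : ℝ → ℝ} {c : ℝ} (i : ℕ)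
    (h : ∀ᶠ t in 𝓝 (0 : ℝ), f (-t) = c * f t) (hc : (-1) ^ i ≠ c) : iteratedDeriv i f 0 = 0 := by
  have h1 : iteratedDeriv i (fun t => f (-t)) 0 = iteratedDeriv i (fun t => c * f t) 0 :=
    Filter.EventuallyEq.iteratedDeriv_eq i h
  rw [iteratedDeriv_comp_neg, iteratedDeriv_const_mul_field, neg_zero, smul_eq_mul] at h1
  have : ((-1) ^ i - c) * iteratedDeriv i f 0 = 0 := by linear_combination h1
  exact (mul_eq_zero.1 this).resolve_left (sub_ne_zero.2 hc)

theorem EquivariantMap.fst_fixed (φ : EquivariantMap σ) {b : S} (hb : σ b = b) : (φ b).1 = 0 := by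
  have := congrArg Prod.fst (φ.equivariant b)
  rw [hb] at this
  simp only [tau] at this
  linarith

section SymmetricChart

variable {e : OpenPartialHomeomorph S ℝ} {b : S}

theorem symm_neg (hb : b ∈ e.source) (h0 : e b = 0)
    (hsym : ∀ s ∈ e.source, σ s ∈ e.source ∧ e (σ s) = - e s) :
    ∀ᶠ t in 𝓝 (0 : ℝ), e.symm (-t) = σ (e.symm t) := by
  have : e.target ∈ 𝓝 (0 : ℝ) := h0 ▸ e.open_target.mem_nhds (e.map_source hb)
  filter_upwards [this] with t ht
  obtain ⟨h1, h2⟩ := hsym _ (e.map_target ht)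
  rw [e.right_inv ht] at h2
  rw [← h2, e.left_inv h1]

theorem localDeriv_snd_of_odd (φ : EquivariantMap σ)
    (he : e ∈ IsManifold.maximalAtlas 𝓘(ℝ, ℝ) ∞ S) (hb : b ∈ e.source) (h0 : e b = 0)
    (hsym : ∀ s ∈ e.source, σ s ∈ e.source ∧ e (σ s) = - e s) {i : ℕ} (hi : Odd i) :
    (localDeriv i e φ b).2 = 0 := by
  rw [localDeriv_snd he hb φ.smooth.contMDiffAt, h0]
  refine iteratedDeriv_eq_zero_of_parity (c := 1) i ?_ (by rw [hi.neg_one_pow]; norm_num)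
  filter_upwards [symm_neg hb h0 hsym] with t ht
  simp [ht, φ.equivariant, tau]

theorem localDeriv_fst_of_even (φ : EquivariantMap σ)
    (he : e ∈ IsManifold.maximalAtlas 𝓘(ℝ, ℝ) ∞ S) (hb : b ∈ e.source) (h0 : e b = 0)
    (hsym : ∀ s ∈ e.source, σ s ∈ e.source ∧ e (σ s) = - e s) {i : ℕ} (hi : Even i) :
    (localDeriv i e φ b).1 = 0 := by
  rw [localDeriv_fst he hb φ.smooth.contMDiffAt, h0]
  refine iteratedDeriv_eq_zero_of_parity (c := -1) i ?_ (by rw [hi.neg_one_pow]; norm_num)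
  filter_upwards [symm_neg hb h0 hsym] with t ht
  simp [ht, φ.equivariant, tau]

end SymmetricChart

/-- First derivatives transform by a non-zero factor under a change of the coordinate. -/
theorem exists_localDeriv_one_eq {e e' : OpenPartialHomeomorph S ℝ} {s : S}
    (he : e ∈ IsManifold.maximalAtlas 𝓘(ℝ, ℝ) ∞ S) (he' : e' ∈ IsManifold.maximalAtlas 𝓘(ℝ, ℝ) ∞ S)
    (hs : s ∈ e.source) (hs' : s ∈ e'.source) {φ : S → ℝ × ℝ}
    (hφ : ContMDiffAt 𝓘(ℝ, ℝ) 𝓘(ℝ, ℝ × ℝ) ∞ φ s) :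
    ∃ c : ℝ, c ≠ 0 ∧ localDeriv 1 e φ s = c • localDeriv 1 e' φ s := by
  obtain ⟨c, hc, h⟩ := localDeriv_one_transfer (srcDiffeoAt_id s) he he' hs hs'
  have := h φ φ id hφ differentiableAt_id EventuallyEq.rfl
  rw [fderiv_id] at this
  exact ⟨c, hc, this⟩

section FixedPoint

variable [IsManifold 𝓘(ℝ, ℝ) ∞ S]

/-- In a symmetric chart parity gives `y' = 0` and `x'' = 0`. The first passes to any chart up to a
factor. The second passes only together with `x = x' = 0`, as flatness of order three. -/
theorem EquivariantMap.localDeriv_fixed (φ : EquivariantMap σ) {b : S} (hb : σ b = b)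
    {e : OpenPartialHomeomorph S ℝ} (he : e ∈ IsManifold.maximalAtlas 𝓘(ℝ, ℝ) ∞ S)
    (hs : b ∈ e.source) : (localDeriv 1 e φ b).2 = 0 ∧
      ((localDeriv 1 e φ b).1 = 0 → (localDeriv 2 e φ b).1 = 0) := by
  obtain ⟨c, hc, hcb, hc0, hsym⟩ := σ.exists_symmetricChart hb
  have hφ : ContMDiffAt 𝓘(ℝ, ℝ) 𝓘(ℝ, ℝ × ℝ) ∞ φ b := φ.smooth.contMDiffAt
  obtain ⟨r, hr, h1⟩ := exists_localDeriv_one_eq hc he hcb hs hφ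
  have h2 := localDeriv_snd_of_odd φ hc hcb hc0 hsym (i := 1) odd_one
  have h3 := localDeriv_fst_of_even φ hc hcb hc0 hsym (i := 2) even_two
  refine ⟨?_, fun h4 => ?_⟩
  · rw [h1] at h2
    simpa [hr] using h2
  · have h5 : (localDeriv 1 c φ b).1 = 0 := by rw [h1]; simp [h4]
    have h6 := (flat_fst_iff hc hcb hφ).2 ⟨φ.fst_fixed hb, h5, h3⟩
    have h7 := flat_fst_transfer (srcDiffeoAt_id b) he hc hs hcb hφ
      (axisDiffeoAt_id (φ.fst_fixed hb)) EventuallyEq.rfl h6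
    exact ((flat_fst_iff he hs hφ).1 h7).2.2

end FixedPoint

/-! ### The strata -/

/-- Labels for the conditions on derivatives used to define strata. -/
abbrev Cnd (A B : Type) : Type := (A × Fin 3) ⊕ (B × Fin 2)

/-- The condition with a given label, in given local coordinates: for a free branch the vanishing
of `x'`, `y'` or `x''`, for a fixed-point branch the vanishing of `x'` or `y''`. -/
def HoldsIn (ea : A → OpenPartialHomeomorph S ℝ) (eb : B → OpenPartialHomeomorph S ℝ)
    (g : MultiGerm σ A B) : Cnd A B → Prop
  | .inl (a, 0) => (localDeriv 1 (ea a) g.map (g.free a)).1 = 0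
  | .inl (a, 1) => (localDeriv 1 (ea a) g.map (g.free a)).2 = 0
  | .inl (a, 2) => (localDeriv 2 (ea a) g.map (g.free a)).1 = 0
  | .inr (b, 0) => (localDeriv 1 (eb b) g.map (g.fixedPt b)).1 = 0
  | .inr (b, 1) => (localDeriv 2 (eb b) g.map (g.fixedPt b)).2 = 0

/-- The condition with a given label. -/
def Holds (g : MultiGerm σ A B) (i : Cnd A B) : Prop :=
  HoldsIn (fun a => chartAt ℝ (g.free a)) (fun b => chartAt ℝ (g.fixedPt b)) g i

/-- Sets of conditions for which a condition on a second derivative comes together with the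
corresponding one on the first derivative. -/
def ClosedCnd (T : Finset (Cnd A B)) : Prop :=
  (∀ a, .inl (a, 2) ∈ T → .inl (a, 0) ∈ T) ∧ ∀ b, .inr (b, 1) ∈ T → .inr (b, 0) ∈ T

/-- All branches pass through one point of the axis. -/
def OnAxis (g : MultiGerm σ A B) : Prop :=
  ∃ w : ℝ × ℝ, w.1 = 0 ∧ (∀ a, g.map (g.free a) = w) ∧ ∀ b, g.map (g.fixedPt b) = w

theorem AxisRel.onAxis {g g' : MultiGerm σ A B} {w : ℝ × ℝ} {L : ℝ × ℝ → ℝ × ℝ}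
    (h : AxisRel g g' w L) : OnAxis g' := by
  have hw := tau_eq_self_of_axis h.diffeo.axis
  refine ⟨L w, h.diffeo.axis_image, fun a => ?_, fun b => ?_⟩
  · obtain ⟨ρ, L', hL', -, hρ, heq⟩ := h.free a
    rw [heq.self_of_nhds]
    rcases hL' with rfl | rfl <;> simp [hρ, h.free_eq, hw]
  · obtain ⟨ρ, -, hρ, heq⟩ := h.fixed b
    rw [heq.self_of_nhds]
    simp [hρ, h.fixed_eq]

/-! ### Invariance of the conditions under equivalence and change of chart -/

section Charts

variable {ea ea' : A → OpenPartialHomeomorph S ℝ} {eb eb' : B → OpenPartialHomeomorph S ℝ}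
  {g g' : MultiGerm σ A B} {w : ℝ × ℝ} {L : ℝ × ℝ → ℝ × ℝ}

/-- Local coordinates at the base points of `g`. -/
structure ChartsAt (ea : A → OpenPartialHomeomorph S ℝ) (eb : B → OpenPartialHomeomorph S ℝ)
    (g : MultiGerm σ A B) : Prop where
  free_mem : ∀ a, ea a ∈ IsManifold.maximalAtlas 𝓘(ℝ, ℝ) ∞ S
  fixed_mem : ∀ b, eb b ∈ IsManifold.maximalAtlas 𝓘(ℝ, ℝ) ∞ S
  free_src : ∀ a, g.free a ∈ (ea a).source
  fixed_src : ∀ b, g.fixedPt b ∈ (eb b).source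

/-- The eigenvalues `α` and `β` belong to the target change and are common to all branches, whereas
the speed `c` and the sign `ε` of a possible reflection depend on the branch. Comparing directions
of different branches relies on this. -/
theorem AxisRel.exists_localDeriv_one (h : AxisRel g g' w L) (hc : ChartsAt ea eb g)
    (hc' : ChartsAt ea' eb' g') :
    ∃ α β : ℝ, α ≠ 0 ∧ β ≠ 0 ∧ ∀ a, ∃ c ε : ℝ, c ≠ 0 ∧ (ε = 1 ∨ ε = -1) ∧
      localDeriv 1 (ea' a) g'.map (g'.free a) =
        (c * (ε * α * (localDeriv 1 (ea a) g.map (g.free a)).1),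
          c * (β * (localDeriv 1 (ea a) g.map (g.free a)).2)) := by
  obtain ⟨α, β, hα, hβ, hd⟩ := h.diffeo.exists_diag
  refine ⟨α, β, hα, hβ, fun a => ?_⟩
  obtain ⟨ρ, L', hL', hρ, hρa, heq⟩ := h.free a
  obtain ⟨c, hc0, hcd⟩ := localDeriv_one_transfer hρ (hc'.free_mem a) (hc.free_mem a)
    (hc'.free_src a) (by rw [hρa]; exact hc.free_src a)
  have hw : g.map (ρ (g'.free a)) = w := by rw [hρa, h.free_eq]
  have hL'' : DifferentiableAt ℝ L' (g.map (ρ (g'.free a))) := by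
    rw [hw]
    rcases hL' with rfl | rfl
    · exact h.diffeo.smooth.differentiableAt (by simp)
    · exact h.diffeo.comp_tau.1.smooth.differentiableAt (by simp)
  have h1 := hcd g.map g'.map L' g.map.smooth.contMDiffAt hL'' heq
  rw [hw, hρa] at h1
  rcases hL' with rfl | rfl
  · exact ⟨c, 1, hc0, Or.inl rfl, by rw [h1, hd]; simp⟩
  · refine ⟨c, -1, hc0, Or.inr rfl, ?_⟩
    rw [h1, h.diffeo.comp_tau.2, hd]
    simp [tau]

/-- First-order conditions survive because the derivative of `L` is diagonal. A reparametrization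
can add a multiple of `x'` to `x''`, and at a fixed point `L` can add a multiple of `x' ^ 2` to
`y''`. These second-order conditions are therefore transferred, as flatness of order three, only in
the presence of `x' = 0`, which is what `ClosedCnd` guarantees. -/
theorem AxisRel.holdsIn [IsManifold 𝓘(ℝ, ℝ) ∞ S] (h : AxisRel g g' w L) (hc : ChartsAt ea eb g)
    (hc' : ChartsAt ea' eb' g') {T : Finset (Cnd A B)} (hT : ClosedCnd T)
    (hg : ∀ i ∈ T, HoldsIn ea eb g i) : ∀ i ∈ T, HoldsIn ea' eb' g' i := by
  obtain ⟨α, β, hα, hβ, hd⟩ := h.exists_localDeriv_one hc hc'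
  have hx : ∀ a, (localDeriv 1 (ea a) g.map (g.free a)).1 = 0 →
      (localDeriv 1 (ea' a) g'.map (g'.free a)).1 = 0 := fun a h0 => by
    obtain ⟨c, ε, -, -, h1⟩ := hd a
    rw [h1, h0]; simp
  have hbx : ∀ b, (localDeriv 1 (eb b) g.map (g.fixedPt b)).1 = 0 →
      (localDeriv 1 (eb' b) g'.map (g'.fixedPt b)).1 = 0 := fun b h0 => by
    obtain ⟨ρ, hρ, hρb, heq⟩ := h.fixed b
    obtain ⟨c, hc0, hcd⟩ := localDeriv_one_transfer hρ (hc'.fixed_mem b) (hc.fixed_mem b)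
      (hc'.fixed_src b) (by rw [hρb]; exact hc.fixed_src b)
    have hw : g.map (ρ (g'.fixedPt b)) = w := by rw [hρb, h.fixed_eq]
    have h1 := hcd g.map g'.map L g.map.smooth.contMDiffAt
      (by rw [hw]; exact h.diffeo.smooth.differentiableAt (by simp)) heq
    obtain ⟨α, β, -, -, hd⟩ := h.diffeo.exists_diag
    rw [hw, hρb, hd] at h1
    rw [h1, h0]
    simp
  rintro (⟨a, i⟩ | ⟨b, i⟩) hi
  · fin_cases i
    · exact hx a (hg _ hi)
    · obtain ⟨c, ε, -, -, h1⟩ := hd a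
      have h0 : (localDeriv 1 (ea a) g.map (g.free a)).2 = 0 := hg _ hi
      change (localDeriv 1 (ea' a) g'.map (g'.free a)).2 = 0
      rw [h1, h0]; simp
    · have h1 : (localDeriv 1 (ea a) g.map (g.free a)).1 = 0 := hg _ (hT.1 a hi)
      have h2 : (localDeriv 2 (ea a) g.map (g.free a)).1 = 0 := hg _ hi
      obtain ⟨ρ, L', hL', hρ, hρa, heq⟩ := h.free a
      have hsm : ContMDiffAt 𝓘(ℝ, ℝ) 𝓘(ℝ, ℝ × ℝ) ∞ g.map (g.free a) := g.map.smooth.contMDiffAt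
      have hflat := (flat_fst_iff (hc.free_mem a) (hc.free_src a) hsm).2
        ⟨by rw [h.free_eq]; exact h.diffeo.axis, h1, h2⟩
      have hLd : AxisDiffeoAt L' w := by
        rcases hL' with rfl | rfl
        · exact h.diffeo
        · exact h.diffeo.comp_tau.1
      rw [← hρa] at hflat hsm
      have := flat_fst_transfer hρ (hc'.free_mem a) (hc.free_mem a) (hc'.free_src a)
        (by rw [hρa]; exact hc.free_src a) hsm (by rw [hρa, h.free_eq]; exact hLd) heq hflat
      exact ((flat_fst_iff (hc'.free_mem a) (hc'.free_src a) g'.map.smooth.contMDiffAt).1 this).2.2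
  · fin_cases i
    · exact hbx b (hg _ hi)
    · have h1 : (localDeriv 1 (eb b) g.map (g.fixedPt b)).1 = 0 := hg _ (hT.2 b hi)
      have h2 : (localDeriv 2 (eb b) g.map (g.fixedPt b)).2 = 0 := hg _ hi
      obtain ⟨h3, h4⟩ := g.map.localDeriv_fixed (g.fixedPt_eq b) (hc.fixed_mem b) (hc.fixed_src b)
      obtain ⟨ρ, hρ, hρb, heq⟩ := h.fixed b
      have hsm : ContMDiffAt 𝓘(ℝ, ℝ) 𝓘(ℝ, ℝ × ℝ) ∞ g.map (g.fixedPt b) :=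
        g.map.smooth.contMDiffAt
      have hf1 := (flat_fst_iff (hc.fixed_mem b) (hc.fixed_src b) hsm).2
        ⟨g.map.fst_fixed (g.fixedPt_eq b), h1, h4 h1⟩
      have hf2 := (flat_snd_iff (hc.fixed_mem b) (hc.fixed_src b) hsm).2 ⟨h3, h2⟩
      have hflat : Flat 3 (eb b) (fun z => g.map z - g.map (g.fixedPt b)) (g.fixedPt b) :=
        flat_sub_iff.2 ⟨by simpa [g.map.fst_fixed (g.fixedPt_eq b)] using hf1, hf2⟩
      rw [← hρb] at hflat hsm
      have := flat_sub_transfer hρ (hc'.fixed_mem b) (hc.fixed_mem b) (hc'.fixed_src b)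
        (by rw [hρb]; exact hc.fixed_src b) hsm (by rw [hρb, h.fixed_eq]; exact h.diffeo) heq hflat
      exact ((flat_snd_iff (hc'.fixed_mem b) (hc'.fixed_src b) g'.map.smooth.contMDiffAt).1
        (flat_sub_iff.1 this).2).2

/-- The free branches `a` and `a'` have oblique derivatives that are parallel up to reflection. -/
def TangentIn (ea : A → OpenPartialHomeomorph S ℝ) (g : MultiGerm σ A B) (a a' : A) : Prop :=
  let u := localDeriv 1 (ea a) g.map (g.free a)
  let v := localDeriv 1 (ea a') g.map (g.free a')
  (u.1 ≠ 0 ∧ u.2 ≠ 0 ∧ v.1 ≠ 0 ∧ v.2 ≠ 0) ∧ (u.1 * v.2) ^ 2 - (u.2 * v.1) ^ 2 = 0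

/-- The difference of squares is the product of the determinants of `u` with `v` and with its
reflection, up to sign. The signs `ε` and `ε'` disappear on squaring, so the difference is only
multiplied by `(c * c' * α * β) ^ 2`. -/
theorem AxisRel.tangentIn (h : AxisRel g g' w L) (hc : ChartsAt ea eb g)
    (hc' : ChartsAt ea' eb' g') {a a' : A} (hg : TangentIn ea g a a') : TangentIn ea' g' a a' := by
  obtain ⟨α, β, hα, hβ, hd⟩ := h.exists_localDeriv_one hc hc'
  obtain ⟨c, ε, hc0, hε, h1⟩ := hd a
  obtain ⟨c', ε', hc0', hε', h2⟩ := hd a'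
  have hε0 : ε ≠ 0 := by rcases hε with rfl | rfl <;> norm_num
  have hε0' : ε' ≠ 0 := by rcases hε' with rfl | rfl <;> norm_num
  have hε2 : ε ^ 2 = 1 := by rcases hε with rfl | rfl <;> norm_num
  have hε2' : ε' ^ 2 = 1 := by rcases hε' with rfl | rfl <;> norm_num
  obtain ⟨⟨k1, k2, k3, k4⟩, k5⟩ := hg
  unfold TangentIn
  rw [h1, h2]
  refine ⟨⟨?_, ?_, ?_, ?_⟩, ?_⟩
  · simp [hc0, hε0, hα, k1]
  · simp [hc0, hβ, k2]
  · simp [hc0', hε0', hα, k3]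
  · simp [hc0', hβ, k4]
  · have : ∀ x y x' y' : ℝ, (x * y') ^ 2 - (y * x') ^ 2 = 0 →
        ((c * (ε * α * x)) * (c' * (β * y'))) ^ 2 - ((c * (β * y)) * (c' * (ε' * α * x'))) ^ 2
          = 0 := fun x y x' y' hxy => by
      linear_combination (c * c' * α * β) ^ 2 * hxy
        + (c * c' * α * β * x * y') ^ 2 * hε2 - (c * c' * α * β * y * x') ^ 2 * hε2'
    exact this _ _ _ _ k5

end Charts

end

section

variable {S : Type*} [TopologicalSpace S] [ChartedSpace ℝ S] {σ : SmoothInvolution S} {A B : Type}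

/-! ### Classes of multijets defined by conditions on multigerms -/

/-- The set of `k`-multijets of the multigerms satisfying `C`. -/
def jetClass (k : ℕ) (C : MultiGerm σ A B → Prop) : Set (MultiJet σ k A B) :=
  {z | ∃ g, g.jet k = z ∧ C g}

/-- A condition on multigerms invariant under right-left equivalence and depending only on the
derivatives of order at most two at the base points. -/
structure SecondOrder (C : MultiGerm σ A B → Prop) : Prop where
  rl : ∀ g g', RLEquiv g g' → C g → C g'
  congr : ∀ g g' : MultiGerm σ A B, g'.free = g.free → g'.fixedPt = g.fixedPt →
    (∀ a, ∀ i ≤ 2, der i g.map (g.free a) = der i g'.map (g.free a)) →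
    (∀ b, ∀ i ≤ 2, der i g.map (g.fixedPt b) = der i g'.map (g.fixedPt b)) → C g → C g'

/-- Right-left equivalence does not depend on the choice of representatives of free orbits. -/
theorem rlEquiv_of_map_eq {g g' : MultiGerm σ A B} (hm : g'.map = g.map)
    (hA : ∀ a, g'.free a = g.free a ∨ g'.free a = σ (g.free a))
    (hB : g'.fixedPt = g.fixedPt) : RLEquiv g g' := by
  refine ⟨OpenPartialHomeomorph.refl S, OpenPartialHomeomorph.refl _, contMDiffOn_id,
    contMDiffOn_id, contDiffOn_id, contDiffOn_id, fun s _ => ⟨trivial, rfl⟩,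
    fun w _ => ⟨trivial, rfl⟩, fun a => ⟨trivial, ?_⟩, fun b => ⟨trivial, ?_⟩,
    fun s _ => ⟨trivial, ?_⟩⟩
  · rcases hA a with h | h
    · exact Or.inl h.symm
    · right
      rw [h]
      exact (σ.involutive _).symm
  · rw [hB]; rfl
  · rw [hm]; rfl

/-- A multigerm with the same jet as `g` may use other representatives of the free orbits. The
intermediate `g''` combines its map with the base points of `g`: it is reached by an equivalence,
and `g` is then reached by comparing derivatives. -/
theorem SecondOrder.mem_jetClass {C : MultiGerm σ A B → Prop} (hC : SecondOrder C)
    {g : MultiGerm σ A B} : g.jet 2 ∈ jetClass 2 C ↔ C g := by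
  refine ⟨?_, fun h => ⟨g, rfl, h⟩⟩
  rintro ⟨g', hj, hg'⟩
  have hs : SameJet 2 g' g := Quotient.exact hj
  obtain ⟨hA, hB⟩ := hs
  let g'' : MultiGerm σ A B :=
    { map := g'.map
      free := g.free
      fixedPt := g.fixedPt
      free_ne := g.free_ne
      free_distinct := g.free_distinct
      fixedPt_eq := g.fixedPt_eq
      fixedPt_inj := g.fixedPt_inj }
  have h1 : C g'' := hC.rl g' g'' (rlEquiv_of_map_eq rfl (fun a => (hA a).1)
    (funext fun b => (hB b).1)) hg'
  refine hC.congr g'' g rfl rfl (fun a i hi => ?_) (fun b i hi => ?_) h1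
  · change der i g'.map (g.free a) = der i g.map (g.free a)
    rcases (hA a).1 with h | h
    · rw [h]; exact ((hA a).2 i hi).1
    · rw [h]; exact ((hA a).2 i hi).2
  · change der i g'.map (g.fixedPt b) = der i g.map (g.fixedPt b)
    rw [(hB b).1]
    exact (hB b).2 i (by omega)

theorem SecondOrder.rlInvariant {C : MultiGerm σ A B → Prop} (hC : SecondOrder C) :
    RLInvariant (jetClass 2 C) := fun g g' h hg =>
  hC.mem_jetClass.2 (hC.rl g g' h (hC.mem_jetClass.1 hg))

/-- One system of equations has to describe `W` in every jet chart, since the chart at a point of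
`W` is supplied by `MultiGerm.exists_jetChart`. The map `R` only relabels the equations by `Fin`. -/
theorem isSubmanifold_of_eq_zero [IsManifold 𝓘(ℝ, ℝ) ∞ S] [Fintype A] [Fintype B] {k : ℕ}
    {W : Set (MultiJet σ k A B)} {ι : Type} [Fintype ι] (F : JetCoord k A B → ι → ℝ)
    (hF : ContDiff ℝ ∞ F) (U : Set (JetCoord k A B)) (hU : IsOpen U)
    (hsurj : ∀ x ∈ U, Function.Surjective (fderiv ℝ F x))
    (hW : ∀ (g : MultiGerm σ A B) (c : JetChart σ A B), c.Domain g →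
      (g.jet k ∈ W ↔ c.coord k g ∈ U ∧ F (c.coord k g) = 0)) :
    IsSubmanifold (Fintype.card ι) W := by
  let R : (ι → ℝ) ≃L[ℝ] (Fin (Fintype.card ι) → ℝ) :=
    (LinearEquiv.funCongrLeft ℝ ℝ (Fintype.equivFin ι).symm).toContinuousLinearEquiv
  intro g hg
  obtain ⟨c, hc⟩ := g.exists_jetChart
  refine ⟨c, hc, U, hU, ((hW g c hc).1 hg).1, fun x => R (F x), ?_, ?_, ?_⟩
  · exact (R.contDiff.comp hF).contDiffOn
  · intro x hx
    have : fderiv ℝ (fun x => R (F x)) x = (R : (ι → ℝ) →L[ℝ] _).comp (fderiv ℝ F x) :=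
      R.comp_fderiv
    rw [this]
    exact R.surjective.comp (hsurj x hx)
  · intro g' hc' hU'
    rw [hW g' c hc', R.map_eq_zero_iff]
    exact ⟨fun h => h.2, fun h => ⟨hU', h⟩⟩

/-! ### Equations of the strata -/

/-- The coordinate expressing the condition with a given label. -/
def cndCoord : Cnd A B → JetCoord 2 A B → ℝ
  | .inl (a, 0), x => ((x.1 a).2 1).1
  | .inl (a, 1), x => ((x.1 a).2 1).2
  | .inl (a, 2), x => ((x.1 a).2 2).1
  | .inr (b, 0), x => (x.2 b 0).1
  | .inr (b, 1), x => (x.2 b 1).2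

/-- The second coordinate of the image of a base point. -/
def heightCoord : A ⊕ B → JetCoord 2 A B → ℝ
  | .inl a, x => ((x.1 a).2 0).2
  | .inr b, x => (x.2 b 0).2

/-- The equations expressing that all branches pass through one point of the axis. -/
def axisEqs (o : A ⊕ B) (x : JetCoord 2 A B) : A ⊕ {i : A ⊕ B // i ≠ o} → ℝ
  | .inl a => ((x.1 a).2 0).1
  | .inr i => heightCoord i.1 x - heightCoord o x

/-- The point of the multijet space with given coordinates. -/
def jetPoint (X : A → ℝ) (H : A ⊕ B → ℝ) (Z : Cnd A B → ℝ) : JetCoord 2 A B :=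
  (fun a => (0, ![(X a, H (.inl a)), (Z (.inl (a, 0)), Z (.inl (a, 1))), (Z (.inl (a, 2)), 0)]),
    fun b => ![(Z (.inr (b, 0)), H (.inr b)), (0, Z (.inr (b, 1))), 0])

theorem cndCoord_jetPoint (X : A → ℝ) (H : A ⊕ B → ℝ) (Z : Cnd A B → ℝ) (i : Cnd A B) :
    cndCoord i (jetPoint X H Z) = Z i := by
  rcases i with ⟨a, i⟩ | ⟨b, i⟩ <;> fin_cases i <;> simp [cndCoord, jetPoint]

theorem heightCoord_jetPoint (X : A → ℝ) (H : A ⊕ B → ℝ) (Z : Cnd A B → ℝ) (i : A ⊕ B) :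
    heightCoord i (jetPoint X H Z) = H i := by
  rcases i with a | b <;> simp [heightCoord, jetPoint]

/-- Positions, heights and conditions read off different jet coordinates, so they can be prescribed
independently; the height at `o` is normalized to zero. -/
theorem exists_axisEqs (o : A ⊕ B) (y : A ⊕ {i : A ⊕ B // i ≠ o} → ℝ) (Z : Cnd A B → ℝ) :
    ∃ v : JetCoord 2 A B, axisEqs o v = y ∧ ∀ i, cndCoord i v = Z i := by
  classical
  refine ⟨jetPoint (fun a => y (.inl a)) (fun i => if h : i ≠ o then y (.inr ⟨i, h⟩) else 0) Z, ?_,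
    cndCoord_jetPoint _ _ _⟩
  ext i
  rcases i with a | ⟨i, hi⟩
  · simp [axisEqs, jetPoint]
  · simp only [axisEqs, heightCoord_jetPoint]
    simp [hi]

/-- The equations of a linear stratum. -/
def linEqs (o : A ⊕ B) (T : Finset (Cnd A B)) :
    JetCoord 2 A B →ₗ[ℝ] (A ⊕ {i : A ⊕ B // i ≠ o}) ⊕ T → ℝ where
  toFun x := Sum.elim (axisEqs o x) fun i => cndCoord i.1 x
  map_add' x y := by
    ext i
    rcases i with (a | ⟨a | b, hi⟩) | ⟨⟨a, i⟩ | ⟨b, i⟩, hi⟩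
    · simp [axisEqs]
    · rcases o with a' | b' <;> simp [axisEqs, heightCoord] <;> ring
    · rcases o with a' | b' <;> simp [axisEqs, heightCoord] <;> ring
    · fin_cases i <;> simp [cndCoord]
    · fin_cases i <;> simp [cndCoord]
  map_smul' r x := by
    ext i
    rcases i with (a | ⟨a | b, hi⟩) | ⟨⟨a, i⟩ | ⟨b, i⟩, hi⟩
    · simp [axisEqs]
    · rcases o with a' | b' <;> simp [axisEqs, heightCoord] <;> ring
    · rcases o with a' | b' <;> simp [axisEqs, heightCoord] <;> ring
    · fin_cases i <;> simp [cndCoord]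
    · fin_cases i <;> simp [cndCoord]

theorem linEqs_surjective (o : A ⊕ B) (T : Finset (Cnd A B)) :
    Function.Surjective (linEqs o T) := fun y => by
  classical
  obtain ⟨v, h1, h2⟩ := exists_axisEqs o (fun i => y (.inl i))
    (fun i => if h : i ∈ T then y (.inr ⟨i, h⟩) else 0)
  refine ⟨v, ?_⟩
  ext i
  rcases i with i | ⟨i, hi⟩
  · exact congrFun h1 i
  · change cndCoord i v = _
    rw [h2]
    simp [hi]

/-- The equations of the stratum of tangencies of the oblique free branches `a` and `a'`. -/
def tangentEqs (o : A ⊕ B) (a a' : A) (x : JetCoord 2 A B) :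
    (A ⊕ {i : A ⊕ B // i ≠ o}) ⊕ Unit → ℝ :=
  Sum.elim (axisEqs o x) fun _ =>
    (cndCoord (.inl (a, 0)) x * cndCoord (.inl (a', 1)) x) ^ 2
      - (cndCoord (.inl (a, 1)) x * cndCoord (.inl (a', 0)) x) ^ 2

theorem axisEqs_add_smul (o : A ⊕ B) (x v : JetCoord 2 A B) (s : ℝ) :
    axisEqs o (x + s • v) = axisEqs o x + s • axisEqs o v := by
  have h : linEqs o ∅ (x + s • v) = linEqs o ∅ x + s • linEqs o ∅ v := by rw [map_add, map_smul]
  exact funext fun i => congrFun h (.inl i)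

theorem cndCoord_add_smul (i : Cnd A B) (x v : JetCoord 2 A B) (s : ℝ) :
    cndCoord i (x + s • v) = cndCoord i x + s * cndCoord i v := by
  rcases i with ⟨a, i⟩ | ⟨b, i⟩ <;> fin_cases i <;> simp [cndCoord]

/-! ### Smoothness and submersivity of the equations -/

section Smooth

variable [Fintype A] [Fintype B]

theorem contDiff_cndCoord (i : Cnd A B) : ContDiff ℝ ∞ (cndCoord i) := by
  rcases i with ⟨a, i⟩ | ⟨b, i⟩ <;> fin_cases i
  · exact (by fun_prop : ContDiff ℝ ∞ fun x : JetCoord 2 A B => ((x.1 a).2 1).1)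
  · exact (by fun_prop : ContDiff ℝ ∞ fun x : JetCoord 2 A B => ((x.1 a).2 1).2)
  · exact (by fun_prop : ContDiff ℝ ∞ fun x : JetCoord 2 A B => ((x.1 a).2 2).1)
  · exact (by fun_prop : ContDiff ℝ ∞ fun x : JetCoord 2 A B => (x.2 b 0).1)
  · exact (by fun_prop : ContDiff ℝ ∞ fun x : JetCoord 2 A B => (x.2 b 1).2)

theorem contDiff_tangentEqs [DecidableEq A] [DecidableEq B] (o : A ⊕ B) (a a' : A) : ContDiff ℝ ∞
    (tangentEqs o a a') := by
  rw [contDiff_pi]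
  rintro (i | i)
  · exact contDiff_pi.1 (linEqs o ∅).toContinuousLinearMap.contDiff (.inl i)
  · exact (((contDiff_cndCoord _).mul (contDiff_cndCoord _)).pow 2).sub
      (((contDiff_cndCoord _).mul (contDiff_cndCoord _)).pow 2)

/-- Among the first derivatives, varying only `x'` of the branch `a` already moves the tangency
equation, because `u` and `v` are non-zero. The incidence equations can be moved independently of
it. -/
theorem tangentEqs_surjective [DecidableEq A] [DecidableEq B] (o : A ⊕ B) {a a' : A} (haa : a ≠ a')
    {x : JetCoord 2 A B}
    (h1 : cndCoord (.inl (a, 0)) x ≠ 0) (h2 : cndCoord (.inl (a', 1)) x ≠ 0) :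
    Function.Surjective (fderiv ℝ (tangentEqs o a a') x) := fun y => by
  classical
  have hd : DifferentiableAt ℝ (tangentEqs o a a') x :=
    ((contDiff_tangentEqs o a a').differentiable (by simp)).differentiableAt
  set u := cndCoord (.inl (a, 0)) x with hu
  set v := cndCoord (.inl (a', 1)) x with hv
  -- At `s = 0` the derivative of `((u + s * d) * v) ^ 2` is `2 * u * v ^ 2 * d`, which dictates the
  -- prescribed entry.
  obtain ⟨z, hz1, hz2⟩ := exists_axisEqs o (fun i => y (.inl i))
    (Pi.single (.inl (a, 0)) (y (.inr ()) / (2 * u * v ^ 2)))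
  refine ⟨z, ?_⟩
  have hline : HasDerivAt (fun s : ℝ => x + s • z) z 0 := by
    simpa using ((hasDerivAt_id (0 : ℝ)).smul_const z).const_add x
  have hd' : HasFDerivAt (tangentEqs o a a') (fderiv ℝ (tangentEqs o a a') x)
      (x + (0 : ℝ) • z) := by simpa using hd.hasFDerivAt
  have hcomp := hd'.comp_hasDerivAt (0 : ℝ) hline
  refine hcomp.unique ?_
  rw [hasDerivAt_pi]
  rintro (i | i)
  · have : (fun s : ℝ => (tangentEqs o a a' ∘ fun s => x + s • z) s (.inl i))
        = fun s => axisEqs o x i + s * y (.inl i) := by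
      ext s
      change axisEqs o (x + s • z) i = _
      rw [axisEqs_add_smul, hz1]
      rfl
    rw [this]
    simpa using ((hasDerivAt_id (0 : ℝ)).mul_const (y (.inl i))).const_add (axisEqs o x i)
  · have hc : ∀ (j : Cnd A B) (s : ℝ), cndCoord j (x + s • z) = cndCoord j x + s * cndCoord j z :=
      fun j s => by rw [cndCoord_add_smul]
    have : (fun s : ℝ => (tangentEqs o a a' ∘ fun s => x + s • z) s (.inr i))
        = fun s => ((u + s * (y (.inr ()) / (2 * u * v ^ 2))) * v) ^ 2
          - (cndCoord (.inl (a, 1)) x * cndCoord (.inl (a', 0)) x) ^ 2 := by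
      ext s
      change (cndCoord (.inl (a, 0)) (x + s • z) * cndCoord (.inl (a', 1)) (x + s • z)) ^ 2
        - (cndCoord (.inl (a, 1)) (x + s • z) * cndCoord (.inl (a', 0)) (x + s • z)) ^ 2 = _
      rw [hc, hc, hc, hc, hz2, hz2, hz2, hz2, Pi.single_eq_same, Pi.single_eq_of_ne (by simp),
        Pi.single_eq_of_ne (by simp), Pi.single_eq_of_ne (by simp [haa.symm]), ← hu, ← hv]
      simp
    rw [this]
    have h := (((((hasDerivAt_id (0 : ℝ)).mul_const (y (.inr ()) / (2 * u * v ^ 2))).const_add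
      u).mul_const v).fun_pow 2).sub_const
        ((cndCoord (.inl (a, 1)) x * cndCoord (.inl (a', 0)) x) ^ 2)
    refine h.congr_deriv ?_
    obtain rfl : i = () := rfl
    simp only [id, zero_mul, add_zero, one_mul, Nat.add_one_sub_one, pow_one]
    push_cast
    field_simp

end Smooth

/-! ### The equations evaluated on jets of multigerms -/

section Coordinates

variable {g : MultiGerm σ A B} {c : JetChart σ A B}

theorem JetChart.chartsAt (hc : c.Domain g) : ChartsAt c.freeChart c.fixedChart g :=
  ⟨c.freeChart_mem, c.fixedChart_mem, hc.1, fun b => by rw [hc.2 b]; exact c.basePt_mem b⟩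

theorem MultiGerm.chartsAt [IsManifold 𝓘(ℝ, ℝ) ∞ S] (g : MultiGerm σ A B) :
    ChartsAt (fun a => chartAt ℝ (g.free a)) (fun b => chartAt ℝ (g.fixedPt b)) g :=
  ⟨fun _ => IsManifold.chart_mem_maximalAtlas _, fun _ => IsManifold.chart_mem_maximalAtlas _,
    fun _ => mem_chart_source _ _, fun _ => mem_chart_source _ _⟩

theorem cndCoord_coord (i : Cnd A B) :
    cndCoord i (c.coord 2 g) = 0 ↔ HoldsIn c.freeChart c.fixedChart g i := by
  rcases i with ⟨a, i⟩ | ⟨b, i⟩ <;> fin_cases i <;> rfl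

/-- Only free branches need the equation `x = 0`, as equivariance puts the images of fixed points on
the axis. -/
theorem onAxis_iff (hc : c.Domain g) (o : A ⊕ B) :
    OnAxis g ↔ axisEqs o (c.coord 2 g) = 0 := by
  have hch := c.chartsAt hc
  have hx : ∀ a, (((c.coord 2 g).1 a).2 0) = g.map (g.free a) := fun a =>
    localDeriv_zero (hch.free_src a)
  have hyb : ∀ b, heightCoord (.inr b) (c.coord 2 g) = (g.map (g.fixedPt b)).2 := fun b => by
    have h := congrArg Prod.snd (localDeriv_zero (φ := g.map) (hch.fixed_src b))
    exact h
  have hya : ∀ a, heightCoord (.inl a) (c.coord 2 g) = (g.map (g.free a)).2 := fun a =>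
    congrArg Prod.snd (localDeriv_zero (hch.free_src a))
  constructor
  · rintro ⟨w, hw, hA, hB⟩
    have hy : ∀ i, heightCoord i (c.coord 2 g) = w.2 := by
      rintro (a | b)
      · rw [hya, hA]
      · rw [hyb, hB]
    ext i
    rcases i with a | i
    · change (((c.coord 2 g).1 a).2 0).1 = 0
      rw [hx, hA, hw]
    · simp [axisEqs, hy]
  · intro h
    have h1 : ∀ a, (g.map (g.free a)).1 = 0 := fun a => by
      rw [← hx]; exact congrFun h (.inl a)
    have h2 : ∀ i, heightCoord i (c.coord 2 g) = heightCoord o (c.coord 2 g) := fun i => by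
      by_cases hi : i = o
      · rw [hi]
      · exact sub_eq_zero.1 (congrFun h (.inr ⟨i, hi⟩))
    refine ⟨(0, heightCoord o (c.coord 2 g)), rfl, fun a => ?_, fun b => ?_⟩
    · exact Prod.ext (h1 a) (by rw [← hya, h2])
    · exact Prod.ext (g.map.fst_fixed (g.fixedPt_eq b)) (by rw [← hyb, h2])

end Coordinates

/-! ### The strata are singularities -/

section Strata

theorem OnAxis.congr {g g' : MultiGerm σ A B} (hA : g'.free = g.free) (hB : g'.fixedPt = g.fixedPt)
    (h1 : ∀ a, ∀ i ≤ 2, der i g.map (g.free a) = der i g'.map (g.free a))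
    (h2 : ∀ b, ∀ i ≤ 2, der i g.map (g.fixedPt b) = der i g'.map (g.fixedPt b))
    (h : OnAxis g) : OnAxis g' := by
  obtain ⟨w, hw, ha, hb⟩ := h
  have h0 : ∀ (φ : S → ℝ × ℝ) s, der 0 φ s = φ s := fun φ s =>
    localDeriv_zero (mem_chart_source ℝ s)
  refine ⟨w, hw, fun a => ?_, fun b => ?_⟩
  · rw [hA, ← h0 g'.map, ← h1 a 0 (by norm_num), h0, ha]
  · rw [hB, ← h0 g'.map, ← h2 b 0 (by norm_num), h0, hb]

/-- The linear stratum given by a set of conditions. -/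
def LinStratum (T : Finset (Cnd A B)) (g : MultiGerm σ A B) : Prop :=
  OnAxis g ∧ ∀ i ∈ T, Holds g i

/-- The stratum where two oblique free branches are tangent up to reflection. -/
def TangentStratum (a a' : A) (g : MultiGerm σ A B) : Prop :=
  OnAxis g ∧ TangentIn (fun a => chartAt ℝ (g.free a)) g a a'

variable [IsManifold 𝓘(ℝ, ℝ) ∞ S]

theorem linStratum_secondOrder {T : Finset (Cnd A B)} (hT : ClosedCnd T) (hne : Nonempty (A ⊕ B)) :
    SecondOrder (LinStratum (σ := σ) T) where
  rl g g' h := by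
    rintro ⟨⟨w, hw, hA, hB⟩, hg⟩
    obtain ⟨L, hL⟩ := h.exists_axisRel hw hA hB hne
    exact ⟨hL.onAxis, hL.holdsIn g.chartsAt g'.chartsAt hT hg⟩
  congr g g' hA hB h1 h2 := by
    rintro ⟨h, hg⟩
    refine ⟨h.congr hA hB h1 h2, fun i hi => ?_⟩
    have := hg i hi
    obtain ⟨m', f', p', _, _, _, _⟩ := g'
    subst hA hB
    rcases i with ⟨a, i⟩ | ⟨b, i⟩ <;> fin_cases i
    · exact (congrArg Prod.fst (h1 a 1 (by norm_num))).symm.trans this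
    · exact (congrArg Prod.snd (h1 a 1 (by norm_num))).symm.trans this
    · exact (congrArg Prod.fst (h1 a 2 (by norm_num))).symm.trans this
    · exact (congrArg Prod.fst (h2 b 1 (by norm_num))).symm.trans this
    · exact (congrArg Prod.snd (h2 b 2 (by norm_num))).symm.trans this

theorem tangentStratum_secondOrder (a a' : A) :
    SecondOrder (TangentStratum (σ := σ) (B := B) a a') where
  rl g g' h := by
    rintro ⟨⟨w, hw, hA, hB⟩, hg⟩
    obtain ⟨L, hL⟩ := h.exists_axisRel hw hA hB ⟨.inl a⟩
    exact ⟨hL.onAxis, hL.tangentIn g.chartsAt g'.chartsAt hg⟩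
  congr g g' hA hB h1 h2 := by
    rintro ⟨h, hg⟩
    refine ⟨h.congr hA hB h1 h2, ?_⟩
    obtain ⟨m', f', p', _, _, _, _⟩ := g'
    subst hA hB
    have e1 := h1 a 1 (by norm_num)
    have e2 := h1 a' 1 (by norm_num)
    simp only [der] at e1 e2
    simp only [TangentIn] at hg ⊢
    rwa [e1, e2] at hg

/-- Independence of the chart is invariance under the trivial equivalence: `AxisRel.refl` is used
with the preferred charts on one side and the jet chart on the other. -/
theorem LinStratum.iff_chart {T : Finset (Cnd A B)} (hT : ClosedCnd T) {g : MultiGerm σ A B}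
    {c : JetChart σ A B} (hc : c.Domain g) (o : A ⊕ B) :
    LinStratum T g ↔ linEqs o T (c.coord 2 g) = 0 := by
  have h0 : linEqs o T (c.coord 2 g) = 0 ↔
      OnAxis g ∧ ∀ i ∈ T, HoldsIn c.freeChart c.fixedChart g i := by
    rw [onAxis_iff hc o]
    constructor
    · intro h
      exact ⟨funext fun i => congrFun h (.inl i),
        fun i hi => (cndCoord_coord i).1 (congrFun h (.inr ⟨i, hi⟩))⟩
    · rintro ⟨h1, h2⟩
      ext i
      rcases i with i | ⟨i, hi⟩
      · exact congrFun h1 i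
      · exact (cndCoord_coord i).2 (h2 i hi)
  rw [h0]
  refine and_congr_right ?_
  rintro ⟨w, hw, hA, hB⟩
  exact ⟨(AxisRel.refl hw hA hB).holdsIn g.chartsAt (c.chartsAt hc) hT,
    (AxisRel.refl hw hA hB).holdsIn (c.chartsAt hc) g.chartsAt hT⟩

theorem card_axisEqs [Fintype A] [Fintype B] [DecidableEq A] [DecidableEq B] (o : A ⊕ B) :
    (Fintype.card (A ⊕ {i : A ⊕ B // i ≠ o}) : ℤ)
      = 2 * Fintype.card A + Fintype.card B - 1 := by
  have h : 0 < Fintype.card (A ⊕ B) := Fintype.card_pos_iff.2 ⟨o⟩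
  have h1 : Fintype.card {i : A ⊕ B // i ≠ o} = Fintype.card (A ⊕ B) - 1 := by
    rw [Fintype.card_subtype_compl, Fintype.card_subtype_eq]
  rw [Fintype.card_sum, h1]
  rw [Fintype.card_sum] at h ⊢
  push_cast [Nat.cast_sub (show 1 ≤ Fintype.card A + Fintype.card B from h)]
  ring

theorem isSingularity_linStratum [Fintype A] [Fintype B] [DecidableEq A] [DecidableEq B]
    {T : Finset (Cnd A B)}
    (hT : ClosedCnd T) (o : A ⊕ B) :
    IsSingularity (jetClass 2 (LinStratum (σ := σ) T))
      (Fintype.card A + Fintype.card B - 1 + T.card) := by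
  have hC := linStratum_secondOrder (σ := σ) hT ⟨o⟩
  refine ⟨hC.rlInvariant, _, isSubmanifold_of_eq_zero (fun x => linEqs o T x)
    ((linEqs o T).toContinuousLinearMap.contDiff) Set.univ isOpen_univ ?_ ?_, ?_⟩
  · intro x _
    have : fderiv ℝ (fun x => linEqs o T x) x = (linEqs o T).toContinuousLinearMap :=
      (linEqs o T).toContinuousLinearMap.fderiv
    rw [this]
    exact linEqs_surjective o T
  · intro g c hc
    rw [hC.mem_jetClass, LinStratum.iff_chart hT hc o]
    simp
  · rw [Fintype.card_sum, Nat.cast_add, card_axisEqs, Fintype.card_coe]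
    ring

/-- One equation beyond the `2m + n - 1` incidence equations gives parametric codimension `m + n`.
Obliqueness of the two branches is an open condition and defines the set on which the equations are
submersive. -/
theorem isSingularity_tangentStratum [Fintype A] [Fintype B] [DecidableEq A] [DecidableEq B]
    {a a' : A} (haa : a ≠ a') :
    IsSingularity (jetClass 2 (TangentStratum (σ := σ) (B := B) a a'))
      (Fintype.card A + Fintype.card B) := by
  have hC := tangentStratum_secondOrder (σ := σ) (B := B) a a'
  let o : A ⊕ B := .inl a
  refine ⟨hC.rlInvariant, _, isSubmanifold_of_eq_zero (tangentEqs o a a')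
    (contDiff_tangentEqs o a a')
    {x | (cndCoord (.inl (a, 0)) x ≠ 0 ∧ cndCoord (.inl (a, 1)) x ≠ 0 ∧
      cndCoord (.inl (a', 0)) x ≠ 0 ∧ cndCoord (.inl (a', 1)) x ≠ 0)} ?_
    (fun x hx => tangentEqs_surjective o haa hx.1 hx.2.2.2) ?_, ?_⟩
  · have hc : ∀ i : Cnd A B, IsOpen {x | cndCoord i x ≠ 0} := fun i =>
      isOpen_ne_fun (contDiff_cndCoord i).continuous continuous_const
    exact (hc _).inter ((hc _).inter ((hc _).inter (hc _)))
  · intro g c hc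
    rw [hC.mem_jetClass]
    have h0 : tangentEqs o a a' (c.coord 2 g) = 0 ↔ axisEqs o (c.coord 2 g) = 0 ∧
        (cndCoord (.inl (a, 0)) (c.coord 2 g) * cndCoord (.inl (a', 1)) (c.coord 2 g)) ^ 2
        - (cndCoord (.inl (a, 1)) (c.coord 2 g) * cndCoord (.inl (a', 0)) (c.coord 2 g)) ^ 2
          = 0 := by
      constructor
      · exact fun h => ⟨funext fun i => congrFun h (.inl i), congrFun h (.inr ())⟩
      · rintro ⟨h1, h2⟩
        ext i
        rcases i with i | i
        · exact congrFun h1 i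
        · exact h2
    rw [h0, ← onAxis_iff hc o]
    have h1 : TangentStratum a a' g ↔ OnAxis g ∧ TangentIn c.freeChart g a a' := by
      refine and_congr_right ?_
      rintro ⟨w, hw, hA, hB⟩
      exact ⟨(AxisRel.refl hw hA hB).tangentIn g.chartsAt (c.chartsAt hc),
        (AxisRel.refl hw hA hB).tangentIn (c.chartsAt hc) g.chartsAt⟩
    rw [h1]
    constructor
    · rintro ⟨k1, k2, k3⟩
      exact ⟨k2, k1, k3⟩
    · rintro ⟨k2, k1, k3⟩
      exact ⟨k1, k2, k3⟩
  · rw [Fintype.card_sum, Nat.cast_add, card_axisEqs, Fintype.card_unit]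
    push_cast
    ring

end Strata

end

section

variable {S : Type*} [TopologicalSpace S] [ChartedSpace ℝ S] {σ : SmoothInvolution S} {A B : Type}

/-! ### Tangent directions to right-left classes -/

/-- `v` is the velocity of a curve of multijets of multigerms equivalent to `g`. -/
def IsOrbitDirection [Fintype A] [Fintype B] (c : JetChart σ A B) (k : ℕ) (g : MultiGerm σ A B)
    (v : JetCoord k A B) : Prop :=
  ∃ G : ℝ → MultiGerm σ A B, ∀ᶠ t in 𝓝 (0 : ℝ), RLEquiv g (G t) ∧ c.Domain (G t) ∧
    c.coord k (G t) = c.coord k g + t • v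

/-- `T` is the derivative, at the jet of `g`, of a submersion defining `D`. By invariance the
submersion vanishes along any curve of jets of multigerms equivalent to `g`, hence so does its
derivative in the direction of that curve. -/
theorem IsSingularity.exists_linearMap [Fintype A] [Fintype B] {k : ℕ}
    {D : Set (MultiJet σ k A B)} {r : ℕ} (hD : IsSingularity D r) {g : MultiGerm σ A B}
    (hg : g.jet k ∈ D) :
    ∃ c : JetChart σ A B, c.Domain g ∧
      ∃ T : JetCoord k A B →ₗ[ℝ] (Fin (Fintype.card A + r) → ℝ), Function.Surjective T ∧
        ∀ v, IsOrbitDirection c k g v → T v = 0 := by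
  obtain ⟨hinv, w, hsub, hw⟩ := hD
  obtain rfl : w = Fintype.card A + r := by omega
  obtain ⟨c, hc, U, hU, hgU, F, hF, hsurj, hiff⟩ := hsub g hg
  refine ⟨c, hc, fderiv ℝ F (c.coord k g), hsurj _ hgU, ?_⟩
  rintro v ⟨G, hG⟩
  have hd : HasFDerivAt F (fderiv ℝ F (c.coord k g)) (c.coord k g + (0 : ℝ) • v) := by
    simpa using ((hF.contDiffAt (hU.mem_nhds hgU)).differentiableAt (by simp)).hasFDerivAt
  have hline : HasDerivAt (fun s : ℝ => c.coord k g + s • v) v 0 := by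
    simpa using ((hasDerivAt_id (0 : ℝ)).smul_const v).const_add (c.coord k g)
  have hcomp := hd.comp_hasDerivAt (0 : ℝ) hline
  have hUev : ∀ᶠ t in 𝓝 (0 : ℝ), c.coord k g + t • v ∈ U := by
    refine hline.continuousAt.eventually (hU.mem_nhds ?_)
    simpa using hgU
  refine hcomp.unique
      ((hasDerivAt_const (0 : ℝ) (0 : Fin (Fintype.card A + r) → ℝ)).congr_of_eventuallyEq ?_)
  filter_upwards [hG, hUev] with t h1 h2
  have := (hiff (G t) h1.2.1 (h1.2.2 ▸ h2)).1 (hinv g (G t) h1.1 hg)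
  rw [h1.2.2] at this
  exact this

/-- A surjective linear map to `ℝʷ` that vanishes on the kernel of a linear map to `ℝᶜ`
has `w ≤ c`. -/
theorem le_of_ker_le {E : Type*} [AddCommGroup E] [Module ℝ E] {w n : ℕ}
    {T : E →ₗ[ℝ] (Fin w → ℝ)} (hT : Function.Surjective T) (L : E →ₗ[ℝ] (Fin n → ℝ))
    (h : ∀ v, L v = 0 → T v = 0) : w ≤ n := by
  have hker : LinearMap.ker L ≤ LinearMap.ker T := fun v hv => h v hv
  have h1 : Function.Surjective ((LinearMap.ker L).liftQ T hker) := by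
    rw [← LinearMap.range_eq_top, Submodule.range_liftQ, LinearMap.range_eq_top]
    exact hT
  have : Module.Finite ℝ (E ⧸ LinearMap.ker L) :=
    Module.Finite.equiv L.quotKerEquivRange.symm
  have h2 := LinearMap.finrank_le_finrank_of_surjective h1
  have h3 : Module.finrank ℝ (E ⧸ LinearMap.ker L) ≤ n := by
    rw [L.quotKerEquivRange.finrank_eq]
    simpa using Submodule.finrank_le (LinearMap.range L)
  simpa using h2.trans h3

/-! ### Diffeomorphisms of the plane -/

/-- A compactly supported field has a global Lipschitz constant `C`. When `|t| * C < 1`, the map is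
a perturbation of the identity with invertible derivative everywhere, hence a homeomorphism with
smooth inverse. -/
theorem exists_diffeo_near_id {X : ℝ × ℝ → ℝ × ℝ} (hX : ContDiff ℝ ∞ X)
    (hc : HasCompactSupport X) :
    ∀ᶠ t in 𝓝 (0 : ℝ), ∃ H : (ℝ × ℝ) ≃ₜ (ℝ × ℝ), (∀ v, H v = v + t • X v) ∧
      ContDiff ℝ ∞ H.symm := by
  obtain ⟨C, hC⟩ := ContDiff.lipschitzWith_of_hasCompactSupport hc hX (by simp)
  have hsmall : ∀ᶠ t in 𝓝 (0 : ℝ), ‖t‖₊ * C < 1 := by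
    have : Continuous fun t : ℝ => ‖t‖₊ * C := by fun_prop
    exact this.continuousAt.eventually (gt_mem_nhds (by simp))
  filter_upwards [hsmall] with t ht
  let f : ℝ × ℝ → ℝ × ℝ := fun v => v + t • X v
  have happ : ApproximatesLinearOn f
      ((ContinuousLinearEquiv.refl ℝ (ℝ × ℝ) : (ℝ × ℝ) ≃L[ℝ] (ℝ × ℝ)) : (ℝ × ℝ) →L[ℝ] (ℝ × ℝ))
      Set.univ (‖t‖₊ * C) := by
    intro x _ y _
    have h1 := hC.dist_le_mul x y
    rw [dist_eq_norm, dist_eq_norm] at h1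
    have h2 : f x - f y - (x - y) = t • (X x - X y) := by
      simp only [f, smul_sub]; abel
    change ‖f x - f y - (x - y)‖ ≤ _
    rw [h2, norm_smul]
    push_cast
    rw [mul_assoc]
    exact mul_le_mul_of_nonneg_left h1 (norm_nonneg t)
  have hN : ‖t‖₊ * C < ‖((ContinuousLinearEquiv.refl ℝ (ℝ × ℝ)).symm :
      (ℝ × ℝ) →L[ℝ] (ℝ × ℝ))‖₊⁻¹ := by
    have : ‖((ContinuousLinearEquiv.refl ℝ (ℝ × ℝ)).symm : (ℝ × ℝ) →L[ℝ] (ℝ × ℝ))‖₊ = 1 := by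
      change ‖ContinuousLinearMap.id ℝ (ℝ × ℝ)‖₊ = 1
      exact NNReal.eq ContinuousLinearMap.norm_id
    rwa [this, inv_one]
  let H := happ.toHomeomorph f (Or.inr hN)
  have hH : ∀ v, H v = f v := fun v => rfl
  refine ⟨H, hH, contDiff_iff_contDiffAt.2 fun y => ?_⟩
  have hf : ContDiff ℝ ∞ f := contDiff_id.add (hX.const_smul t)
  set x := H.symm y with hx
  have hXd := (hX.differentiable (by simp) x).hasFDerivAt
  have hfd : HasFDerivAt f (ContinuousLinearMap.id ℝ _ + t • fderiv ℝ X x) x :=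
    (hasFDerivAt_id x).add (hXd.const_smul t)
  have hinj : Function.Injective
      (ContinuousLinearMap.id ℝ (ℝ × ℝ) + t • fderiv ℝ X x : (ℝ × ℝ) →L[ℝ] (ℝ × ℝ)) := by
    rw [injective_iff_map_eq_zero]
    intro v hv
    have h1 : v = -(t • fderiv ℝ X x v) := eq_neg_of_add_eq_zero_left hv
    have h2 : ‖v‖ ≤ (‖t‖ * C) * ‖v‖ := by
      calc ‖v‖ = ‖t‖ * ‖fderiv ℝ X x v‖ := by
            conv_lhs => rw [h1]
            rw [norm_neg, norm_smul]
        _ ≤ ‖t‖ * (C * ‖v‖) := by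
            gcongr
            exact (fderiv ℝ X x).le_of_opNorm_le (norm_fderiv_le_of_lipschitz ℝ hC) v
        _ = _ := by ring
    have h3 : ‖t‖ * C < 1 := by exact_mod_cast ht
    by_contra hne
    have : 0 < ‖v‖ := norm_pos_iff.2 hne
    nlinarith
  let E : (ℝ × ℝ) ≃L[ℝ] (ℝ × ℝ) :=
    (LinearEquiv.ofInjectiveEndo
      ((ContinuousLinearMap.id ℝ (ℝ × ℝ) + t • fderiv ℝ X x : (ℝ × ℝ) →L[ℝ] (ℝ × ℝ)) :
        (ℝ × ℝ) →ₗ[ℝ] (ℝ × ℝ)) hinj).toContinuousLinearEquiv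
  have hE : (E : (ℝ × ℝ) →L[ℝ] (ℝ × ℝ)) = ContinuousLinearMap.id ℝ _ + t • fderiv ℝ X x := by
    ext1 <;> rfl
  exact H.toOpenPartialHomeomorph.contDiffAt_symm (f₀' := E) (n := ∞) (Set.mem_univ y)
    (by rw [hE]; exact hfd) hf.contDiffAt

/-- Equivariant vector fields on the plane can be cut off outside of a large disc. -/
theorem exists_cutoff {X : ℝ × ℝ → ℝ × ℝ} (hX : ContDiff ℝ ∞ X)
    (hτ : ∀ v, X (tau v) = tau (X v)) {Q : Set (ℝ × ℝ)} (hQ : Q.Finite) :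
    ∃ Y : ℝ × ℝ → ℝ × ℝ, ContDiff ℝ ∞ Y ∧ HasCompactSupport Y ∧ (∀ v, Y (tau v) = tau (Y v)) ∧
      ∀ q ∈ Q, Y =ᶠ[𝓝 q] X := by
  let N : ℝ × ℝ → ℝ := fun v => v.1 ^ 2 + v.2 ^ 2
  have hN : ContDiff ℝ ∞ N := by fun_prop
  obtain ⟨R, hR⟩ := (hQ.image N).bddAbove
  -- The bump is applied to `N`, which is invariant under `tau`, so equivariance is kept. It equals
  -- one where `N ≤ |R| + 1`, hence near `Q`. It vanishes for `N ≥ |R| + 2`, hence outside the ball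
  -- of that radius, which exceeds one.
  let β : ContDiffBump (0 : ℝ) := ⟨|R| + 1, |R| + 2, by positivity, by linarith⟩
  refine ⟨fun v => β (N v) • X v, (β.contDiff.comp hN).smul hX, ?_, fun v => ?_, fun q hq => ?_⟩
  · refine HasCompactSupport.intro (isCompact_closedBall (0 : ℝ × ℝ) (|R| + 2)) fun v hv => ?_
    have h1 : |R| + 2 ≤ N v := by
      have h2 : |R| + 2 < ‖v‖ := by simpa using hv
      have h3 : ‖v‖ ^ 2 ≤ N v := by
        rw [Prod.norm_def]
        simp only [N, Real.norm_eq_abs]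
        rcases max_cases |v.1| |v.2| with ⟨h, -⟩ | ⟨h, -⟩ <;> rw [h, sq_abs] <;> nlinarith
            [sq_nonneg v.1, sq_nonneg v.2]
      nlinarith [abs_nonneg R]
    have h2 : β (N v) = 0 := β.zero_of_le_dist (by
      rw [Real.dist_eq, sub_zero]
      exact h1.trans (le_abs_self _))
    simp [h2]
  · have h1 : N (tau v) = N v := by simp [N, tau]
    simp only [h1, hτ]
    exact (tauL.map_smul _ _).symm
  · have h1 : ∀ᶠ v in 𝓝 q, N v < |R| + 1 := by
      refine hN.continuous.continuousAt.eventually (gt_mem_nhds ?_)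
      have := hR (Set.mem_image_of_mem N hq)
      linarith [le_abs_self R]
    filter_upwards [h1] with v hv
    have h2 : β (N v) = 1 := β.one_of_mem_closedBall (by
      have : 0 ≤ N v := by simp only [N]; positivity
      rw [Metric.mem_closedBall, Real.dist_eq, sub_zero, abs_of_nonneg this]
      exact hv.le)
    simp [h2]

/-! ### Directions given by vector fields on the plane -/

/-- The composition of a multigerm with an equivariant map of the plane. -/
def MultiGerm.postcomp (g : MultiGerm σ A B) (H : ℝ × ℝ → ℝ × ℝ) (hH : ContDiff ℝ ∞ H)
    (hτ : ∀ v, H (tau v) = tau (H v)) : MultiGerm σ A B where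
  map :=
    { toFun := H ∘ g.map
      smooth := hH.contMDiff.comp g.map.smooth
      equivariant := fun s => by simp [g.map.equivariant, hτ] }
  free := g.free
  fixedPt := g.fixedPt
  free_ne := g.free_ne
  free_distinct := g.free_distinct
  fixedPt_eq := g.fixedPt_eq
  fixedPt_inj := g.fixedPt_inj

theorem MultiGerm.rlEquiv_postcomp (g : MultiGerm σ A B) (H : (ℝ × ℝ) ≃ₜ (ℝ × ℝ))
    (hH : ContDiff ℝ ∞ H) (hH' : ContDiff ℝ ∞ H.symm) (hτ : ∀ v, H (tau v) = tau (H v)) :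
    RLEquiv g (g.postcomp H hH hτ) :=
  ⟨OpenPartialHomeomorph.refl S, H.toOpenPartialHomeomorph, contMDiffOn_id, contMDiffOn_id,
    hH.contDiffOn, hH'.contDiffOn, fun _ _ => ⟨trivial, rfl⟩, fun w _ => ⟨trivial, hτ w⟩,
    fun _ => ⟨trivial, Or.inl rfl⟩, fun _ => ⟨trivial, rfl⟩, fun _ _ => ⟨trivial, rfl⟩⟩

/-- The multijet of the composition of the multigerm with a vector field on the plane. -/
def fieldJet (c : JetChart σ A B) (k : ℕ) (g : MultiGerm σ A B) (X : ℝ × ℝ → ℝ × ℝ) :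
    JetCoord k A B :=
  (fun a => (0, fun i => localDeriv i (c.freeChart a) (X ∘ g.map) (g.free a)),
    fun b j => ((localDeriv (2 * j + 1) (c.fixedChart b) (X ∘ g.map) (g.fixedPt b)).1,
      (localDeriv (2 * j) (c.fixedChart b) (X ∘ g.map) (g.fixedPt b)).2))

theorem localDeriv_add_smul {e : OpenPartialHomeomorph S ℝ}
    (he : e ∈ IsManifold.maximalAtlas 𝓘(ℝ, ℝ) ∞ S) {s : S} (hs : s ∈ e.source)
    {φ ψ φ' : S → ℝ × ℝ} (hφ : ContMDiffAt 𝓘(ℝ, ℝ) 𝓘(ℝ, ℝ × ℝ) ∞ φ s)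
    (hψ : ContMDiffAt 𝓘(ℝ, ℝ) 𝓘(ℝ, ℝ × ℝ) ∞ ψ s) {t : ℝ}
    (h : φ' =ᶠ[𝓝 s] fun z => φ z + t • ψ z) (i : ℕ) :
    localDeriv i e φ' s = localDeriv i e φ s + t • localDeriv i e ψ s := by
  have hesymm : Tendsto e.symm (𝓝 (e s)) (𝓝 s) := by
    simpa [ContinuousAt, e.left_inv hs] using e.continuousAt_symm (e.map_source hs)
  have h1 : φ' ∘ e.symm =ᶠ[𝓝 (e s)] fun u => (φ ∘ e.symm) u + t • (ψ ∘ e.symm) u :=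
    hesymm.eventually h
  have hψ' := (contDiffAt_comp_symm he hs hψ).nat i
  unfold localDeriv
  rw [h1.iteratedDeriv_eq i,
    iteratedDeriv_fun_add ((contDiffAt_comp_symm he hs hφ).nat i) (hψ'.const_smul t),
    iteratedDeriv_fun_const_smul hψ']

/-- The curve consists of the composites with `v + t • Y v`, where `Y` is the field cut off far
away. Their jets are affine in `t`, and only the germs of `Y` at the image points matter, where `Y`
agrees with `X`. -/
theorem isOrbitDirection_fieldJet [Fintype A] [Fintype B] {c : JetChart σ A B} (k : ℕ)
    {g : MultiGerm σ A B} (hc : c.Domain g) {X : ℝ × ℝ → ℝ × ℝ} (hX : ContDiff ℝ ∞ X)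
    (hτ : ∀ v, X (tau v) = tau (X v)) : IsOrbitDirection c k g (fieldJet c k g X) := by
  classical
  have hQ : (Set.range (fun a => g.map (g.free a)) ∪
      Set.range (fun b => g.map (g.fixedPt b))).Finite :=
    (Set.finite_range _).union (Set.finite_range _)
  obtain ⟨Y, hY, hYc, hYτ, hYX⟩ := exists_cutoff hX hτ hQ
  have hHτ : ∀ (t : ℝ) v, tau v + t • Y (tau v) = tau (v + t • Y v) := fun t v => by
    rw [hYτ]
    change tauL v + t • tauL (Y v) = tauL (v + t • Y v)
    rw [map_add, map_smul]
  have hsm : ∀ t : ℝ, ContDiff ℝ ∞ fun v => v + t • Y v := fun t =>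
    contDiff_id.add (hY.const_smul t)
  refine ⟨fun t => g.postcomp (fun v => v + t • Y v) (hsm t) (hHτ t), ?_⟩
  have hch := c.chartsAt hc
  have hg : ∀ s, ContMDiffAt 𝓘(ℝ, ℝ) 𝓘(ℝ, ℝ × ℝ) ∞ g.map s := fun s => g.map.smooth.contMDiffAt
  have hXg : ∀ s, ContMDiffAt 𝓘(ℝ, ℝ) 𝓘(ℝ, ℝ × ℝ) ∞ (X ∘ g.map) s := fun s =>
    (hX.contMDiff.comp g.map.smooth).contMDiffAt
  have hev : ∀ (t : ℝ) s, Y =ᶠ[𝓝 (g.map s)] X →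
      (fun z => g.map z + t • Y (g.map z)) =ᶠ[𝓝 s] fun z => g.map z + t • (X ∘ g.map) z :=
    fun t s h => by
      filter_upwards [(hg s).continuousAt.eventually h] with z hz
      simp [hz]
  filter_upwards [exists_diffeo_near_id hY hYc] with t ⟨H, hH, hHs⟩
  refine ⟨?_, hc, ?_⟩
  · have hHf : (H : ℝ × ℝ → ℝ × ℝ) = fun v => v + t • Y v := funext hH
    have := g.rlEquiv_postcomp H (by rw [hHf]; exact hsm t) hHs (by rw [hHf]; exact hHτ t)
    convert this using 2
    exact hHf.symm
  · have h1 : ∀ a i, localDeriv i (c.freeChart a) (fun z => g.map z + t • Y (g.map z)) (g.free a)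
        = localDeriv i (c.freeChart a) g.map (g.free a)
          + t • localDeriv i (c.freeChart a) (X ∘ g.map) (g.free a) := fun a i =>
      localDeriv_add_smul (hch.free_mem a) (hch.free_src a) (hg _) (hXg _)
        (hev t _ (hYX _ (Or.inl ⟨a, rfl⟩))) i
    have h2 : ∀ b i, localDeriv i (c.fixedChart b) (fun z => g.map z + t • Y (g.map z))
        (g.fixedPt b) = localDeriv i (c.fixedChart b) g.map (g.fixedPt b)
          + t • localDeriv i (c.fixedChart b) (X ∘ g.map) (g.fixedPt b) := fun b i =>
      localDeriv_add_smul (hch.fixed_mem b) (hch.fixed_src b) (hg _) (hXg _)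
        (hev t _ (hYX _ (Or.inr ⟨b, rfl⟩))) i
    refine Prod.ext (funext fun a => Prod.ext ?_ (funext fun i => ?_))
      (funext fun b => funext fun j => ?_)
    · simp [JetChart.coord, fieldJet, MultiGerm.postcomp]
    · exact h1 a i
    · have h3 := congrArg Prod.fst (h2 b (2 * j + 1))
      have h4 := congrArg Prod.snd (h2 b (2 * j))
      exact Prod.ext h3 h4

end

section

variable {S : Type*} [TopologicalSpace S] [ChartedSpace ℝ S] {σ : SmoothInvolution S} {A B : Type}

/-! ### Moving the base point of a free branch -/

theorem contMDiffOn_disjointUnion {h h' : OpenPartialHomeomorph S S}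
    [∀ x, Decidable (x ∈ h.source)] [∀ y, Decidable (y ∈ h.target)]
    (hs : Disjoint h.source h'.source) (ht : Disjoint h.target h'.target)
    (h1 : ContMDiffOn 𝓘(ℝ, ℝ) 𝓘(ℝ, ℝ) ∞ h h.source)
    (h2 : ContMDiffOn 𝓘(ℝ, ℝ) 𝓘(ℝ, ℝ) ∞ h' h'.source) :
    ContMDiffOn 𝓘(ℝ, ℝ) 𝓘(ℝ, ℝ) ∞ (h.disjointUnion h' hs ht)
      (h.disjointUnion h' hs ht).source := by
  rintro z (hz | hz)
  · have h3 : h.source ∈ 𝓝 z := h.open_source.mem_nhds hz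
    refine (((h1 z hz).contMDiffAt h3).congr_of_eventuallyEq ?_).contMDiffWithinAt
    filter_upwards [h3] with y hy
    exact Set.piecewise_eq_of_mem _ _ _ hy
  · have h3 : h'.source ∈ 𝓝 z := h'.open_source.mem_nhds hz
    refine (((h2 z hz).contMDiffAt h3).congr_of_eventuallyEq ?_).contMDiffWithinAt
    filter_upwards [h3] with y hy
    exact Set.piecewise_eq_of_notMem _ _ _ (Set.disjoint_right.1 hs hy)

theorem contMDiffOn_disjointUnion_symm {h h' : OpenPartialHomeomorph S S}
    [∀ x, Decidable (x ∈ h.source)] [∀ y, Decidable (y ∈ h.target)]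
    (hs : Disjoint h.source h'.source) (ht : Disjoint h.target h'.target)
    (h1 : ContMDiffOn 𝓘(ℝ, ℝ) 𝓘(ℝ, ℝ) ∞ h.symm h.target)
    (h2 : ContMDiffOn 𝓘(ℝ, ℝ) 𝓘(ℝ, ℝ) ∞ h'.symm h'.target) :
    ContMDiffOn 𝓘(ℝ, ℝ) 𝓘(ℝ, ℝ) ∞ (h.disjointUnion h' hs ht).symm
      (h.disjointUnion h' hs ht).target :=
  @contMDiffOn_disjointUnion _ _ _ h.symm h'.symm
    (inferInstanceAs (∀ y, Decidable (y ∈ h.target)))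
        (inferInstanceAs (∀ x, Decidable (x ∈ h.source)))
    ht hs h1 h2

/-- A local diffeomorphism supported away from its mirror image extends by the identity to an
equivariant one. -/
theorem exists_equivariant_extension (σ : SmoothInvolution S) {K : Set S} (hK : IsClosed K)
    (hKσ : ∀ z ∈ K, σ z ∉ K) {h : OpenPartialHomeomorph S S} (hs : h.source ⊆ K)
    (ht : h.target ⊆ K) (h1 : ContMDiffOn 𝓘(ℝ, ℝ) 𝓘(ℝ, ℝ) ∞ h h.source)
    (h2 : ContMDiffOn 𝓘(ℝ, ℝ) 𝓘(ℝ, ℝ) ∞ h.symm h.target) :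
    ∃ H : OpenPartialHomeomorph S S, ContMDiffOn 𝓘(ℝ, ℝ) 𝓘(ℝ, ℝ) ∞ H H.source ∧
      ContMDiffOn 𝓘(ℝ, ℝ) 𝓘(ℝ, ℝ) ∞ H.symm H.target ∧
      (∀ z ∈ H.source, σ z ∈ H.source ∧ H (σ z) = σ (H z)) ∧
      (∀ z ∈ h.source, z ∈ H.source ∧ H z = h z) ∧
      (∀ z, z ∉ K → σ z ∉ K → z ∈ H.source ∧ H z = z) ∧
      ∀ z ∈ H.source, z ∈ h.source ∨ σ z ∈ h.source ∨ (z ∉ K ∧ σ z ∉ K) := by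
  classical
  have hσσ : ∀ z, σ (σ z) = z := σ.involutive
  have hσc : Continuous σ := σ.smooth.continuous
  let hσ : S ≃ₜ S := ⟨⟨σ, σ, hσσ, hσσ⟩, hσc, hσc⟩
  -- The conjugate of `h` by `σ`. The maps `h`, `j` and the identity away from `K` and its mirror
  -- image have disjoint sources and disjoint targets, so they glue.
  let j : OpenPartialHomeomorph S S := (hσ.toOpenPartialHomeomorph.trans h).trans
    hσ.toOpenPartialHomeomorph
  have hjs : ∀ z, z ∈ j.source ↔ σ z ∈ h.source := fun z => by
    simp [j, hσ]
  have hjt : ∀ z, z ∈ j.target ↔ σ z ∈ h.target := fun z => by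
    simp only [j, OpenPartialHomeomorph.trans_target]
    simp [hσ, Homeomorph.symm]
  have hjv : ∀ z, j z = σ (h (σ z)) := fun z => rfl
  have hjv' : ∀ z, j.symm z = σ (h.symm (σ z)) := fun z => rfl
  have hdis : Disjoint h.source j.source := Set.disjoint_left.2 fun z hz hz' =>
    hKσ z (hs hz) (hs ((hjs z).1 hz'))
  have hdit : Disjoint h.target j.target := Set.disjoint_left.2 fun z hz hz' =>
    hKσ z (ht hz) (ht ((hjt z).1 hz'))
  have hM : IsOpen (K ∪ σ ⁻¹' K)ᶜ := (hK.union (hK.preimage hσc)).isOpen_compl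
  let i : OpenPartialHomeomorph S S := OpenPartialHomeomorph.ofSet _ hM
  let u := h.disjointUnion j hdis hdit
  have hus : Disjoint u.source i.source := Set.disjoint_left.2 fun z hz hz' => by
    rcases hz with hz | hz
    · exact hz' (Or.inl (hs hz))
    · exact hz' (Or.inr (hs ((hjs z).1 hz)))
  have hut : Disjoint u.target i.target := Set.disjoint_left.2 fun z hz hz' => by
    rcases hz with hz | hz
    · exact hz' (Or.inl (ht hz))
    · exact hz' (Or.inr (ht ((hjt z).1 hz)))
  let H := u.disjointUnion i hus hut
  have hH1 : ∀ z ∈ h.source, H z = h z := fun z hz => by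
    have a1 : H z = u z := Set.piecewise_eq_of_mem _ _ _ (show z ∈ u.source from Or.inl hz)
    rw [a1]
    exact Set.piecewise_eq_of_mem _ _ _ hz
  have hH2 : ∀ z, σ z ∈ h.source → H z = σ (h (σ z)) := fun z hz => by
    have hz' := (hjs z).2 hz
    have a1 : H z = u z := Set.piecewise_eq_of_mem _ _ _ (show z ∈ u.source from Or.inr hz')
    rw [a1]
    exact Set.piecewise_eq_of_notMem _ _ _ (Set.disjoint_right.1 hdis hz')
  have hH3 : ∀ z, z ∉ K → σ z ∉ K → z ∈ H.source ∧ H z = z := fun z hz hz' => by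
    have hzi : z ∈ i.source := fun hmem => hmem.elim hz hz'
    exact ⟨Or.inr hzi, Set.piecewise_eq_of_notMem _ _ _ (Set.disjoint_right.1 hus hzi)⟩
  have hcase : ∀ z ∈ H.source, z ∈ h.source ∨ σ z ∈ h.source ∨ (z ∉ K ∧ σ z ∉ K) := by
    rintro z ((hz | hz) | hz)
    · exact Or.inl hz
    · exact Or.inr (Or.inl ((hjs z).1 hz))
    · exact Or.inr (Or.inr ⟨fun h' => hz (Or.inl h'), fun h' => hz (Or.inr h')⟩)
  refine ⟨H, ?_, ?_, fun z hz => ?_, fun z hz => ⟨Or.inl (Or.inl hz), hH1 z hz⟩, hH3, hcase⟩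
  · refine contMDiffOn_disjointUnion _ _ (contMDiffOn_disjointUnion _ _ h1 ?_) contMDiffOn_id
    exact σ.smooth.comp_contMDiffOn (h1.comp σ.smooth.contMDiffOn fun z hz => (hjs z).1 hz)
  · refine contMDiffOn_disjointUnion_symm _ _ (contMDiffOn_disjointUnion_symm _ _ h2 ?_)
      contMDiffOn_id
    exact σ.smooth.comp_contMDiffOn (h2.comp σ.smooth.contMDiffOn fun z hz => (hjt z).1 hz)
  · rcases hcase z hz with h' | h' | ⟨h', h''⟩
    · have h3 : σ (σ z) ∈ h.source := by rwa [hσσ]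
      exact ⟨Or.inl (Or.inr ((hjs _).2 h3)), by rw [hH1 z h', hH2 _ h3, hσσ]⟩
    · exact ⟨Or.inl (Or.inl h'), by rw [hH1 _ h', hH2 z h', hσσ]⟩
    · obtain ⟨k1, k2⟩ := hH3 (σ z) h'' (by rwa [hσσ])
      exact ⟨k1, by rw [k2, (hH3 z h' h'').2]⟩

/-- A multigerm can be changed near a free branch by translating the coordinate. -/
theorem exists_translate (φ : EquivariantMap σ) {χ : S → ℝ}
    (hχ : ContMDiff 𝓘(ℝ, ℝ) 𝓘(ℝ, ℝ) ∞ χ) {e : OpenPartialHomeomorph S ℝ}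
    (he : e ∈ IsManifold.maximalAtlas 𝓘(ℝ, ℝ) ∞ S) (hχe : tsupport χ ⊆ e.source)
    (hχσ : ∀ z ∈ tsupport χ, σ z ∉ tsupport χ) {t : ℝ}
    (ht : ∀ z ∈ tsupport χ, e z - t ∈ e.target) :
    ∃ φ' : EquivariantMap σ, (∀ z, χ z = 1 → φ' z = φ (e.symm (e z - t))) ∧
      ∀ z, z ∉ tsupport χ → σ z ∉ tsupport χ → φ' z = φ z := by
  -- The cut-off change on one branch. Adding its reflected copy on the mirror branch restores
  -- equivariance, and the two supports do not meet.
  let ψ : S → ℝ × ℝ := fun z => χ z • (φ (e.symm (e z - t)) - φ z)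
  have hψ0 : ∀ z, z ∉ tsupport χ → ψ z = 0 := fun z hz => by
    simp [ψ, image_eq_zero_of_notMem_tsupport hz]
  have hψ : ContMDiff 𝓘(ℝ, ℝ) 𝓘(ℝ, ℝ × ℝ) ∞ ψ := fun z => by
    by_cases hz : z ∈ tsupport χ
    · have h1 : ContMDiffAt 𝓘(ℝ, ℝ) 𝓘(ℝ, ℝ) ∞ (fun z => e z - t) z :=
        (contMDiffAt_of_mem_maximalAtlas he (hχe hz)).sub contMDiffAt_const
      have h2 : ContMDiffAt 𝓘(ℝ, ℝ) 𝓘(ℝ, ℝ × ℝ) ∞ (fun z => φ (e.symm (e z - t))) z :=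
        (φ.smooth.contMDiffAt (x := e.symm (e z - t))).comp z
          ((contMDiffAt_symm_of_mem_maximalAtlas he (ht z hz)).comp z h1)
      exact hχ.contMDiffAt.smul (h2.sub φ.smooth.contMDiffAt)
    · refine (contMDiffAt_const (c := (0 : ℝ × ℝ))).congr_of_eventuallyEq ?_
      filter_upwards [(isClosed_tsupport χ).isOpen_compl.mem_nhds hz] with y hy using hψ0 y hy
  refine ⟨⟨fun z => φ z + (ψ z + tauL (ψ (σ z))), ?_, fun z => ?_⟩, fun z hz => ?_,
    fun z hz hz' => ?_⟩
  · exact φ.smooth.add (hψ.add (tauL.contDiff.contMDiff.comp (hψ.comp σ.smooth)))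
  · rw [φ.equivariant, σ.involutive z]
    change tauL (φ z) + (ψ (σ z) + tauL (ψ z)) = tauL (φ z + (ψ z + tauL (ψ (σ z))))
    have : tauL (tauL (ψ (σ z))) = ψ (σ z) := tau_tau (ψ (σ z))
    rw [map_add, map_add, this, add_comm (ψ (σ z))]
  · have h1 : z ∈ tsupport χ := subset_tsupport χ (by simp [hz])
    change φ z + (ψ z + tauL (ψ (σ z))) = _
    rw [hψ0 _ (hχσ z h1), map_zero, add_zero]
    simp [ψ, hz]
  · change φ z + (ψ z + tauL (ψ (σ z))) = _
    rw [hψ0 _ hz, hψ0 _ hz', map_zero, add_zero, add_zero]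

/-- Translate the coordinate of the branch `a` together with its base point. The derivatives at the
base point do not change and its position grows by `t`, while the new multigerm is right equivalent
to the old one. -/
theorem isOrbitDirection_move [IsManifold 𝓘(ℝ, ℝ) ∞ S] [T2Space S] [Fintype A] [Fintype B]
    [DecidableEq A] {c : JetChart σ A B} (k : ℕ)
    {g : MultiGerm σ A B} (hc : c.Domain g) (a : A) :
    IsOrbitDirection c k g (Pi.single a (1, 0), 0) := by
  have hσσ : ∀ z, σ (σ z) = z := σ.involutive
  have hσc : Continuous σ := σ.smooth.continuous
  have hch := c.chartsAt hc
  set s := g.free a with hs_def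
  set e := c.freeChart a with he_def
  have he : e ∈ IsManifold.maximalAtlas 𝓘(ℝ, ℝ) ∞ S := hch.free_mem a
  have hs : s ∈ e.source := hch.free_src a
  have het : e s ∈ e.target := e.map_source hs
  -- the base points to be avoided
  let Q : Set S := (Set.range g.fixedPt) ∪ ((g.free '' {a}ᶜ) ∪ (σ '' (g.free '' {a}ᶜ)))
  have hQ : Q.Finite := (Set.finite_range _).union
    ((Set.toFinite _).union (Set.toFinite _))
  have hsQ : s ∉ Q := by
    rintro (⟨b, hb⟩ | ⟨a', ha', h⟩ | ⟨_, ⟨a', ha', rfl⟩, h⟩)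
    · exact g.free_ne a (by rw [← hs_def, ← hb]; exact g.fixedPt_eq b)
    · exact (g.free_distinct a a' (fun h => ha' h.symm)).1 h
    · refine (g.free_distinct a a' (fun h => ha' h.symm)).2 ?_
      rw [← hs_def, ← h, hσσ]
  obtain ⟨ρ, hρ, hball⟩ := Metric.isOpen_iff.1 e.open_target _ het
  obtain ⟨U₁, U₂, hU₁, hU₂, hsU₁, hsU₂, hdisj⟩ := t2_separation (g.free_ne a).symm
  -- The bump must be supported inside the chart, with room `ρ / 2` for translations, away from its
  -- mirror image, and away from all other base points.
  have hN : (e.source ∩ e ⁻¹' Metric.ball (e s) (ρ / 2)) ∩ (U₁ ∩ σ ⁻¹' U₂) ∩ Qᶜ ∈ 𝓝 s := by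
    refine inter_mem (inter_mem ?_ ?_) (hQ.isClosed.isOpen_compl.mem_nhds hsQ)
    · exact inter_mem (e.open_source.mem_nhds hs)
        ((e.continuousAt hs).preimage_mem_nhds (Metric.ball_mem_nhds _ (by positivity)))
    · exact inter_mem (hU₁.mem_nhds hsU₁) (hσc.continuousAt.preimage_mem_nhds (hU₂.mem_nhds hsU₂))
  obtain ⟨χ, -, hχN⟩ := (SmoothBumpFunction.nhds_basis_tsupport (I := 𝓘(ℝ, ℝ)) s).mem_iff.1 hN
  set K := tsupport χ with hK_def
  have hKc : IsClosed K := isClosed_tsupport _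
  have hKσ : ∀ z ∈ K, σ z ∉ K := fun z hz hz' =>
    Set.disjoint_left.1 hdisj (hχN hz').1.2.1 (hχN hz).1.2.2
  have hKQ : ∀ q ∈ Q, q ∉ K := fun q hq hq' => (hχN hq').2 hq
  have hKe : K ⊆ e.source := fun z hz => (hχN hz).1.1.1
  have hfree : ∀ a', a' ≠ a → g.free a' ∉ K ∧ σ (g.free a') ∉ K := fun a' ha' =>
    ⟨hKQ _ (Or.inr (Or.inl ⟨a', ha', rfl⟩)), hKQ _ (Or.inr (Or.inr ⟨_, ⟨a', ha', rfl⟩, rfl⟩))⟩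
  have hfix : ∀ b, g.fixedPt b ∉ K ∧ σ (g.fixedPt b) ∉ K := fun b => by
    have := hKQ _ (Or.inl ⟨b, rfl⟩)
    exact ⟨this, by rwa [g.fixedPt_eq b]⟩
  obtain ⟨V, hV1, hV, hsV⟩ := mem_nhds_iff.1 χ.eventuallyEq_one
  have hV1' : ∀ z ∈ V, χ z = 1 := fun z hz => hV1 hz
  have hVK : V ⊆ K := fun z hz => subset_tsupport _ (by simp [hV1' z hz])
  -- the moved point
  have hst : ∀ᶠ t in 𝓝 (0 : ℝ), e s + t ∈ e.target ∧ e.symm (e s + t) ∈ V := by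
    have h1 : Tendsto (fun t : ℝ => e s + t) (𝓝 0) (𝓝 (e s)) := by
      have : Continuous fun t : ℝ => e s + t := by fun_prop
      simpa using this.tendsto 0
    refine (h1.eventually (e.open_target.mem_nhds het)).and ?_
    have h2 : Tendsto e.symm (𝓝 (e s)) (𝓝 s) := by
      simpa [ContinuousAt, e.left_inv hs] using e.continuousAt_symm het
    exact (h2.comp h1).eventually (hV.mem_nhds hsV)
  have hsmall : ∀ᶠ t in 𝓝 (0 : ℝ), ∀ z ∈ K, e z - t ∈ e.target := by
    filter_upwards [Metric.ball_mem_nhds (0 : ℝ) (half_pos hρ)] with t ht z hz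
    refine hball ?_
    have h1 : dist (e z) (e s) < ρ / 2 := (hχN hz).1.1.2
    have h2 : dist t 0 < ρ / 2 := ht
    rw [Real.dist_eq] at h1 h2
    rw [Metric.mem_ball, Real.dist_eq]
    rw [sub_zero] at h2
    rw [abs_lt] at h1 h2 ⊢
    constructor <;> linarith [h1.1, h1.2, h2.1, h2.2]
  have key : ∀ t : ℝ, (e s + t ∈ e.target ∧ e.symm (e s + t) ∈ V) →
      (∀ z ∈ K, e z - t ∈ e.target) → ∃ g' : MultiGerm σ A B, RLEquiv g g' ∧ c.Domain g' ∧
        c.coord k g' = c.coord k g + t • (Pi.single a (1, 0), 0) := by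
    rintro t ⟨ht1, ht2⟩ ht3
    obtain ⟨φ', hφ1, hφ2⟩ := exists_translate g.map χ.contMDiff he hKe hKσ ht3
    set s' := e.symm (e s + t) with hs'_def
    have hs'K : s' ∈ K := hVK ht2
    let g' : MultiGerm σ A B :=
      { map := φ'
        free := Function.update g.free a s'
        fixedPt := g.fixedPt
        free_ne := fun a' => by
          rcases eq_or_ne a' a with rfl | h
          · rw [Function.update_self]
            exact fun h => hKσ s' hs'K (by rwa [h])
          · rw [Function.update_of_ne h]; exact g.free_ne a'
        free_distinct := fun a₁ a₂ h => by
          rcases eq_or_ne a₁ a with rfl | h1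
          · rw [Function.update_self, Function.update_of_ne h.symm]
            have := hfree a₂ h.symm
            exact ⟨fun h' => this.1 (by rwa [h']), fun h' => this.2 (by rwa [h', hσσ])⟩
          · rcases eq_or_ne a₂ a with rfl | h2
            · rw [Function.update_self, Function.update_of_ne h1]
              have := hfree a₁ h1
              exact ⟨fun h' => this.1 (by rwa [← h']), fun h' => this.2 (by rwa [← h'])⟩
            · rw [Function.update_of_ne h1, Function.update_of_ne h2]
              exact g.free_distinct a₁ a₂ h
        fixedPt_eq := g.fixedPt_eq
        fixedPt_inj := g.fixedPt_inj }
    have hfa : g'.free a = s' := Function.update_self _ _ _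
    have hfa' : ∀ a', a' ≠ a → g'.free a' = g.free a' := fun a' h => Function.update_of_ne h _ _
    have hφeq : ∀ z, z ∉ K → σ z ∉ K → φ' =ᶠ[𝓝 z] g.map := fun z hz hz' => by
      filter_upwards [hKc.isOpen_compl.mem_nhds hz,
        (hKc.isOpen_compl.preimage hσc).mem_nhds hz'] with y h1 h2
      exact hφ2 y h1 h2
    have hes' : e s' = e s + t := e.right_inv ht1
    refine ⟨g', ?_, ⟨fun a' => ?_, hc.2⟩, ?_⟩
    · -- the right equivalence
      let h₀ : OpenPartialHomeomorph S S :=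
        (e.trans (Homeomorph.addRight t).toOpenPartialHomeomorph).trans e.symm
      have hh₀ : ∀ z, h₀ z = e.symm (e z + t) := fun z => rfl
      -- Both source and target are confined to `V`, where the bump equals one, so that the new map
      -- composed with `h` is exactly the old one.
      let h : OpenPartialHomeomorph S S :=
        ((OpenPartialHomeomorph.ofSet V hV).trans h₀).trans (OpenPartialHomeomorph.ofSet V hV)
      have hh : ∀ z, h z = e.symm (e z + t) := fun z => rfl
      have hhsymm : ∀ z, h.symm z = e.symm (e z - t) := fun z => by
        change e.symm (e z + -t) = _
        rw [sub_eq_add_neg]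
      have hhs : ∀ z, z ∈ h.source ↔ z ∈ V ∧ (z ∈ e.source ∧ e z + t ∈ e.target) ∧
          e.symm (e z + t) ∈ V := fun z => by
        simp only [h, h₀, OpenPartialHomeomorph.trans_source, Set.mem_inter_iff,
          Set.mem_preimage, OpenPartialHomeomorph.ofSet_source, OpenPartialHomeomorph.symm_source]
        simp [and_assoc]
      have hht : ∀ z ∈ h.target, z ∈ V ∧ e z - t ∈ e.target := fun z hz => by
        have h1 := h.map_target hz
        have h2 := h.right_inv hz
        rw [hh] at h2
        obtain ⟨k1, ⟨k2, k3⟩, k4⟩ := (hhs _).1 h1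
        rw [h2] at k4
        refine ⟨k4, ht3 z (hVK k4)⟩
      obtain ⟨H, H1, H2, H3, H4, H5, H6⟩ := exists_equivariant_extension σ hKc hKσ (h := h)
        (fun z hz => hVK ((hhs z).1 hz).1) (fun z hz => hVK (hht z hz).1)
        (fun z hz => by
          obtain ⟨k1, ⟨k2, k3⟩, k4⟩ := (hhs z).1 hz
          have h1 : ContMDiffAt 𝓘(ℝ, ℝ) 𝓘(ℝ, ℝ) ∞ (fun z => e z + t) z :=
            (contMDiffAt_of_mem_maximalAtlas he k2).add contMDiffAt_const
          exact ((contMDiffAt_symm_of_mem_maximalAtlas he k3).comp z h1).contMDiffWithinAt)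
        (fun z hz => by
          obtain ⟨k1, k3⟩ := hht z hz
          have h1 : ContMDiffAt 𝓘(ℝ, ℝ) 𝓘(ℝ, ℝ) ∞ (fun z => e z - t) z :=
            (contMDiffAt_of_mem_maximalAtlas he (hKe (hVK k1))).sub contMDiffAt_const
          have h2 := ((contMDiffAt_symm_of_mem_maximalAtlas he k3).comp z h1)
          rw [show (h.symm : S → S) = fun z => e.symm (e z - t) from funext hhsymm]
          exact h2.contMDiffWithinAt)
      have hmap : ∀ z ∈ h.source, φ' (h z) = g.map z := fun z hz => by
        obtain ⟨k1, ⟨k2, k3⟩, k4⟩ := (hhs z).1 hz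
        rw [hh, hφ1 _ (hV1' _ k4), e.right_inv k3, add_sub_cancel_right, e.left_inv k2]
      have hsh : s ∈ h.source := (hhs s).2 ⟨hsV, ⟨hs, ht1⟩, ht2⟩
      refine ⟨H, OpenPartialHomeomorph.refl _, H1, H2, contDiffOn_id, contDiffOn_id, H3,
        fun w _ => ⟨trivial, rfl⟩, fun a' => ?_, fun b => H5 _ (hfix b).1 (hfix b).2,
        fun z hz => ⟨trivial, ?_⟩⟩
      · rcases eq_or_ne a' a with rfl | h'
        · exact ⟨(H4 _ hsh).1, Or.inl ((H4 _ hsh).2.trans hfa.symm)⟩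
        · obtain ⟨k1, k2⟩ := H5 _ (hfree a' h').1 (hfree a' h').2
          exact ⟨k1, Or.inl (k2.trans (hfa' a' h').symm)⟩
      · change g.map z = φ' (H z)
        rcases H6 z hz with h' | h' | ⟨h', h''⟩
        · rw [(H4 z h').2, hmap z h']
        · have h3 : H z = σ (h (σ z)) := by
            have := (H3 (σ z) (H4 _ h').1).2
            rw [hσσ] at this
            rw [this, (H4 _ h').2]
          rw [h3, φ'.equivariant, hmap _ h', g.map.equivariant, tau_tau]
        · rw [(H5 z h' h'').2, hφ2 z h' h'']
    · rcases eq_or_ne a' a with rfl | h'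
      · rw [hfa]; exact hKe hs'K
      · rw [hfa' a' h']; exact hc.1 a'
    · -- the coordinates
      have hloc : ∀ (e' : OpenPartialHomeomorph S ℝ) (z : S), z ∈ e'.source → z ∉ K → σ z ∉ K →
          ∀ i, localDeriv i e' φ' z = localDeriv i e' g.map z := fun e' z hz h1 h2 i => by
        have hesymm : Tendsto e'.symm (𝓝 (e' z)) (𝓝 z) := by
          simpa [ContinuousAt, e'.left_inv hz] using e'.continuousAt_symm (e'.map_source hz)
        exact Filter.EventuallyEq.iteratedDeriv_eq i (hesymm.eventually (hφeq z h1 h2))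
      refine Prod.ext (funext fun a' => ?_) (funext fun b => funext fun j => ?_)
      · rcases eq_or_ne a' a with rfl | h'
        · have h1 : ∀ i, localDeriv i e φ' s' = localDeriv i e g.map s := fun i => by
            have h2 : φ' ∘ e.symm =ᶠ[𝓝 (e s')] fun u => (g.map ∘ e.symm) (u - t) := by
              have hesymm : Tendsto e.symm (𝓝 (e s')) (𝓝 s') := by
                rw [hes']
                exact e.continuousAt_symm ht1
              filter_upwards [hesymm.eventually (hV.mem_nhds ht2),
                e.open_target.mem_nhds (show e s' ∈ e.target by rwa [hes'])] with u hu hu'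
              simp only [Function.comp_apply]
              rw [hφ1 _ (hV1' _ hu), e.right_inv hu']
            unfold localDeriv
            rw [h2.iteratedDeriv_eq i,
              congrFun (iteratedDeriv_comp_sub_const i (g.map ∘ e.symm) t) (e s'), hes',
              add_sub_cancel_right]
          refine Prod.ext ?_ (funext fun i => ?_)
          · simp only [JetChart.coord, hfa, Prod.fst_add, Prod.smul_fst, Pi.add_apply,
              Pi.smul_apply, Pi.single_eq_same, smul_eq_mul, mul_one]
            exact hes'
          · simp only [JetChart.coord, hfa, Prod.fst_add, Prod.smul_fst, Prod.snd_add,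
              Prod.smul_snd, Pi.add_apply, Pi.smul_apply, Pi.single_eq_same, smul_zero]
            exact (h1 i).trans (add_zero _).symm
        · refine Prod.ext ?_ (funext fun i => ?_)
          · simp [JetChart.coord, hfa' a' h', h']
          · simp only [JetChart.coord, hfa' a' h', Prod.fst_add, Prod.smul_fst,
              Pi.add_apply, Pi.smul_apply, Pi.single_eq_of_ne h', smul_zero, add_zero]
            exact hloc _ _ (hc.1 a') (hfree a' h').1 (hfree a' h').2 i
      · have h1 := hloc _ _ (hch.fixed_src b) (hfix b).1 (hfix b).2
        simp only [Prod.snd_add, Prod.smul_snd, smul_zero, add_zero]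
        have h3 := congrArg Prod.fst (h1 (2 * j + 1))
        have h4 := congrArg Prod.snd (h1 (2 * j))
        exact Prod.ext h3 h4
  have : Nonempty (MultiGerm σ A B) := ⟨g⟩
  choose! G hG using key
  exact ⟨G, (hst.and hsmall).mono fun t ht => hG t ht.1 ht.2⟩

end

section

variable {S : Type*} [TopologicalSpace S] [ChartedSpace ℝ S] {σ : SmoothInvolution S} {A B : Type}

/-! ### Equivariant vector fields with prescribed jets along curves -/

theorem taylorSeries_comb {f u : ℝ → ℝ} {t : ℝ} (hf : ContDiffAt ℝ ∞ f t)
    (hu : ContDiffAt ℝ ∞ u t) (N : ℕ) (a : ℕ → ℝ) :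
    taylorSeries (fun s => ∑ j ∈ Finset.range N, a j * (f s * u s ^ j)) t =
      ∑ j ∈ Finset.range N,
        PowerSeries.C (a j) * (taylorSeries f t * taylorSeries u t ^ j) := by
  rw [taylorSeries_sum _ fun j => contDiffAt_const.mul (hf.mul (hu.pow j))]
  refine Finset.sum_congr rfl fun j _ => ?_
  rw [taylorSeries_mul contDiffAt_const (hf.mul (hu.pow j)), taylorSeries_const,
    taylorSeries_mul hf (hu.pow j), taylorSeries_pow hu]

theorem lt_order_comb {f u : ℝ → ℝ} {t : ℝ} (hf : ContDiffAt ℝ ∞ f t)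
    (hu : ContDiffAt ℝ ∞ u t) (N : ℕ) (a : ℕ → ℝ) {i : ℕ}
    (h : (i : ℕ∞) < (taylorSeries f t).order) :
    iteratedDeriv i (fun s => ∑ j ∈ Finset.range N, a j * (f s * u s ^ j)) t = 0 := by
  rw [iteratedDeriv_eq_coeff, taylorSeries_comb hf hu, map_sum]
  refine mul_eq_zero_of_right _ (Finset.sum_eq_zero fun j _ => ?_)
  rw [PowerSeries.coeff_C_mul, PowerSeries.coeff_of_lt_order, mul_zero]
  refine lt_of_lt_of_le h ?_
  rw [PowerSeries.order_mul]
  exact le_self_add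

theorem exists_comb_iteratedDeriv {f u : ℝ → ℝ} {t : ℝ} (hf : ContDiffAt ℝ ∞ f t)
    (hu : ContDiffAt ℝ ∞ u t) {d e : ℕ} (he : 0 < e) (hfo : (taylorSeries f t).order = d)
    (huo : (taylorSeries u t).order = e) (N : ℕ) (c : ℕ → ℝ) :
    ∃ a : ℕ → ℝ, ∀ i < N,
      iteratedDeriv (d + e * i) (fun s => ∑ j ∈ Finset.range N, a j * (f s * u s ^ j)) t = c i := by
  obtain ⟨a, ha⟩ := exists_sum_mul_pow_coeff he hfo huo N
    fun i => c i / (d + e * i).factorial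
  refine ⟨a, fun i hi => ?_⟩
  rw [iteratedDeriv_eq_coeff, taylorSeries_comb hf hu, ha i hi]
  field_simp

/-- Jets with vanishing value along one curve are realized by equivariant vector fields that are
flat along another one. -/
theorem exists_field_jet {F₁ F₂ U : ℝ × ℝ → ℝ} (hF₁ : ContDiff ℝ ∞ F₁) (hF₂ : ContDiff ℝ ∞ F₂)
    (hU : ContDiff ℝ ∞ U) (τF₁ : ∀ v, F₁ (tau v) = -F₁ v) (τF₂ : ∀ v, F₂ (tau v) = F₂ v)
    (τU : ∀ v, U (tau v) = U v) {γ : ℝ → ℝ × ℝ} {t : ℝ} (hγ : ContDiffAt ℝ ∞ γ t)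
    (o₁ : (taylorSeries (F₁ ∘ γ) t).order = 1) (o₂ : (taylorSeries (F₂ ∘ γ) t).order = 1)
    (oU : (taylorSeries (U ∘ γ) t).order = 1) (k : ℕ) (w : Fin (k + 1) → ℝ × ℝ) (hw : w 0 = 0) :
    ∃ X : ℝ × ℝ → ℝ × ℝ, ContDiff ℝ ∞ X ∧ (∀ v, X (tau v) = tau (X v)) ∧
      (∀ i : Fin (k + 1), iteratedDeriv i (X ∘ γ) t = w i) ∧
      ∀ (δ : ℝ → ℝ × ℝ) (s : ℝ), ContDiffAt ℝ ∞ δ s →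
        (k : ℕ∞) < (taylorSeries (F₁ ∘ δ) s).order → (k : ℕ∞) < (taylorSeries (F₂ ∘ δ) s).order →
        ∀ i : Fin (k + 1), iteratedDeriv i (X ∘ δ) s = 0 := by
  have hs : ∀ {F : ℝ × ℝ → ℝ} {δ : ℝ → ℝ × ℝ} {s : ℝ}, ContDiff ℝ ∞ F → ContDiffAt ℝ ∞ δ s →
    ContDiffAt ℝ ∞ (F ∘ δ) s := fun hF hδ => hF.contDiffAt.comp _ hδ
  -- The products of `F₁` or `F₂` with `U ^ j` have order `1 + j` along `γ`, so the target jet is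
  -- shifted by one; its value vanishes by hypothesis. Entries beyond `k` are never used.
  let W : ℕ → ℝ × ℝ := fun i => if h : i + 1 < k + 1 then w ⟨i + 1, h⟩ else 0
  obtain ⟨a, ha⟩ := exists_comb_iteratedDeriv (hs hF₁ hγ) (hs hU hγ) one_pos
    (d := 1) (by simpa using o₁) (by simpa using oU) k fun i => (W i).1
  obtain ⟨b, hb⟩ := exists_comb_iteratedDeriv (hs hF₂ hγ) (hs hU hγ) one_pos
    (d := 1) (by simpa using o₂) (by simpa using oU) k fun i => (W i).2
  have hX1 : ∀ (F : ℝ × ℝ → ℝ) (a : ℕ → ℝ), ContDiff ℝ ∞ F →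
      ContDiff ℝ ∞ fun v => ∑ j ∈ Finset.range k, a j * (F v * U v ^ j) := fun F a hF =>
    ContDiff.sum fun j _ => contDiff_const.mul (hF.mul (hU.pow j))
  have hX : ContDiff ℝ ∞ fun v => (∑ j ∈ Finset.range k, a j * (F₁ v * U v ^ j),
      ∑ j ∈ Finset.range k, b j * (F₂ v * U v ^ j)) := (hX1 F₁ a hF₁).prodMk (hX1 F₂ b hF₂)
  refine ⟨_, hX, fun v => ?_, fun i => ?_, fun δ s hδ h1 h2 i => ?_⟩
  · simp only [τF₁, τF₂, τU]
    refine Prod.ext ?_ rfl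
    simp only [tau, ← Finset.sum_neg_distrib]
    exact Finset.sum_congr rfl fun j _ => by ring
  · have hγ' := (hX.contDiffAt.comp t hγ).nat i
    rcases i with ⟨_ | i, hi⟩
    · have h0 : w ⟨0, hi⟩ = 0 := hw
      rw [h0]
      refine Prod.ext ?_ ?_
      · rw [iteratedDeriv_fst hγ']
        exact lt_order_comb (hs hF₁ hγ) (hs hU hγ) k a (by rw [o₁]; exact zero_lt_one)
      · rw [iteratedDeriv_snd hγ']
        exact lt_order_comb (hs hF₂ hγ) (hs hU hγ) k b (by rw [o₂]; exact zero_lt_one)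
    · have hW : W i = w ⟨i + 1, hi⟩ := dif_pos hi
      have e1 : 1 + 1 * i = i + 1 := by omega
      rw [← hW]
      refine Prod.ext ?_ ?_
      · rw [iteratedDeriv_fst hγ']
        have := ha i (by omega)
        rwa [e1] at this
      · rw [iteratedDeriv_snd hγ']
        have := hb i (by omega)
        rwa [e1] at this
  · have hδ' := (hX.contDiffAt.comp s hδ).nat i
    have hi : (i : ℕ∞) ≤ k := by exact_mod_cast Nat.lt_succ_iff.1 i.2
    refine Prod.ext ?_ ?_
    · rw [iteratedDeriv_fst hδ']
      exact lt_order_comb (hs hF₁ hδ) (hs hU hδ) k a (hi.trans_lt h1)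
    · rw [iteratedDeriv_snd hδ']
      exact lt_order_comb (hs hF₂ hδ) (hs hU hδ) k b (hi.trans_lt h2)

/-- A function vanishing to first order along one curve and to high order along another one, if
two functions have independent pairs of derivatives along these curves. -/
theorem exists_separating {P Q : ℝ × ℝ → ℝ} (hP : ContDiff ℝ ∞ P) (hQ : ContDiff ℝ ∞ Q)
    (τP : ∀ v, P (tau v) = P v) (τQ : ∀ v, Q (tau v) = Q v) {γ δ : ℝ → ℝ × ℝ} {t s : ℝ}
    (hγ : ContDiffAt ℝ ∞ γ t) (hδ : ContDiffAt ℝ ∞ δ s) (Pγ : P (γ t) = 0) (Qγ : Q (γ t) = 0)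
    (Pδ : P (δ s) = 0) (Qδ : Q (δ s) = 0)
    (hdet : deriv (P ∘ γ) t * deriv (Q ∘ δ) s - deriv (P ∘ δ) s * deriv (Q ∘ γ) t ≠ 0) (k : ℕ) :
    ∃ p : ℝ × ℝ → ℝ, ContDiff ℝ ∞ p ∧ (∀ v, p (tau v) = p v) ∧
      (taylorSeries (p ∘ γ) t).order = 1 ∧ (k : ℕ∞) < (taylorSeries (p ∘ δ) s).order := by
  have hs : ∀ {F : ℝ × ℝ → ℝ} {δ : ℝ → ℝ × ℝ} {s : ℝ}, ContDiff ℝ ∞ F → ContDiffAt ℝ ∞ δ s →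
    ContDiffAt ℝ ∞ (F ∘ δ) s := fun hF hδ => hF.contDiffAt.comp _ hδ
  have hd : ∀ {F : ℝ × ℝ → ℝ} {δ : ℝ → ℝ × ℝ} {s : ℝ}, ContDiff ℝ ∞ F → ContDiffAt ℝ ∞ δ s →
    HasDerivAt (F ∘ δ) (deriv (F ∘ δ) s) s := fun hF hδ =>
      ((hs hF hδ).differentiableAt (by simp)).hasDerivAt
  set α₂ := deriv (P ∘ δ) s
  set β₂ := deriv (Q ∘ δ) s
  -- `lam` is the combination with zero derivative along `δ`, and its derivative along `γ` is the
  -- given determinant. `mu` has a non-zero derivative along `δ` and serves as parameter there.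
  let lam : ℝ × ℝ → ℝ := fun v => β₂ * P v - α₂ * Q v
  let mu : ℝ × ℝ → ℝ := fun v => α₂ * P v + β₂ * Q v
  have hlam : ContDiff ℝ ∞ lam := (contDiff_const.mul hP).sub (contDiff_const.mul hQ)
  have hmu : ContDiff ℝ ∞ mu := (contDiff_const.mul hP).add (contDiff_const.mul hQ)
  have dmu : HasDerivAt (mu ∘ δ) (α₂ * α₂ + β₂ * β₂) s :=
    ((hd hP hδ).const_mul α₂).add ((hd hQ hδ).const_mul β₂)
  have dlam : HasDerivAt (lam ∘ δ) (β₂ * α₂ - α₂ * β₂) s :=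
    ((hd hP hδ).const_mul β₂).sub ((hd hQ hδ).const_mul α₂)
  have dlam' : HasDerivAt (lam ∘ γ) (β₂ * deriv (P ∘ γ) t - α₂ * deriv (Q ∘ γ) t) t :=
    ((hd hP hγ).const_mul β₂).sub ((hd hQ hγ).const_mul α₂)
  have hne : α₂ * α₂ + β₂ * β₂ ≠ 0 := fun h => by
    have h1 : α₂ = 0 := by nlinarith [mul_self_nonneg α₂, mul_self_nonneg β₂]
    have h2 : β₂ = 0 := by nlinarith [mul_self_nonneg α₂, mul_self_nonneg β₂]
    exact hdet (by rw [h1, h2]; ring)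
  have omu : (taylorSeries (mu ∘ δ) s).order = 1 :=
    order_taylorSeries_eq_one (by simp [mu, Pδ, Qδ]) (by rwa [dmu.deriv])
  have omu2 : (taylorSeries (fun u => (mu ∘ δ) u ^ 2) s).order = (2 : ℕ) := by
    rw [taylorSeries_pow (hs hmu hδ), PowerSeries.order_pow, omu]
    simp
  -- Powers of `mu` from the second on match the derivatives of `lam` of orders `2` to `k + 1` along
  -- `δ`. Each is a multiple of `mu ^ 2`, so subtracting them does not change the first derivative
  -- along `γ`.
  obtain ⟨a, ha⟩ := exists_comb_iteratedDeriv ((hs hmu hδ).pow 2) (hs hmu hδ) one_pos omu2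
    (by simpa using omu) k fun i => iteratedDeriv (2 + 1 * i) (lam ∘ δ) s
  let q : ℝ × ℝ → ℝ := fun v => ∑ j ∈ Finset.range k, a j * (mu v ^ 2 * mu v ^ j)
  have hq : ContDiff ℝ ∞ q :=
    ContDiff.sum fun j _ => contDiff_const.mul ((hmu.pow 2).mul (hmu.pow j))
  have omu2' : (1 : ℕ∞) < (taylorSeries (fun u => (mu ∘ γ) u ^ 2) t).order := by
    have h1 : 1 ≤ (taylorSeries (mu ∘ γ) t).order := by
      refine PowerSeries.le_order _ 1 fun i hi => ?_
      obtain rfl : i = 0 := by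
        have : i < 1 := by exact_mod_cast hi
        omega
      simp [coeff_taylorSeries, mu, Pγ, Qγ]
    rw [taylorSeries_pow (hs hmu hγ), PowerSeries.order_pow, two_nsmul]
    calc (1 : ℕ∞) < 1 + 1 := by norm_num
      _ ≤ _ := add_le_add h1 h1
  have dq : deriv (q ∘ γ) t = 0 := by
    rw [← iteratedDeriv_one]
    exact lt_order_comb ((hs hmu hγ).pow 2) (hs hmu hγ) k a (by exact_mod_cast omu2')
  refine ⟨fun v => lam v - q v, hlam.sub hq, fun v => by simp only [lam, q, mu, τP, τQ], ?_, ?_⟩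
  · refine order_taylorSeries_eq_one ?_ ?_
    · simp [lam, q, mu, Pγ, Qγ]
    · have h2 := dlam'.sub (hd hq hγ)
      rw [dq, sub_zero] at h2
      rw [show (fun v => lam v - q v) ∘ γ = lam ∘ γ - q ∘ γ from rfl, h2.deriv]
      intro h3
      exact hdet (by linarith)
  · refine lt_of_lt_of_le (b := ((k + 2 : ℕ) : ℕ∞)) (by exact_mod_cast (by omega)) ?_
    refine PowerSeries.nat_le_order _ _ fun i hi => ?_
    rw [coeff_taylorSeries]
    refine div_eq_zero_iff.2 (Or.inl ?_)
    rw [show (fun v => lam v - q v) ∘ δ = lam ∘ δ - q ∘ δ from rfl,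
      iteratedDeriv_sub ((hs hlam hδ).nat i) ((hs hq hδ).nat i), sub_eq_zero]
    have low : i < 2 → iteratedDeriv i (q ∘ δ) s = 0 := fun hi =>
      lt_order_comb ((hs hmu hδ).pow 2) (hs hmu hδ) k a (by rw [omu2]; exact_mod_cast hi)
    rcases i with _ | _ | i
    · rw [low (by omega)]
      simp [lam, Pδ, Qδ]
    · rw [low (by omega), zero_add, iteratedDeriv_one, dlam.deriv]
      ring
    · have := ha i (by omega)
      rw [show i + 1 + 1 = 2 + 1 * i by omega, ← this]
      rfl

end

section

variable {S : Type*} [TopologicalSpace S] [ChartedSpace ℝ S] {σ : SmoothInvolution S} {A B : Type}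

/-! ### Multigerms in no singularity of parametric codimension two -/

theorem MultiGerm.contDiffAt_symm (g : MultiGerm σ A B) {e : OpenPartialHomeomorph S ℝ}
    (he : e ∈ IsManifold.maximalAtlas 𝓘(ℝ, ℝ) ∞ S) {s : S} (hs : s ∈ e.source) :
    ContDiffAt ℝ ∞ (g.map ∘ e.symm) (e s) :=
  contDiffAt_comp_symm he hs g.map.smooth.contMDiffAt

theorem MultiGerm.hasDerivAt_symm (g : MultiGerm σ A B) {e : OpenPartialHomeomorph S ℝ}
    (he : e ∈ IsManifold.maximalAtlas 𝓘(ℝ, ℝ) ∞ S) {s : S} (hs : s ∈ e.source) :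
    HasDerivAt (g.map ∘ e.symm) (localDeriv 1 e g.map s) (e s) := by
  rw [localDeriv, iteratedDeriv_one]
  exact ((g.contDiffAt_symm he hs).differentiableAt (by simp)).hasDerivAt

theorem not_isSingularity_of_isEmpty [IsEmpty A] [IsEmpty B] [Fintype A] [Fintype B] {k : ℕ}
    {D : Set (MultiJet σ k A B)} (hD : IsSingularity D 2) (g : MultiGerm σ A B) : g.jet k ∉ D := by
  intro hg
  obtain ⟨c, hc, T, hT, -⟩ := IsSingularity.exists_linearMap (r := 2) (by exact_mod_cast hD) hg
  have := le_of_ker_le hT (n := 0) 0 fun v _ => by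
    rw [Subsingleton.elim v 0, map_zero]
  omega

/-- Along a regular fixed-point branch `x` has order one. The fields with components `x ^ (2j + 1)`
and `x ^ (2j)` are equivariant and realize exactly the derivatives that equivariance allows, so
every direction is tangent to the class. -/
theorem not_isSingularity_of_fixed [IsManifold 𝓘(ℝ, ℝ) ∞ S] [IsEmpty A] [Fintype A] [Fintype B]
    {k : ℕ}
    {D : Set (MultiJet σ k A B)} (hD : IsSingularity D 2) (g : MultiGerm σ A B) {b : B}
    (hb : ∀ b', b' = b) (h : (der 1 g.map (g.fixedPt b)).1 ≠ 0) : g.jet k ∉ D := by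
  intro hg
  obtain ⟨c, hc, T, hT, hdir⟩ := IsSingularity.exists_linearMap (r := 2) (by exact_mod_cast hD) hg
  have hch := c.chartsAt hc
  set e := c.fixedChart b
  have he := hch.fixed_mem b
  have hs := hch.fixed_src b
  set γ := g.map ∘ e.symm with hγ_def
  have hγ : ContDiffAt ℝ ∞ γ (e (g.fixedPt b)) := g.contDiffAt_symm he hs
  have hγ1 : ContDiffAt ℝ ∞ (fun u => (γ u).1) (e (g.fixedPt b)) := hγ.fst
  have hx0 : (γ (e (g.fixedPt b))).1 = 0 := by
    simp only [hγ_def, Function.comp_apply, e.left_inv hs]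
    exact g.map.fst_fixed (g.fixedPt_eq b)
  have hx1 : deriv (fun u => (γ u).1) (e (g.fixedPt b)) ≠ 0 := by
    obtain ⟨r, hr, h1⟩ := exists_localDeriv_one_eq he (IsManifold.chart_mem_maximalAtlas _) hs
      (mem_chart_source ℝ _) (φ := g.map) g.map.smooth.contMDiffAt
    have h2 := (hasFDerivAt_fst (𝕜 := ℝ)).comp_hasDerivAt _ (g.hasDerivAt_symm he hs)
    have h3 : deriv (fun u => (γ u).1) (e (g.fixedPt b)) = (localDeriv 1 e g.map (g.fixedPt b)).1 :=
      h2.deriv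
    rw [h3, h1]
    exact mul_ne_zero hr h
  have ox := order_taylorSeries_eq_one hx0 hx1
  have oxx : (taylorSeries (fun u => (γ u).1 ^ 2) (e (g.fixedPt b))).order = (2 : ℕ) := by
    rw [taylorSeries_pow hγ1, PowerSeries.order_pow, ox]
    simp
  have o1 : (taylorSeries (fun _ => (1 : ℝ)) (e (g.fixedPt b))).order = (0 : ℕ) := by
    simpa using order_taylorSeries_eq_zero (f := fun _ => (1 : ℝ)) (t := e (g.fixedPt b)) (by simp)
  have := le_of_ker_le hT (n := 0) 0 fun v _ => by
    let W : ℕ → ℝ × ℝ := fun i => if h : i < k + 1 then v.2 b ⟨i, h⟩ else 0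
    obtain ⟨p, hp⟩ := exists_comb_iteratedDeriv hγ1 (hγ1.pow 2) two_pos (d := 1)
      (by simpa using ox) oxx (k + 1) fun i => (W i).1
    obtain ⟨q, hq⟩ := exists_comb_iteratedDeriv contDiffAt_const (hγ1.pow 2) two_pos o1 oxx (k + 1)
      fun i => (W i).2
    let X : ℝ × ℝ → ℝ × ℝ := fun w => (∑ j ∈ Finset.range (k + 1), p j * (w.1 * (w.1 ^ 2) ^ j),
      ∑ j ∈ Finset.range (k + 1), q j * (1 * (w.1 ^ 2) ^ j))
    have hX : ContDiff ℝ ∞ X := by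
      refine ContDiff.prodMk (ContDiff.sum fun j _ => ?_) (ContDiff.sum fun j _ => ?_) <;> fun_prop
    have hXτ : ∀ w, X (tau w) = tau (X w) := fun w => by
      refine Prod.ext ?_ ?_
      · simp only [X, tau, neg_sq, ← Finset.sum_neg_distrib]
        exact Finset.sum_congr rfl fun j _ => by ring
      · simp only [X, tau, neg_sq]
    have hXγ := fun n : ℕ => (hX.contDiffAt.comp _ hγ).nat n
    have hv : v = fieldJet c k g X := by
      refine Prod.ext (funext fun a => isEmptyElim a) (funext fun b' => funext fun j => ?_)
      rw [hb b']
      have hW : W j = v.2 b j := dif_pos j.2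
      rw [← hW]
      refine Prod.ext ?_ ?_
      · have h1 := hp j j.2
        rw [show 1 + 2 * (j : ℕ) = 2 * j + 1 by omega] at h1
        exact h1.symm.trans (iteratedDeriv_fst (hXγ _)).symm
      · have h1 := hq j j.2
        rw [zero_add] at h1
        exact h1.symm.trans (iteratedDeriv_snd (hXγ _)).symm
    rw [hv]
    exact hdir _ (isOrbitDirection_fieldJet k hc hX hXτ)
  omega

/-! ### Stable free germs -/

section Free

variable [IsManifold 𝓘(ℝ, ℝ) ∞ S] [T2Space S] [Fintype A] [Fintype B] [IsEmpty B] {k : ℕ}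
  {D : Set (MultiJet σ k A B)} {g : MultiGerm σ A B}

/-- Moving the base point and the fields from `exists_field_jet` give every direction in which the
value of the branch stays put. This has codimension at most two, whereas `D` has codimension three.
The data are required in all charts because the chart comes with `D`. -/
theorem false_of_one_free_branch (hD : IsSingularity D 2) (hg : g.jet k ∈ D)
    {a : A} (ha : ∀ a', a' = a) (hF : ∀ e ∈ IsManifold.maximalAtlas 𝓘(ℝ, ℝ) ∞ S,
      g.free a ∈ e.source → ∃ F₁ F₂ U : ℝ × ℝ → ℝ, ContDiff ℝ ∞ F₁ ∧ ContDiff ℝ ∞ F₂ ∧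
      ContDiff ℝ ∞ U ∧ (∀ v, F₁ (tau v) = -F₁ v) ∧ (∀ v, F₂ (tau v) = F₂ v) ∧
      (∀ v, U (tau v) = U v) ∧
      (taylorSeries (F₁ ∘ (g.map ∘ e.symm)) (e (g.free a))).order = 1 ∧
      (taylorSeries (F₂ ∘ (g.map ∘ e.symm)) (e (g.free a))).order = 1 ∧
      (taylorSeries (U ∘ (g.map ∘ e.symm)) (e (g.free a))).order = 1) : False := by
  classical
  obtain ⟨c, hc, T, hT, hdir⟩ := IsSingularity.exists_linearMap (r := 2) (by exact_mod_cast hD) hg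
  have hch := c.chartsAt hc
  have he := hch.free_mem a
  have hs := hch.free_src a
  obtain ⟨F₁, F₂, U, h1, h2, h3, τ1, τ2, τ3, o1, o2, o3⟩ := hF _ he hs
  have hcard : Fintype.card A = 1 := Fintype.card_eq_one_iff.2 ⟨a, ha⟩
  let L : JetCoord k A B →ₗ[ℝ] (Fin 2 → ℝ) :=
    { toFun := fun v => ![((v.1 a).2 0).1, ((v.1 a).2 0).2]
      map_add' := fun v w => by ext i; fin_cases i <;> simp
      map_smul' := fun r v => by ext i; fin_cases i <;> simp }
  have := le_of_ker_le hT L fun v hv => by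
    have h0 : (v.1 a).2 0 = 0 := Prod.ext (congrFun hv 0) (congrFun hv 1)
    obtain ⟨X, hX, hXτ, hXj, -⟩ := exists_field_jet h1 h2 h3 τ1 τ2 τ3 (g.contDiffAt_symm he hs)
      o1 o2 o3 k (v.1 a).2 h0
    have hv : v = (v.1 a).1 • (Pi.single a (1, 0), 0) + fieldJet c k g X := by
      refine Prod.ext (funext fun a' => ?_) (funext fun b => isEmptyElim b)
      rw [ha a']
      refine Prod.ext ?_ (funext fun i => ?_)
      · simp [fieldJet]
      · have : (v.1 a).2 i = ((fieldJet c k g X).1 a).2 i := (hXj i).symm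
        simpa using this
    rw [hv, map_add, map_smul, hdir _ (isOrbitDirection_move k hc a),
      hdir _ (isOrbitDirection_fieldJet k hc hX hXτ), smul_zero, add_zero]
  omega

/-- A single free branch crossing the axis obliquely. -/
theorem not_isSingularity_of_oblique (hD : IsSingularity D 2) {a : A} (ha : ∀ a', a' = a)
    (h0 : (g.map (g.free a)).1 = 0) (h1 : (der 1 g.map (g.free a)).1 ≠ 0)
    (h2 : (der 1 g.map (g.free a)).2 ≠ 0) : g.jet k ∉ D := fun hg => by
  refine false_of_one_free_branch hD hg ha fun e he hs => ?_
  obtain ⟨r, hr, hd⟩ := exists_localDeriv_one_eq he (IsManifold.chart_mem_maximalAtlas _) hs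
    (mem_chart_source ℝ _) (φ := g.map) g.map.smooth.contMDiffAt
  have hd1 := (hasFDerivAt_fst (𝕜 := ℝ)).comp_hasDerivAt _ (g.hasDerivAt_symm he hs)
  have hd2 := (hasFDerivAt_snd (𝕜 := ℝ)).comp_hasDerivAt _ (g.hasDerivAt_symm he hs)
  have o2 : (taylorSeries ((fun v : ℝ × ℝ => v.2 - (g.map (g.free a)).2) ∘ (g.map ∘ e.symm))
      (e (g.free a))).order = 1 := by
    refine order_taylorSeries_eq_one (by simp [e.left_inv hs]) ?_
    have h3 := (hd2.sub_const (g.map (g.free a)).2).deriv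
    refine ne_of_eq_of_ne h3 ?_
    rw [hd]
    exact mul_ne_zero hr h2
  -- Obliqueness means that the odd function `x` and the even function `y - y₀` both have order one
  -- along the branch.
  refine ⟨Prod.fst, fun v => v.2 - (g.map (g.free a)).2, fun v => v.2 - (g.map (g.free a)).2,
    contDiff_fst, by fun_prop, by fun_prop, fun _ => rfl, fun _ => rfl, fun _ => rfl, ?_, o2, o2⟩
  refine order_taylorSeries_eq_one (by simp [e.left_inv hs, h0]) ?_
  refine ne_of_eq_of_ne hd1.deriv ?_
  rw [hd]
  exact mul_ne_zero hr h1

/-- The product of the first coordinate with a function, off the axis. -/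
theorem order_fst_mul {p : ℝ × ℝ → ℝ} (hp : ContDiff ℝ ∞ p) {γ : ℝ → ℝ × ℝ} {t : ℝ}
    (hγ : ContDiffAt ℝ ∞ γ t) (h : (γ t).1 ≠ 0) :
    (taylorSeries ((fun v => v.1 * p v) ∘ γ) t).order = (taylorSeries (p ∘ γ) t).order := by
  have : (fun v => v.1 * p v) ∘ γ = fun u => (γ u).1 * (p ∘ γ) u := rfl
  rw [this, taylorSeries_mul hγ.fst (hp.contDiffAt.comp t hγ), PowerSeries.order_mul,
    order_taylorSeries_eq_zero h, zero_add]

theorem hasDerivAt_sq_sub {γ : ℝ → ℝ × ℝ} {t : ℝ} {v : ℝ × ℝ} (h : HasDerivAt γ v t) (q : ℝ) :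
    HasDerivAt ((fun w : ℝ × ℝ => w.1 ^ 2 - q) ∘ γ) (2 * (γ t).1 * v.1) t := by
  have h1 := ((hasFDerivAt_fst (𝕜 := ℝ)).comp_hasDerivAt _ h).pow 2
  refine (h1.sub_const q).congr_deriv ?_
  simp

theorem hasDerivAt_snd_sub {γ : ℝ → ℝ × ℝ} {t : ℝ} {v : ℝ × ℝ} (h : HasDerivAt γ v t) (q : ℝ) :
    HasDerivAt ((fun w : ℝ × ℝ => w.2 - q) ∘ γ) v.2 t := by
  have h1 : HasDerivAt (fun u => (γ u).2) v.2 t :=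
    (hasFDerivAt_snd (𝕜 := ℝ) (p := γ t)).comp_hasDerivAt t h
  exact h1.sub_const q

/-- A single immersed free branch off the axis. -/
theorem not_isSingularity_of_immersed (hD : IsSingularity D 2) {a : A} (ha : ∀ a', a' = a)
    (h0 : (g.map (g.free a)).1 ≠ 0) (h1 : der 1 g.map (g.free a) ≠ 0) : g.jet k ∉ D := fun hg => by
  refine false_of_one_free_branch hD hg ha fun e he hs => ?_
  obtain ⟨r, hr, hd⟩ := exists_localDeriv_one_eq he (IsManifold.chart_mem_maximalAtlas _) hs
    (mem_chart_source ℝ _) (φ := g.map) g.map.smooth.contMDiffAt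
  have hγt : (g.map ∘ e.symm) (e (g.free a)) = g.map (g.free a) := by simp [e.left_inv hs]
  have hd0 := g.hasDerivAt_symm he hs
  -- Off the axis `x` is a unit, so one even function `p` of order one suffices, with `x * p` as the
  -- odd one. Either `y - y₀` or `x ^ 2 - x₀ ^ 2` qualifies, since the branch is immersed.
  suffices h : ∃ p : ℝ × ℝ → ℝ, ContDiff ℝ ∞ p ∧ (∀ v, p (tau v) = p v) ∧
      (taylorSeries (p ∘ (g.map ∘ e.symm)) (e (g.free a))).order = 1 by
    obtain ⟨p, hp, τp, op⟩ := h
    refine ⟨fun v => v.1 * p v, p, p, contDiff_fst.mul hp, hp, hp, fun v => ?_, τp, τp, ?_, op, op⟩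
    · simp only [τp]
      simp [tau]
    · rw [order_fst_mul hp (g.contDiffAt_symm he hs) (by rwa [hγt]), op]
  by_cases hx : (der 1 g.map (g.free a)).1 = 0
  · have hy : (der 1 g.map (g.free a)).2 ≠ 0 := fun hy => h1 (Prod.ext hx hy)
    refine ⟨fun v => v.2 - (g.map (g.free a)).2, by fun_prop, fun _ => rfl,
      order_taylorSeries_eq_one (by simp [e.left_inv hs])
        (ne_of_eq_of_ne (hasDerivAt_snd_sub hd0 _).deriv ?_)⟩
    rw [hd]
    exact mul_ne_zero hr hy
  · refine ⟨fun v => v.1 ^ 2 - (g.map (g.free a)).1 ^ 2, by fun_prop, fun v => by simp [tau],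
      order_taylorSeries_eq_one (by simp [e.left_inv hs])
        (ne_of_eq_of_ne (hasDerivAt_sq_sub hd0 _).deriv ?_)⟩
    rw [hd, hγt]
    exact mul_ne_zero (mul_ne_zero two_ne_zero h0) (mul_ne_zero hr hx)

/-- Two free branches crossing transversally off the axis. -/
theorem not_isSingularity_of_transverse (hD : IsSingularity D 2) {a a' : A} (haa : a ≠ a')
    (ha : ∀ x, x = a ∨ x = a') (h0 : (g.map (g.free a)).1 ≠ 0)
    (hw : g.map (g.free a') = g.map (g.free a) ∨ g.map (g.free a') = tau (g.map (g.free a)))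
    (h1 : (g.map (g.free a)).1 * ((der 1 g.map (g.free a)).1 * (der 1 g.map (g.free a')).2) -
      (g.map (g.free a')).1 * ((der 1 g.map (g.free a')).1 * (der 1 g.map (g.free a)).2) ≠ 0) :
    g.jet k ∉ D := fun hg => by
  classical
  obtain ⟨c, hc, T, hT, hdir⟩ := IsSingularity.exists_linearMap (r := 2) (by exact_mod_cast hD) hg
  have hch := c.chartsAt hc
  have he := hch.free_mem a
  have hs := hch.free_src a
  have he' := hch.free_mem a'
  have hs' := hch.free_src a'
  set e := c.freeChart a
  set e' := c.freeChart a'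
  have hcard : Fintype.card A = 2 := by
    have : (Finset.univ : Finset A) = {a, a'} := by
      ext x
      simpa using ha x
    rw [← Finset.card_univ, this, Finset.card_pair haa]
  set z := g.map (g.free a) with hz
  set z' := g.map (g.free a') with hz'
  have hx' : z'.1 ^ 2 = z.1 ^ 2 := by rcases hw with h | h <;> simp [h, tau]
  have hy' : z'.2 = z.2 := by rcases hw with h | h <;> simp [h, tau]
  have h0' : z'.1 ≠ 0 := fun h => h0 (by
    rw [h] at hx'
    exact pow_eq_zero_iff two_ne_zero |>.1 (by rw [← hx']; simp))
  obtain ⟨r, hr, hd⟩ := exists_localDeriv_one_eq he (IsManifold.chart_mem_maximalAtlas _) hs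
    (mem_chart_source ℝ _) (φ := g.map) g.map.smooth.contMDiffAt
  obtain ⟨r', hr', hd'⟩ := exists_localDeriv_one_eq he' (IsManifold.chart_mem_maximalAtlas _) hs'
    (mem_chart_source ℝ _) (φ := g.map) g.map.smooth.contMDiffAt
  have hγt : (g.map ∘ e.symm) (e (g.free a)) = z := by simp [e.left_inv hs, hz]
  have hγt' : (g.map ∘ e'.symm) (e' (g.free a')) = z' := by simp [e'.left_inv hs', hz']
  have hγ := g.contDiffAt_symm he hs
  have hγ' := g.contDiffAt_symm he' hs'
  -- `P` and `Q` are coordinates on the quotient by `tau` off the axis. Both branches pass through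
  -- the same point there, even if their images are mirror images of each other.
  let P : ℝ × ℝ → ℝ := fun v => v.1 ^ 2 - z.1 ^ 2
  let Q : ℝ × ℝ → ℝ := fun v => v.2 - z.2
  have hP : ContDiff ℝ ∞ P := by fun_prop
  have hQ : ContDiff ℝ ∞ Q := by fun_prop
  have τP : ∀ v, P (tau v) = P v := fun v => by simp [P, tau]
  have τQ : ∀ v, Q (tau v) = Q v := fun v => rfl
  have Pz : P z = 0 := sub_self _
  have Qz : Q z = 0 := sub_self _
  have Pz' : P z' = 0 := sub_eq_zero.2 hx'
  have Qz' : Q z' = 0 := sub_eq_zero.2 hy'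
  have dP := (hasDerivAt_sq_sub (g.hasDerivAt_symm he hs) (z.1 ^ 2)).deriv
  have dQ := (hasDerivAt_snd_sub (g.hasDerivAt_symm he hs) z.2).deriv
  have dP' := (hasDerivAt_sq_sub (g.hasDerivAt_symm he' hs') (z.1 ^ 2)).deriv
  have dQ' := (hasDerivAt_snd_sub (g.hasDerivAt_symm he' hs') z.2).deriv
  rw [hγt, hd] at dP
  rw [hγt', hd'] at dP'
  rw [hd] at dQ
  rw [hd'] at dQ'
  have hdet : deriv (P ∘ (g.map ∘ e.symm)) (e (g.free a)) *
      deriv (Q ∘ (g.map ∘ e'.symm)) (e' (g.free a')) -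
      deriv (P ∘ (g.map ∘ e'.symm)) (e' (g.free a')) *
      deriv (Q ∘ (g.map ∘ e.symm)) (e (g.free a)) ≠ 0 := by
    rw [dP, dQ, dP', dQ']
    refine ne_of_eq_of_ne ?_ (mul_ne_zero (mul_ne_zero two_ne_zero (mul_ne_zero hr hr')) h1)
    simp only [Prod.smul_fst, Prod.smul_snd, smul_eq_mul, der]
    ring
  obtain ⟨p, hp, τp, op, op'⟩ := exists_separating hP hQ τP τQ hγ hγ' (by rw [hγt, Pz])
    (by rw [hγt, Qz]) (by rw [hγt', Pz']) (by rw [hγt', Qz']) hdet k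
  obtain ⟨q, hq, τq, oq, oq'⟩ := exists_separating hP hQ τP τQ hγ' hγ (by rw [hγt', Pz'])
    (by rw [hγt', Qz']) (by rw [hγt, Pz]) (by rw [hγt, Qz])
    (fun h => hdet (by linear_combination -h)) k
  have hfield : ∀ {p : ℝ × ℝ → ℝ}, (∀ v, p (tau v) = p v) →
      ∀ v, (tau v).1 * p (tau v) = -(v.1 * p v) := fun h v => by rw [h]; simp [tau]
  -- Three equations reduce the values at the two branches to a common vertical vector, which the
  -- constant equivariant field `(0, y)` provides. The codimension of `D` is four.
  let L : JetCoord k A B →ₗ[ℝ] (Fin 3 → ℝ) :=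
    { toFun := fun v => ![((v.1 a).2 0).1, ((v.1 a').2 0).1, ((v.1 a).2 0).2 - ((v.1 a').2 0).2]
      map_add' := fun v w => by
        ext i
        fin_cases i
        · simp
        · simp
        · simp [add_sub_add_comm]
      map_smul' := fun r v => by
        ext i
        fin_cases i
        · simp
        · simp
        · simp [mul_sub] }
  have := le_of_ker_le hT L fun v hv => by
    have k1 : ((v.1 a).2 0).1 = 0 := congrFun hv 0
    have k2 : ((v.1 a').2 0).1 = 0 := congrFun hv 1
    have k3 : ((v.1 a).2 0).2 = ((v.1 a').2 0).2 := sub_eq_zero.1 (congrFun hv 2)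
    set y := ((v.1 a).2 0).2 with hy
    obtain ⟨X, hX, hXτ, hXj, hX0⟩ := exists_field_jet (contDiff_fst.mul hp) hp hp (hfield τp) τp τp
      hγ (by rw [order_fst_mul hp hγ (by rwa [hγt]), op]) op op k
      (fun i => if i = 0 then 0 else (v.1 a).2 i) (by simp)
    obtain ⟨Y, hY, hYτ, hYj, hY0⟩ := exists_field_jet (contDiff_fst.mul hq) hq hq (hfield τq) τq τq
      hγ' (by rw [order_fst_mul hq hγ' (by rwa [hγt']), oq]) oq oq k
      (fun i => if i = 0 then 0 else (v.1 a').2 i) (by simp)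
    have hX0' := hX0 _ _ hγ' (by rwa [order_fst_mul hp hγ' (by rwa [hγt'])]) op'
    have hY0' := hY0 _ _ hγ (by rwa [order_fst_mul hq hγ (by rwa [hγt])]) oq'
    have hC : ∀ (x : A) (i : Fin (k + 1)), localDeriv i (c.freeChart x)
        ((fun _ : ℝ × ℝ => ((0 : ℝ), y)) ∘ g.map) (g.free x) = if i = 0 then (0, y) else 0 :=
      fun x i => by
        have : ((fun _ : ℝ × ℝ => ((0 : ℝ), y)) ∘ g.map) ∘ (c.freeChart x).symm =
          fun _ => ((0 : ℝ), y) := rfl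
        rw [localDeriv, this, iteratedDeriv_const]
        exact if_congr Fin.val_eq_zero_iff rfl rfl
    -- Two moves of base points, one field acting on each branch and flat on the other, and the
    -- constant vertical field for the common value.
    have hv : v = (v.1 a).1 • (Pi.single a (1, 0), 0) + (v.1 a').1 • (Pi.single a' (1, 0), 0) +
        (fieldJet c k g X + fieldJet c k g Y) + fieldJet c k g fun _ => (0, y) := by
      refine Prod.ext (funext fun x => ?_) (funext fun b => isEmptyElim b)
      rcases ha x with rfl | rfl
      · refine Prod.ext ?_ (funext fun i => ?_)
        · simp [fieldJet, haa]
        · have e1 : ((fieldJet c k g X).1 x).2 i = _ := hXj i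
          have e2 : ((fieldJet c k g Y).1 x).2 i = _ := hY0' i
          have e3 : ((fieldJet c k g fun _ => (0, y)).1 x).2 i = _ := hC x i
          simp only [Prod.fst_add, Prod.snd_add, Pi.add_apply, e1, e2, e3, Prod.smul_fst,
            Prod.smul_snd, Pi.smul_apply, Pi.single_eq_same, Pi.single_eq_of_ne haa, smul_zero,
            Prod.snd_zero, Pi.zero_apply]
          split_ifs with h
          · rw [h]
            exact Prod.ext (by simp [k1]) (by simp [hy])
          · simp
      · refine Prod.ext ?_ (funext fun i => ?_)
        · simp [fieldJet, haa.symm]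
        · have e1 : ((fieldJet c k g X).1 x).2 i = _ := hX0' i
          have e2 : ((fieldJet c k g Y).1 x).2 i = _ := hYj i
          have e3 : ((fieldJet c k g fun _ => (0, y)).1 x).2 i = _ := hC x i
          simp only [Prod.fst_add, Prod.snd_add, Pi.add_apply, e1, e2, e3, Prod.smul_fst,
            Prod.smul_snd, Pi.smul_apply, Pi.single_eq_same, Pi.single_eq_of_ne haa.symm, smul_zero,
            Prod.snd_zero, Pi.zero_apply]
          split_ifs with h
          · rw [h]
            exact Prod.ext (by simp [k2]) (by simp [k3])
          · simp
    rw [hv, map_add, map_add, map_add, map_add, map_smul, map_smul,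
      hdir _ (isOrbitDirection_move k hc a), hdir _ (isOrbitDirection_move k hc a'),
      hdir _ (isOrbitDirection_fieldJet k hc hX hXτ),
      hdir _ (isOrbitDirection_fieldJet k hc hY hYτ),
      hdir _ (isOrbitDirection_fieldJet k hc contDiff_const fun v => by simp [tau])]
    simp
  omega

end Free

end

section

variable {S : Type*} [TopologicalSpace S] [ChartedSpace ℝ S] {σ : SmoothInvolution S} {A B : Type}

/-! ### The five kinds -/

/-- Split the branches into those over the orbit of one image point and the rest. If both groups
were non-empty, taking the full jet spaces as `D₁` and `D₂` would make `g` a coincidence. -/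
theorem exists_common_image [Nonempty (A ⊕ B)] {g : MultiGerm σ A B} (h : ¬ IsCoincidence g) :
    ∃ w, (∀ a, g.map (g.free a) = w ∨ g.map (g.free a) = tau w) ∧
      ∀ b, g.map (g.fixedPt b) = w ∨ g.map (g.fixedPt b) = tau w := by
  obtain ⟨w, hw⟩ : ∃ w, (∃ a, g.map (g.free a) = w) ∨ ∃ b, g.map (g.fixedPt b) = w := by
    obtain ⟨a | b⟩ := ‹Nonempty (A ⊕ B)›
    exacts [⟨_, Or.inl ⟨a, rfl⟩⟩, ⟨_, Or.inr ⟨b, rfl⟩⟩]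
  let P : Set A := {a | g.map (g.free a) = w ∨ g.map (g.free a) = tau w}
  let Q : Set B := {b | g.map (g.fixedPt b) = w ∨ g.map (g.fixedPt b) = tau w}
  by_contra hne
  refine h ⟨P, Q, ?_, ?_, 0, 0, Set.univ, Set.univ, g, rfl, trivial, trivial, ?_⟩
  · exact hw.imp (fun ⟨a, ha⟩ => ⟨a, Or.inl ha⟩) fun ⟨b, hb⟩ => ⟨b, Or.inl hb⟩
  · by_contra! hcon
    rw [Set.compl_empty_iff, Set.compl_empty_iff] at hcon
    exact hne ⟨w, fun a => (hcon.1 ▸ Set.mem_univ a : a ∈ P), fun b =>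
      (hcon.2 ▸ Set.mem_univ b : b ∈ Q)⟩
  · have hτ : ∀ {v}, (tau v = w ∨ tau v = tau w) → v = w ∨ v = tau w := fun {v} hv => by
      rcases hv with hv | hv
      · exact Or.inr (by rw [← hv, tau_tau])
      · exact Or.inl (by rw [← tau_tau v, hv, tau_tau])
    refine Set.disjoint_left.2 fun v hv hv' => ?_
    have h1 : v = w ∨ v = tau w := by
      rcases hv with ⟨⟨a, ha⟩, rfl⟩ | ⟨⟨a, ha⟩, rfl⟩ | ⟨⟨b, hb⟩, rfl⟩
      · exact ha
      · refine hτ ?_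
        change tau (g.map (σ (g.free a))) = w ∨ tau (g.map (σ (g.free a))) = tau w
        rwa [g.map.equivariant, tau_tau]
      · exact hb
    rcases hv' with ⟨⟨a, ha⟩, rfl⟩ | ⟨⟨a, ha⟩, rfl⟩ | ⟨⟨b, hb⟩, rfl⟩
    · exact ha h1
    · refine ha (hτ ?_)
      rwa [← g.map.equivariant]
    · exact hb h1

theorem EquivariantMap.exists_der_sigma [IsManifold 𝓘(ℝ, ℝ) ∞ S]
    (φ : EquivariantMap σ) (s : S) :
    ∃ c : ℝ, c ≠ 0 ∧ der 1 φ (σ s) = c • tau (der 1 φ s) := by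
  have hσ : σ (σ s) = s := σ.involutive s
  obtain ⟨c, hc, h⟩ := localDeriv_one_transfer (σ.srcDiffeoAt (σ s))
    (IsManifold.chart_mem_maximalAtlas (I := 𝓘(ℝ, ℝ)) (n := ∞) (σ s))
    (IsManifold.chart_mem_maximalAtlas (I := 𝓘(ℝ, ℝ)) (n := ∞) s) (mem_chart_source ℝ _)
    (by rw [hσ]; exact mem_chart_source ℝ s)
  have h1 := h φ φ tauL φ.smooth.contMDiffAt tauL.differentiableAt
    (Eventually.of_forall fun z => by
      change φ z = tau (φ (σ z))
      rw [φ.equivariant, tau_tau])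
  rw [ContinuousLinearMap.fderiv, hσ] at h1
  exact ⟨c, hc, h1⟩

/-- The difference of squares factors, up to sign, into the two determinants that must not vanish;
in particular the derivative itself is non-zero. -/
theorem transverseToGenTangent_of_regular {φ : S → ℝ × ℝ} {s : S} {u : ℝ × ℝ}
    (h : (u.1 * (der 1 φ s).2) ^ 2 - (u.2 * (der 1 φ s).1) ^ 2 ≠ 0) :
    TransverseToGenTangent u φ s := by
  refine ⟨_, ⟨1, le_rfl, fun i h1 h2 => by omega, rfl, fun h0 => h (by simp [h0])⟩,
    fun h1 => h ?_, fun h1 => h ?_⟩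
  · rw [det2] at h1
    linear_combination (u.1 * (der 1 φ s).2 + u.2 * (der 1 φ s).1) * h1
  · simp only [det2, tau] at h1
    linear_combination (u.1 * (der 1 φ s).2 - u.2 * (der 1 φ s).1) * h1

/-- The disjunction of the five kinds. -/
def IsOfFiveKinds (g : MultiGerm σ A B) : Prop :=
  IsOffAxisSingularity g ∨ (IsOnAxisCusp g ∨ IsFixedPointCusp g) ∨
    IsAxialOrdinaryStrikethrough g ∨
    (IsLineTangency g ∨ IsPerpendicularTangency g ∨ IsObliqueTangency g ∨
      IsFixedPointTangency g) ∨ IsFixedThroughLineTangency g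

/-! ### Case analysis by position and number of branches -/

section Kinds

variable {k : ℕ} {D : Set (MultiJet σ k A B)} {g : MultiGerm σ A B}

/-- If all three alternatives fail, there are at most two branches, immersed and transverse up to
reflection. Such germs lie in no singularity of parametric codimension two. -/
theorem isOffAxisSingularity_of_mem [IsManifold 𝓘(ℝ, ℝ) ∞ S] [T2Space S] [Fintype A] [Fintype B]
    [IsEmpty B] [Nonempty A] (hD : IsSingularity D 2)
    (hg : g.jet k ∈ D) {w : ℝ × ℝ} (hw : w.1 ≠ 0)
    (hA : ∀ a, g.map (g.free a) = w ∨ g.map (g.free a) = tau w) : IsOffAxisSingularity g := by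
  refine ⟨⟨w, hw, ‹_›, hA⟩, ?_⟩
  by_contra! hcon
  obtain ⟨h1, h2, h3⟩ := hcon
  obtain ⟨a⟩ := ‹Nonempty A›
  have hx : (g.map (g.free a)).1 ≠ 0 := by
    rcases hA a with h | h <;> rw [h]
    · exact hw
    · exact neg_ne_zero.2 hw
  by_cases ha : ∀ a', a' = a
  · exact not_isSingularity_of_immersed hD ha hx (h1 a) hg
  · push Not at ha
    obtain ⟨a', ha'⟩ := ha
    have hall : ∀ x, x = a ∨ x = a' := fun x => by
      by_contra! hx
      exact hx.2 (h3 a a' x ha'.symm hx.1.symm).symm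
    obtain ⟨t1, t2⟩ := h2 a a' ha'.symm
    have hww : g.map (g.free a') = g.map (g.free a) ∨
        g.map (g.free a') = tau (g.map (g.free a)) := by
      rcases hA a with h | h <;> rcases hA a' with h' | h' <;> simp [h, h', tau_tau]
    refine not_isSingularity_of_transverse hD ha'.symm hall hx hww (fun h0 => ?_) hg
    rcases hww with e | e
    · refine t1 ⟨e.symm, h1 a, h1 a', ?_⟩
      rw [e, ← mul_sub] at h0
      have := (mul_eq_zero.1 h0).resolve_left hx
      rw [det2]
      linear_combination this
    · obtain ⟨c, hc, hd⟩ := g.map.exists_der_sigma (g.free a')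
      refine t2 ⟨by rw [g.map.equivariant, e, tau_tau], h1 a, ?_, ?_⟩
      · rw [hd]
        refine smul_ne_zero hc fun h => h1 a' ?_
        rw [← tau_tau (der 1 _ _), h]
        simp [tau]
      · have e1 : (g.map (g.free a')).1 = -(g.map (g.free a)).1 := by rw [e]; rfl
        have h4 : (g.map (g.free a)).1 * ((der 1 g.map (g.free a)).1 * (der 1 g.map (g.free a')).2 +
            (der 1 g.map (g.free a')).1 * (der 1 g.map (g.free a)).2) = 0 := by
          rw [e1] at h0
          linear_combination h0
        have := (mul_eq_zero.1 h4).resolve_left hx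
        rw [hd]
        simp only [det2, tau, Prod.smul_fst, Prod.smul_snd, smul_eq_mul]
        linear_combination c * this

/-- A free branch that is vertical or horizontal on the axis is tangent to its mirror image. -/
theorem isTangency_sigma [IsManifold 𝓘(ℝ, ℝ) ∞ S]
    {a : A} (h0 : (g.map (g.free a)).1 = 0) (h1 : der 1 g.map (g.free a) ≠ 0)
    (h : (der 1 g.map (g.free a)).1 = 0 ∨ (der 1 g.map (g.free a)).2 = 0) :
    IsTangency g.map (g.free a) (σ (g.free a)) := by
  obtain ⟨c, hc, hd⟩ := g.map.exists_der_sigma (g.free a)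
  refine ⟨by rw [g.map.equivariant, tau_eq_self_of_axis h0], h1, ?_, ?_⟩
  · rw [hd]
    refine smul_ne_zero hc fun h => h1 ?_
    rw [← tau_tau (der 1 _ _), h]
    simp [tau]
  · rw [hd]
    rcases h with h | h <;> simp [det2, tau, h]

/-- A line tangency has order one if the second derivative is not vertical. -/
theorem isTangencyOfOrder_one [IsManifold 𝓘(ℝ, ℝ) ∞ S]
    {a : A} (h0 : (g.map (g.free a)).1 = 0)
    (h1 : (der 1 g.map (g.free a)).1 = 0) (h2 : (der 1 g.map (g.free a)).2 ≠ 0)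
    (h3 : (der 2 g.map (g.free a)).1 ≠ 0) :
    IsTangencyOfOrder 1 g.map (g.free a) (σ (g.free a)) := by
  set s := g.free a
  have hne : der 1 g.map s ≠ 0 := fun h => h2 (by simp [h])
  refine ⟨isTangency_sigma h0 hne (Or.inl h1), ?_⟩
  have hφ : ∀ z, ContMDiffAt 𝓘(ℝ, ℝ) 𝓘(ℝ, ℝ × ℝ) ∞ g.map z := fun z => g.map.smooth.contMDiffAt
  set y₀ := (g.map s).2 with hy₀
  have hf : ContMDiff 𝓘(ℝ, ℝ) 𝓘(ℝ, ℝ) ∞ fun z => (g.map z).2 - y₀ := fun z =>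
    (contMDiffAt_snd (hφ z)).sub contMDiffAt_const
  have hcoord : ∀ z, (der 1 g.map z).2 ≠ 0 → ∃ e ∈ IsManifold.maximalAtlas 𝓘(ℝ, ℝ) ∞ S,
      z ∈ e.source ∧ ∀ x ∈ e.source, e x = (g.map x).2 - y₀ := fun z hz => by
    obtain ⟨e, he, hze, -, heq⟩ := exists_localCoord isOpen_univ hf.contMDiffOn (Set.mem_univ z)
      (IsManifold.chart_mem_maximalAtlas (I := 𝓘(ℝ, ℝ)) (n := ∞) z) (mem_chart_source ℝ z)
      (ne_of_eq_of_ne (hasDerivAt_snd_sub (g.hasDerivAt_symm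
        (IsManifold.chart_mem_maximalAtlas (I := 𝓘(ℝ, ℝ)) (n := ∞) z)
        (mem_chart_source ℝ z)) y₀).deriv hz)
    exact ⟨e, he, hze, fun x hx => (heq x).2 hx⟩
  obtain ⟨c, hc, hd⟩ := g.map.exists_der_sigma s
  obtain ⟨e, he, hs, hev⟩ := hcoord s h2
  obtain ⟨e', he', hs', hev'⟩ := hcoord (σ s) (by
    rw [hd]
    exact mul_ne_zero hc h2)
  have hes : e s = 0 := by rw [hev s hs, sub_self]
  have hes' : e' (σ s) = 0 := by
    rw [hev' _ hs', g.map.equivariant]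
    exact sub_self _
  have h0t : (0 : ℝ) ∈ e.target := hes ▸ e.map_source hs
  have h0t' : (0 : ℝ) ∈ e'.target := hes' ▸ e'.map_source hs'
  let X : ℝ → ℝ := fun t => (g.map (e.symm t)).1
  have hX : ∀ t ∈ e.target, ContDiffAt ℝ ∞ X t := fun t ht => by
    have := (g.contDiffAt_symm he (e.map_target ht)).fst
    rwa [e.right_inv ht] at this
  have hXi : ∀ i, iteratedDeriv i X 0 = (localDeriv i e g.map s).1 := fun i => by
    rw [localDeriv_fst he hs (hφ s), hes]
    rfl
  have hX0 : X 0 = 0 := by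
    have h4 : e.symm 0 = s := by rw [← hes, e.left_inv hs]
    change (g.map (e.symm 0)).1 = 0
    rw [h4, h0]
  have hX1 : iteratedDeriv 1 X 0 = 0 := by
    obtain ⟨r, hr, h⟩ := exists_localDeriv_one_eq he
      (IsManifold.chart_mem_maximalAtlas (I := 𝓘(ℝ, ℝ)) (n := ∞) s) hs (mem_chart_source ℝ _) (hφ s)
    rw [hXi, h]
    exact mul_eq_zero_of_right r h1
  have hX2 : iteratedDeriv 2 X 0 ≠ 0 := fun h => by
    have h4 := (flat_fst_iff he hs (hφ s)).2 ⟨h0, by rw [← hXi, hX1], by rw [← hXi, h]⟩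
    have h5 := flat_fst_transfer (srcDiffeoAt_id s)
      (IsManifold.chart_mem_maximalAtlas (I := 𝓘(ℝ, ℝ)) (n := ∞) s) he (mem_chart_source ℝ _) hs
      (hφ s) (axisDiffeoAt_id h0) EventuallyEq.rfl h4
    exact h3 ((flat_fst_iff (IsManifold.chart_mem_maximalAtlas (I := 𝓘(ℝ, ℝ)) (n := ∞) s)
      (mem_chart_source ℝ _) (hφ s)).1 h5).2.2
  have hXc : ContDiffOn ℝ ∞ X e.target := fun t ht => (hX t ht).contDiffWithinAt
  -- With `y - y₀` as parameter on both branches, the branch is the graph `x = X t` and its mirror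
  -- image is `x = -X t`. `Ψ` straightens the former, and the latter becomes the graph of `-2 * X`,
  -- of leading degree two.
  let Ψ : OpenPartialHomeomorph (ℝ × ℝ) (ℝ × ℝ) :=
    { toFun := fun v => (v.2 - y₀, v.1 - X (v.2 - y₀))
      invFun := fun v => (v.2 + X v.1, v.1 + y₀)
      source := (fun v : ℝ × ℝ => v.2 - y₀) ⁻¹' e.target
      target := Prod.fst ⁻¹' e.target
      map_source' := fun v hv => hv
      map_target' := fun v hv => by simpa using hv
      left_inv' := fun v hv => by simp
      right_inv' := fun v hv => by simp
      open_source := e.open_target.preimage (by fun_prop)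
      open_target := e.open_target.preimage continuous_fst
      continuousOn_toFun := by
        refine ContinuousOn.prodMk (by fun_prop) (continuousOn_fst.sub ?_)
        exact hXc.continuousOn.comp (by fun_prop) fun v hv => hv
      continuousOn_invFun := by
        refine ContinuousOn.prodMk (continuousOn_snd.add ?_) (by fun_prop)
        exact hXc.continuousOn.comp continuousOn_fst fun v hv => hv }
  have hΨ : ∀ v, Ψ v = (v.2 - y₀, v.1 - X (v.2 - y₀)) := fun v => rfl
  have hy : ∀ t ∈ e.target, (g.map (e.symm t)).2 - y₀ = t := fun t ht => by
    rw [← hev _ (e.map_target ht), e.right_inv ht]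
  have hy' : ∀ t ∈ e'.target, (g.map (e'.symm t)).2 - y₀ = t := fun t ht => by
    rw [← hev' _ (e'.map_target ht), e'.right_inv ht]
  have h2X : ∀ i, iteratedDeriv i (fun t => (-2) * X t) 0 = (-2) * iteratedDeriv i X 0 := fun i =>
    iteratedDeriv_const_mul_field _ _
  refine ⟨e, e', Ψ, fun t => (-2) * X t, he, he', hs, hes, hs', hes', ?_, ?_, ?_,
    contDiffAt_const.mul (hX 0 h0t), ?_, ?_, fun i hi => ?_, ?_⟩
  · refine ContDiffOn.prodMk (by fun_prop) (contDiffOn_fst.sub ?_)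
    exact hXc.comp (by fun_prop) fun v hv => hv
  · refine ContDiffOn.prodMk (contDiffOn_snd.add ?_) (by fun_prop)
    exact hXc.comp contDiffOn_fst fun v hv => hv
  · change (g.map s).2 - y₀ ∈ e.target
    rwa [sub_self]
  · filter_upwards [e.open_target.mem_nhds h0t] with t ht
    rw [hΨ, hy t ht]
    exact Prod.ext rfl (sub_self _)
  · have h4 : Tendsto (fun t => σ (e'.symm t)) (𝓝 0) (𝓝 s) := by
      have h5 : Tendsto e'.symm (𝓝 0) (𝓝 (σ s)) := by
        have := e'.continuousAt_symm h0t'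
        rwa [ContinuousAt, ← hes', e'.left_inv hs', hes'] at this
      have h6 := (σ.smooth.continuous.tendsto (σ s)).comp h5
      rwa [show σ.toFun (σ.toFun s) = s from σ.involutive s] at h6
    filter_upwards [e'.open_target.mem_nhds h0t', h4.eventually (e.open_source.mem_nhds hs)]
      with t ht ht'
    have h7 : e.symm t = σ (e'.symm t) := by
      rw [← e.left_inv ht', hev _ ht', g.map.equivariant]
      exact congrArg e.symm (hy' t ht).symm
    have h8 : X t = -(g.map (e'.symm t)).1 := by
      simp only [X, h7, g.map.equivariant, tau]
    rw [hΨ, hy' t ht, h8]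
    exact Prod.ext rfl (by ring)
  · have : i = 0 ∨ i = 1 := by omega
    rw [h2X]
    rcases this with rfl | rfl
    · rw [iteratedDeriv_zero, hX0, mul_zero]
    · rw [hX1, mul_zero]
  · rw [h2X]
    exact mul_ne_zero (by norm_num) hX2

theorem isAxialOrdinaryStrikethrough_of_oblique (hax : OnAxis g) {a : A}
    (hne : (∃ a', a' ≠ a) ∨ Nonempty B) (h1 : (der 1 g.map (g.free a)).1 ≠ 0)
    (h2 : (der 1 g.map (g.free a)).2 ≠ 0)
    (hA : ∀ a', a' ≠ a → TransverseToGenTangent (der 1 g.map (g.free a)) g.map (g.free a'))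
    (hB : ∀ b, TransverseToGenTangent (der 1 g.map (g.free a)) g.map (g.fixedPt b)) :
    IsAxialOrdinaryStrikethrough g := by
  obtain ⟨w, hw, hwA, hwB⟩ := hax
  exact ⟨w, hw, hwA, hwB, a, hne, h1, h2, hA, hB⟩

theorem transverseToGenTangent_fixed [IsManifold 𝓘(ℝ, ℝ) ∞ S]
    {u : ℝ × ℝ} {b : B} (hu : u.2 ≠ 0)
    (h : (der 1 g.map (g.fixedPt b)).1 ≠ 0) : TransverseToGenTangent u g.map (g.fixedPt b) := by
  refine transverseToGenTangent_of_regular ?_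
  have := (g.map.localDeriv_fixed (g.fixedPt_eq b)
    (IsManifold.chart_mem_maximalAtlas (I := 𝓘(ℝ, ℝ)) (n := ∞) _) (mem_chart_source ℝ _)).1
  rw [show (der 1 g.map (g.fixedPt b)).2 = 0 from this]
  have h3 := mul_ne_zero hu h
  simpa using h3

/-- Three branches use up the whole codimension, so no further condition holds: every free branch is
oblique and a fixed-point branch is regular. At most one branch is fixed, so any free branch strikes
through the others. -/
theorem isOfFiveKinds_of_card_eq_three [IsManifold 𝓘(ℝ, ℝ) ∞ S] [Fintype A] [Fintype B]
    (hax : OnAxis g) (hB : Fintype.card B ≤ 1)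
    (hcard : Fintype.card A + Fintype.card B = 3)
    (hlin : ∀ T : Finset (Cnd A B), ClosedCnd T → (∀ i ∈ T, Holds g i) → T.card = 0)
    (htan : ∀ a a', a ≠ a' → ¬ TangentIn (fun a => chartAt ℝ (g.free a)) g a a') :
    IsAxialOrdinaryStrikethrough g := by
  have hone : ∀ i, ClosedCnd {i} → ¬ Holds g i := fun i hi h => by
    have := hlin {i} hi (by simpa using h)
    simp at this
  have hA : ∀ a, (der 1 g.map (g.free a)).1 ≠ 0 ∧ (der 1 g.map (g.free a)).2 ≠ 0 := fun a =>
    ⟨hone (.inl (a, 0)) (by simp [ClosedCnd]), hone (.inl (a, 1)) (by simp [ClosedCnd])⟩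
  obtain ⟨a, a', haa⟩ := Fintype.one_lt_card_iff.1 (show 1 < Fintype.card A by omega)
  refine isAxialOrdinaryStrikethrough_of_oblique hax (Or.inl ⟨a', haa.symm⟩) (hA a).1 (hA a).2
    (fun x hx => transverseToGenTangent_of_regular fun h0 => ?_)
    fun b => transverseToGenTangent_fixed (hA a).2 (hone (.inr (b, 0)) (by simp [ClosedCnd]))
  exact htan a x hx.symm ⟨⟨(hA a).1, (hA a).2, (hA x).1, (hA x).2⟩, h0⟩

/-- Two conditions cannot hold together. If one branch is vertical or horizontal, the other is
therefore oblique and strikes through it; if both are oblique, they are either transverse up to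
reflection or form an oblique tangency. -/
theorem isOfFiveKinds_of_two_free [IsManifold 𝓘(ℝ, ℝ) ∞ S]
    [IsEmpty B] (hax : OnAxis g) {a a' : A} (haa : a ≠ a')
    (hall : ∀ x, x = a ∨ x = a')
    (hlin : ∀ T : Finset (Cnd A B), ClosedCnd T → (∀ i ∈ T, Holds g i) → T.card ≤ 1) :
    IsAxialOrdinaryStrikethrough g ∨ IsObliqueTangency g := by
  classical
  have htwo : ∀ i j, i ≠ j → ClosedCnd
      {i, j} → Holds g i → ¬ Holds g j := fun i j hij hT hi hj => by
    have := hlin {i, j} hT (by simpa using ⟨hi, hj⟩)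
    rw [Finset.card_pair hij] at this
    omega
  have strike : ∀ {a a' : A}, a ≠ a' → (∀ x, x = a ∨ x = a') → (der 1 g.map (g.free a)).1 ≠ 0 →
      (der 1 g.map (g.free a)).2 ≠ 0 →
      ((der 1 g.map (g.free a)).1 * (der 1 g.map (g.free a')).2) ^ 2 -
        ((der 1 g.map (g.free a)).2 * (der 1 g.map (g.free a')).1) ^ 2 ≠ 0 →
      IsAxialOrdinaryStrikethrough g := fun {a a'} haa hall h1 h2 h => by
    refine isAxialOrdinaryStrikethrough_of_oblique hax (Or.inl ⟨a', haa.symm⟩) h1 h2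
      (fun x hx => ?_) isEmptyElim
    rw [(hall x).resolve_left hx]
    exact transverseToGenTangent_of_regular h
  have hxy : ∀ x, (der 1 g.map (g.free x)).1 = 0 → (der 1 g.map (g.free x)).2 ≠ 0 := fun x =>
    htwo (.inl (x, 0)) (.inl (x, 1)) (by simp) (by simp [ClosedCnd])
  have other : ∀ {a a' : A}, a ≠ a' → (∀ x, x = a ∨ x = a') →
      ((der 1 g.map (g.free a)).1 = 0 ∨ (der 1 g.map (g.free a)).2 = 0) →
      IsAxialOrdinaryStrikethrough g := fun {a a'} haa hall h => by
    rcases h with h | h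
    · have k1 : (der 1 g.map (g.free a')).1 ≠ 0 :=
        htwo (.inl (a, 0)) (.inl (a', 0)) (by simp [haa]) (by simp [ClosedCnd]) h
      have k2 : (der 1 g.map (g.free a')).2 ≠ 0 :=
        htwo (.inl (a, 0)) (.inl (a', 1)) (by simp) (by simp [ClosedCnd]) h
      refine strike haa.symm (fun x => (hall x).symm) k1 k2 ?_
      rw [h]
      simpa using And.intro k1 (hxy a h)
    · have k1 : (der 1 g.map (g.free a')).1 ≠ 0 :=
        htwo (.inl (a, 1)) (.inl (a', 0)) (by simp) (by simp [ClosedCnd]) h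
      have k2 : (der 1 g.map (g.free a')).2 ≠ 0 :=
        htwo (.inl (a, 1)) (.inl (a', 1)) (by simp [haa]) (by simp [ClosedCnd]) h
      refine strike haa.symm (fun x => (hall x).symm) k1 k2 ?_
      have k3 : (der 1 g.map (g.free a)).1 ≠ 0 := fun h' => hxy a h' h
      rw [h]
      simpa using And.intro k2 k3
  by_cases ha : (der 1 g.map (g.free a)).1 = 0 ∨ (der 1 g.map (g.free a)).2 = 0
  · exact Or.inl (other haa hall ha)
  by_cases ha' : (der 1 g.map (g.free a')).1 = 0 ∨ (der 1 g.map (g.free a')).2 = 0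
  · exact Or.inl (other haa.symm (fun x => (hall x).symm) ha')
  push Not at ha ha'
  by_cases h0 : ((der 1 g.map (g.free a)).1 * (der 1 g.map (g.free a')).2) ^ 2 -
      ((der 1 g.map (g.free a)).2 * (der 1 g.map (g.free a')).1) ^ 2 = 0
  swap
  · exact Or.inl (strike haa hall ha.1 ha.2 h0)
  right
  obtain ⟨w, hw, hwA, -⟩ := hax
  refine ⟨‹_›, a, a', haa, hall, by rw [hwA]; exact hw, ?_, ha.1, ha.2⟩
  have hne : ∀ {v : ℝ × ℝ}, v.1 ≠ 0 → v ≠ 0 := fun h h' => h (by simp [h'])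
  rw [sq_sub_sq] at h0
  rcases mul_eq_zero.1 h0 with h | h
  · obtain ⟨c, hc, hd⟩ := g.map.exists_der_sigma (g.free a')
    refine Or.inr ⟨?_, hne ha.1, ?_, ?_⟩
    · rw [g.map.equivariant, hwA, hwA, tau_eq_self_of_axis hw]
    · rw [hd]
      exact smul_ne_zero hc (hne (neg_ne_zero.2 ha'.1))
    · rw [hd]
      simp only [det2, tau, Prod.smul_fst, Prod.smul_snd, smul_eq_mul]
      linear_combination c * h
  · exact Or.inl ⟨by rw [hwA, hwA], hne ha.1, hne ha'.1, h⟩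

/-- At most one condition is available. If it is spent on a vertical free branch, the tangency with
its mirror image has order one and the fixed-point branch is regular. If it is spent on a horizontal
one, that branch is tangent to the fixed-point branch. Otherwise the free branch is oblique and
strikes through. -/
theorem isOfFiveKinds_of_free_fixed [IsManifold 𝓘(ℝ, ℝ) ∞ S]
    (hax : OnAxis g) {a : A} {b : B} (ha : ∀ x, x = a)
    (hb : ∀ x, x = b)
        (hlin : ∀ T : Finset (Cnd A B), ClosedCnd T → (∀ i ∈ T, Holds g i) → T.card ≤ 1) :
    IsAxialOrdinaryStrikethrough g ∨ IsFixedPointTangency g ∨ IsFixedThroughLineTangency g := by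
  classical
  have htwo : ∀ i j, i ≠ j → ClosedCnd
      {i, j} → Holds g i → ¬ Holds g j := fun i j hij hT hi hj => by
    have := hlin {i, j} hT (by simpa using ⟨hi, hj⟩)
    rw [Finset.card_pair hij] at this
    omega
  obtain ⟨w, hw, hwA, hwB⟩ := hax
  have hax : OnAxis g := ⟨w, hw, hwA, hwB⟩
  have h0 : (g.map (g.free a)).1 = 0 := by rw [hwA, hw]
  have hne : ∀ {v : ℝ × ℝ}, v.1 ≠ 0 → v ≠ 0 := fun h h' => h (by simp [h'])
  obtain ⟨hb1, hb2⟩ := g.map.localDeriv_fixed (g.fixedPt_eq b)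
    (IsManifold.chart_mem_maximalAtlas (I := 𝓘(ℝ, ℝ)) (n := ∞) _) (mem_chart_source ℝ _)
  have hxy : (der 1 g.map (g.free a)).1 = 0 → (der 1 g.map (g.free a)).2 ≠ 0 :=
    htwo (.inl (a, 0)) (.inl (a, 1)) (by simp) (by simp [ClosedCnd])
  have hxb : (der 1 g.map (g.free a)).1 = 0 → (der 1 g.map (g.fixedPt b)).1 ≠ 0 :=
    htwo (.inl (a, 0)) (.inr (b, 0)) (by simp) (by simp [ClosedCnd])
  have hyb : (der 1 g.map (g.free a)).2 = 0 → (der 1 g.map (g.fixedPt b)).1 ≠ 0 :=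
    htwo (.inl (a, 1)) (.inr (b, 0)) (by simp) (by simp [ClosedCnd])
  have hxx : (der 1 g.map (g.free a)).1 = 0 → (der 2 g.map (g.free a)).1 ≠ 0 :=
    htwo (.inl (a, 0)) (.inl (a, 2)) (by simp) (by simp [ClosedCnd])
  have hbb : (der 1 g.map (g.fixedPt b)).1 = 0 → (der 2 g.map (g.fixedPt b)).2 ≠ 0 :=
    htwo (.inr (b, 0)) (.inr (b, 1)) (by simp) (by simp [ClosedCnd])
  by_cases h1 : (der 1 g.map (g.free a)).1 = 0
  · exact Or.inr (Or.inr ⟨a, b, ha, hb, by rw [hwA, hwB], hne (hxb h1),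
      isTangencyOfOrder_one h0 h1 (hxy h1) (hxx h1), h1⟩)
  by_cases h2 : (der 1 g.map (g.free a)).2 = 0
  · refine Or.inr (Or.inl ⟨a, b, ha, hb, ⟨by rw [hwA, hwB], hne h1, hne (hyb h2), ?_⟩,
      isTangency_sigma h0 (hne h1) (Or.inr h2)⟩)
    rw [det2, h2, show (der 1 g.map (g.fixedPt b)).2 = 0 from hb1]
    ring
  · refine Or.inl (isAxialOrdinaryStrikethrough_of_oblique hax (Or.inr ⟨b⟩) h1 h2
      (fun x hx => absurd (ha x) hx) fun x => ?_)
    rw [hb x]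
    by_cases h3 : (der 1 g.map (g.fixedPt b)).1 = 0
    · have h4 : (der 2 g.map (g.fixedPt b)).1 = 0 := hb2 h3
      -- At a fixed-point cusp `x''` vanishes by parity, so the generalized tangent is the vertical
      -- vector `(0, y'')`.
      refine ⟨_, ⟨2, one_le_two, fun i hi hi' => ?_, rfl, fun h => hbb h3 (by rw [h]; rfl)⟩, ?_, ?_⟩
      · obtain rfl : i = 1 := by omega
        exact Prod.ext h3 hb1
      · rw [det2, h4, mul_zero, sub_zero]
        exact mul_ne_zero h1 (hbb h3)
      · simp only [det2, tau, h4, neg_zero, mul_zero, sub_zero]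
        exact mul_ne_zero h1 (hbb h3)
    · exact transverseToGenTangent_fixed h2 h3

theorem isOfFiveKinds_of_one_free [IsManifold 𝓘(ℝ, ℝ) ∞ S] [T2Space S] [Fintype A] [Fintype B]
    [IsEmpty B] (hD : IsSingularity D 2) (hg : g.jet k ∈ D)
    (hax : OnAxis g) {a : A} (ha : ∀ x, x = a) :
    IsOnAxisCusp g ∨ IsLineTangency g ∨ IsPerpendicularTangency g := by
  obtain ⟨w, hw, hwA, hwB⟩ := hax
  have h0 : (g.map (g.free a)).1 = 0 := by rw [hwA, hw]
  by_cases h : der 1 g.map (g.free a) = 0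
  · exact Or.inl ⟨‹_›, a, ha, h0, h⟩
  by_cases h1 : (der 1 g.map (g.free a)).1 = 0
  · exact Or.inr (Or.inl ⟨‹_›, a, ha, h0, isTangency_sigma h0 h (Or.inl h1), h1⟩)
  by_cases h2 : (der 1 g.map (g.free a)).2 = 0
  · exact Or.inr (Or.inr ⟨‹_›, a, ha, h0, isTangency_sigma h0 h (Or.inr h2), h2⟩)
  exact absurd hg (not_isSingularity_of_oblique hD ha h0 h1 h2)

theorem isFixedPointCusp_of_mem [IsManifold 𝓘(ℝ, ℝ) ∞ S] [Fintype A] [Fintype B]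
    [IsEmpty A] (hD : IsSingularity D 2) (hg : g.jet k ∈ D) {b : B}
    (hb : ∀ x, x = b) : IsFixedPointCusp g := by
  refine ⟨‹_›, b, hb, ?_⟩
  by_contra h
  have h2 := (g.map.localDeriv_fixed (g.fixedPt_eq b)
    (IsManifold.chart_mem_maximalAtlas (I := 𝓘(ℝ, ℝ)) (n := ∞) _) (mem_chart_source ℝ _)).1
  exact not_isSingularity_of_fixed hD g hb (fun h1 => h (Prod.ext h1 h2)) hg

theorem isOfFiveKinds_of_onAxis [IsManifold 𝓘(ℝ, ℝ) ∞ S] [T2Space S] [Fintype A] [Fintype B]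
    [Nonempty (A ⊕ B)] (hD : IsSingularity D 2) (hg : g.jet k ∈ D)
    (hax : OnAxis g) (hB : Fintype.card B ≤ 1)
    (hlin : ∀ T : Finset (Cnd A B), ClosedCnd T → (∀ i ∈ T, Holds g i) →
      Fintype.card A + Fintype.card B + T.card ≤ 3)
    (htan : ∀ a a', a ≠ a' → 3 ≤ Fintype.card A + Fintype.card B →
      ¬ TangentIn (fun a => chartAt ℝ (g.free a)) g a a') : IsOfFiveKinds g := by
  classical
  have h3 := hlin ∅ (by simp [ClosedCnd]) (by simp)
  rw [Finset.card_empty, add_zero] at h3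
  have htwo : Fintype.card A + Fintype.card B = 2 → ∀ T : Finset (Cnd A B), ClosedCnd T →
      (∀ i ∈ T, Holds g i) → T.card ≤ 1 := fun h T hT hi => by
    have := hlin T hT hi
    omega
  have hpos : 0 < Fintype.card A + Fintype.card B := by
    rw [← Fintype.card_sum]
    exact Fintype.card_pos
  rcases Nat.lt_or_ge (Fintype.card A + Fintype.card B) 3 with hlt | hge
  swap
  · refine Or.inr (Or.inr (Or.inl (isOfFiveKinds_of_card_eq_three hax hB (by omega)
      (fun T hT h => ?_) fun a a' haa => htan a a' haa hge)))
    have := hlin T hT h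
    omega
  have hB01 : Fintype.card B = 0 ∨ Fintype.card B = 1 := by omega
  rcases hB01 with hB0 | hB1
  · have : IsEmpty B := Fintype.card_eq_zero_iff.1 hB0
    have hA12 : Fintype.card A = 1 ∨ Fintype.card A = 2 := by omega
    rcases hA12 with hA | hA
    · obtain ⟨a, ha⟩ := Fintype.card_eq_one_iff.1 hA
      rcases isOfFiveKinds_of_one_free hD hg hax ha with h | h | h
      · exact Or.inr (Or.inl (Or.inl h))
      · exact Or.inr (Or.inr (Or.inr (Or.inl (Or.inl h))))
      · exact Or.inr (Or.inr (Or.inr (Or.inl (Or.inr (Or.inl h)))))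
    · rw [← Finset.card_univ, Finset.card_eq_two] at hA
      obtain ⟨a, a', haa, huniv⟩ := hA
      have hall : ∀ x, x = a ∨ x = a' := fun x => by
        have := Finset.mem_univ x
        rw [huniv] at this
        simpa using this
      have hA : Fintype.card A = 2 := by rw [← Finset.card_univ, huniv, Finset.card_pair haa]
      rcases isOfFiveKinds_of_two_free hax haa hall (htwo (by omega)) with h | h
      · exact Or.inr (Or.inr (Or.inl h))
      · exact Or.inr (Or.inr (Or.inr (Or.inl (Or.inr (Or.inr (Or.inl h))))))
  · obtain ⟨b, hb⟩ := Fintype.card_eq_one_iff.1 hB1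
    have hA01 : Fintype.card A = 0 ∨ Fintype.card A = 1 := by omega
    rcases hA01 with hA | hA
    · have : IsEmpty A := Fintype.card_eq_zero_iff.1 hA
      exact Or.inr (Or.inl (Or.inr (isFixedPointCusp_of_mem hD hg hb)))
    · obtain ⟨a, ha⟩ := Fintype.card_eq_one_iff.1 hA
      rcases isOfFiveKinds_of_free_fixed hax ha hb (htwo (by omega)) with h | h | h
      · exact Or.inr (Or.inr (Or.inl h))
      · exact Or.inr (Or.inr (Or.inr (Or.inl (Or.inr (Or.inr (Or.inr h))))))
      · exact Or.inr (Or.inr (Or.inr (Or.inr h)))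

theorem isOfFiveKinds_of_mem [IsManifold 𝓘(ℝ, ℝ) ∞ S] [T2Space S] [Fintype A] [Fintype B]
    (hD : IsSingularity D 2) (hg : g.jet k ∈ D) (hF : g.map ∈ mapsF σ)
    (hco : ¬ IsCoincidence g)
    (hlin : ∀ T : Finset (Cnd A B), ClosedCnd T → LinStratum T g →
      Fintype.card A + Fintype.card B + T.card ≤ 3)
    (htan : ∀ a a', a ≠ a' → 3 ≤ Fintype.card A + Fintype.card B → ¬ TangentStratum a a' g) :
    IsOfFiveKinds g := by
  rcases isEmpty_or_nonempty (A ⊕ B) with hemp | hne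
  · have hA : IsEmpty A := ⟨fun a => hemp.false (.inl a)⟩
    have hB : IsEmpty B := ⟨fun b => hemp.false (.inr b)⟩
    exact absurd hg (not_isSingularity_of_isEmpty hD g)
  obtain ⟨w, hA, hB⟩ := exists_common_image hco
  by_cases hw : w.1 = 0
  · have hwτ : tau w = w := tau_eq_self_of_axis hw
    simp only [hwτ, or_self] at hA hB
    have hax : OnAxis g := ⟨w, hw, hA, hB⟩
    refine isOfFiveKinds_of_onAxis hD hg hax ?_ (fun T hT h => hlin T hT ⟨hax, h⟩)
      fun a a' haa h h' => htan a a' haa h ⟨hax, h'⟩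
    refine Fintype.card_le_one_iff.2 fun b b' => g.fixedPt_inj ?_
    exact hF _ _ (g.fixedPt_eq b) (g.fixedPt_eq b') ((hB b).trans (hB b').symm)
  · have hBe : IsEmpty B := ⟨fun b => by
      have h1 := g.map.fst_fixed (g.fixedPt_eq b)
      rcases hB b with h | h
      · exact hw (h ▸ h1)
      · rw [h] at h1
        exact hw (neg_eq_zero.1 h1)⟩
    have : Nonempty A := by
      obtain ⟨a | b⟩ := hne
      exacts [⟨a⟩, isEmptyElim b]
    exact Or.inl (isOffAxisSingularity_of_mem hD hg hw hA)

end Kinds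

end

end EquivSing

end

/-! ### The finite list of strata and the conclusion -/

open EquivSing

theorem mainTheorem6 {S : Type*} [TopologicalSpace S] [ChartedSpace ℝ S]
    [IsManifold 𝓘(ℝ, ℝ) ∞ S] [CompactSpace S] [T2Space S]
    (σ : SmoothInvolution S) (m n : ℕ) :
    ∃ (K : ℕ) (𝒲 : Set (Set (MultiJet σ K (Fin m) (Fin n)))),
      𝒲.Finite ∧
      (∀ W ∈ 𝒲, ∃ r : ℤ, 3 ≤ r ∧ IsSingularity W r) ∧
      ∀ (k : ℕ) (D : Set (MultiJet σ k (Fin m) (Fin n))), IsSingularity D 2 →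
        ∀ g : MultiGerm σ (Fin m) (Fin n), g.map ∈ mapsF σ → g.jet k ∈ D → ¬ IsCoincidence g →
          (IsOffAxisSingularity g ∨
            (IsOnAxisCusp g ∨ IsFixedPointCusp g) ∨
            IsAxialOrdinaryStrikethrough g ∨
            (IsLineTangency g ∨ IsPerpendicularTangency g ∨ IsObliqueTangency g ∨
              IsFixedPointTangency g) ∨
            IsFixedThroughLineTangency g) ∨
          ∃ W ∈ 𝒲, g.jet K ∈ W := by
  -- The parametric codimensions are `m + n - 1 + T.card` and `m + n`; the side conditions on `T`
  -- and on `m + n` say that these are at least three.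
  refine ⟨2, (fun T => jetClass 2 (LinStratum T)) ''
      {T : Finset (Cnd (Fin m) (Fin n)) | ClosedCnd T ∧ 4 ≤ m + n + T.card} ∪
    (fun p => jetClass 2 (TangentStratum p.1 p.2)) ''
      {p : Fin m × Fin m | p.1 ≠ p.2 ∧ 3 ≤ m + n},
    (Set.toFinite _).union (Set.toFinite _), ?_, fun k D hD g hF hg hco => ?_⟩
  · rintro _ (⟨T, ⟨hT, hcard⟩, rfl⟩ | ⟨⟨a, a'⟩, ⟨haa, hcard⟩, rfl⟩)
    -- A reference branch is needed for the equalities of heights; without branches there would be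
    -- no conditions either, against `hcard`.
    · have o : Nonempty (Fin m ⊕ Fin n) := by
        by_contra hne
        rw [not_nonempty_iff] at hne
        have hm : IsEmpty (Fin m) := ⟨fun a => hne.false (.inl a)⟩
        have hn : IsEmpty (Fin n) := ⟨fun b => hne.false (.inr b)⟩
        rw [Finset.eq_empty_of_isEmpty T, Finset.card_empty] at hcard
        have h1 : m = 0 := by_contra fun h => hm.false ⟨0, Nat.pos_of_ne_zero h⟩
        have h2 : n = 0 := by_contra fun h => hn.false ⟨0, Nat.pos_of_ne_zero h⟩
        omega
      refine ⟨_, ?_, isSingularity_linStratum hT o.some⟩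
      simp only [Fintype.card_fin]
      omega
    · refine ⟨_, ?_, isSingularity_tangentStratum haa⟩
      simp only [Fintype.card_fin]
      omega
  · refine or_iff_not_imp_right.2 fun hW => isOfFiveKinds_of_mem hD hg hF hco (fun T hT h => ?_)
      fun a a' haa hcard h => ?_
    · by_contra! hcard
      simp only [Fintype.card_fin] at hcard
      exact hW ⟨_, Or.inl ⟨T, ⟨hT, by omega⟩, rfl⟩, g, rfl, h⟩
    · simp only [Fintype.card_fin] at hcard
      exact hW ⟨_, Or.inr ⟨(a, a'), ⟨haa, hcard⟩, rfl⟩, g, rfl, h⟩
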